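/- For $N\ge 2$ let $\mathbb{S}^{N-1}(\sqrt N)\subset\mathbb{R}^N$ be the sphere of radius $\sqrt N$ with uniform probability measure $\sigma_N$, and for $\gamma\in[0,1]$ let $$\mathcal{L}_{N,\gamma}F(v)=-N\binom N2^{-1}\sum_{i<j}(1+v_i^2+v_j^2)^{\gamma}\,\frac1{2\pi}\int_{-\pi}^{\pi}\bigl(F(v)-F(R_{i,j,\theta}v)\bigr)\,d\theta ,$$ where $R_{i,j,\theta}$ replaces $v_i$ by $v_i\cos\theta+v_j\sin\theta$ and $v_j$ by $-v_i\sin\theta+v_j\cos\theta$ and fixes the other coordinates. The Kac master equation is $\partial_tF=\mathcal{L}_{N,\gamma}F$. A family of probability densities $F_N$ with respect to $\sigma_N$ ($N\ge2$) is called log-scalable with constant $C_F>0$ if $\sup_v|\log F_N(v)|\le C_FN$ for every $N$ (in particular $F_N>0$). Let $\Pi_1(F_N)$ be the first one-dimensional marginal of $F_N\,d\sigma_N$, $M_p(\mu)=\int_{\mathbb{R}}|x|^p\,d\mu(x)$, and $H_N(F)=\int F\log F\,d\sigma_N$. **Theorem.** Let $\gamma\in[0,1]$ and $k>1$. Let $(F_N)_{N\ge2}$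 be a family of probability densities on $\mathbb{S}^{N-1}(\sqrt N)$, each invariant under permutations of the coordinates, which is log-scalable with constant $C_F$ and satisfies $\sup_{N\ge 2}M_{2k}(\Pi_1(F_N))<\infty$. For each $N\ge 2$ let $F_N(t)$, $t\ge0$, be the (bounded) solution of the Kac master equation with initial datum $F_N$. Then: 1. for every $t\ge0$ the family $(F_N(t))_{N\ge2}$ consists of probability densities and is log-scalable with the same constant $C_F$; 2. $\displaystyle\sup_{N\ge2}\,\sup_{t\ge0}M_{2k}(\Pi_1(F_N(t)))<\infty$; 3. if $\gamma<1$, there is a constant $C>0$, independent of $N$ and $t$, such that for all $N\ge2$ and $t\ge0$ $$\frac{H_N(F_N(t))}{N}\le\left(\left(\frac{H_N(F_N)}{N}\right)^{\frac{\gamma-1}{k-1}}+C\,N^{\frac{\gamma-1}{k-1}}\,t\right)^{-\frac{k-1}{1-\gamma}},$$ where, if $H_N(F_N)=0$, the right-hand side is read as $0$. -/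

import Mathlib

open MeasureTheory
open scoped ENNReal

noncomputable section

/-- The sphere of radius `√N` centred at the origin of Euclidean `ℝ^N`. -/
abbrev KacSphere (N : ℕ) : Type :=
  Metric.sphere (0 : EuclideanSpace ℝ (Fin N)) (Real.sqrt N)

/-- Dilation by the factor `√N`, from the unit sphere onto the sphere of radius `√N`. -/
def kacDilation (N : ℕ) (u : Metric.sphere (0 : EuclideanSpace ℝ (Fin N)) 1) : KacSphere N :=
  ⟨Real.sqrt N • (u : EuclideanSpace ℝ (Fin N)), by
    have hu : ‖(u : EuclideanSpace ℝ (Fin N))‖ = 1 := by simp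
    rw [mem_sphere_zero_iff_norm, norm_smul, hu, mul_one, Real.norm_of_nonneg (Real.sqrt_nonneg _)]⟩

/-- The uniform probability measure `σ_N` on the sphere of radius `√N`: the surface measure of the
unit sphere, normalised to total mass one and transported by dilation. -/
def kacSigma (N : ℕ) : Measure (KacSphere N) :=
  let s : Measure (Metric.sphere (0 : EuclideanSpace ℝ (Fin N)) 1) :=
    (volume : Measure (EuclideanSpace ℝ (Fin N))).toSphere
  ((s Set.univ)⁻¹ • s).map (kacDilation N)

/-- The vector obtained from `v` by rotating its coordinates `i`, `j` through the angle `θ`. -/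
def kacRotationVec {N : ℕ} (i j : Fin N) (θ : ℝ) (v : EuclideanSpace ℝ (Fin N)) :
    EuclideanSpace ℝ (Fin N) :=
  WithLp.toLp 2 fun l =>
    if l = i then v i * Real.cos θ + v j * Real.sin θ
    else if l = j then -(v i) * Real.sin θ + v j * Real.cos θ
    else v l

theorem kacRotationVec_norm {N : ℕ} {i j : Fin N} (hij : i ≠ j) (θ : ℝ)
    (v : EuclideanSpace ℝ (Fin N)) : ‖kacRotationVec i j θ v‖ = ‖v‖ := by
  rw [EuclideanSpace.norm_eq, EuclideanSpace.norm_eq]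
  congr 1
  have hj : j ∈ Finset.univ.erase i := Finset.mem_erase.2 ⟨hij.symm, Finset.mem_univ _⟩
  rw [← Finset.add_sum_erase _ _ (Finset.mem_univ i), ← Finset.add_sum_erase _ _ hj,
    ← Finset.add_sum_erase (a := i) Finset.univ (fun l => ‖v l‖ ^ 2) (Finset.mem_univ i),
    ← Finset.add_sum_erase (a := j) _ (fun l => ‖v l‖ ^ 2) hj, ← add_assoc, ← add_assoc]
  congr 1
  · simp only [kacRotationVec, if_true, if_neg hij.symm, Real.norm_eq_abs, sq_abs]
    nlinarith [Real.sin_sq_add_cos_sq θ]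
  · refine Finset.sum_congr rfl fun l hl => ?_
    have h1 : l ≠ j := (Finset.mem_erase.1 hl).1
    have h2 : l ≠ i := (Finset.mem_erase.1 (Finset.mem_erase.1 hl).2).1
    simp [kacRotationVec, h1, h2]

/-- The collision map `R_{i,j,θ}` on the sphere of radius `√N`. -/
def kacRotation {N : ℕ} (i j : Fin N) (hij : i ≠ j) (θ : ℝ) (v : KacSphere N) : KacSphere N :=
  ⟨kacRotationVec i j θ v.1, by
    rw [mem_sphere_zero_iff_norm, kacRotationVec_norm hij]
    exact mem_sphere_zero_iff_norm.1 v.2⟩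

/-- The generator `L_{N,γ}` of the Kac walk; the sum runs over the pairs `i < j`. -/
def kacGenerator {N : ℕ} (γ : ℝ) (F : KacSphere N → ℝ) (v : KacSphere N) : ℝ :=
  -(N : ℝ) * ((N.choose 2 : ℕ) : ℝ)⁻¹ *
    ∑ p : {p : Fin N × Fin N // p.1 < p.2},
      (1 + v.1 p.1.1 ^ 2 + v.1 p.1.2 ^ 2) ^ γ *
        (1 / (2 * Real.pi) *
          ∫ θ in (-Real.pi)..Real.pi, (F v - F (kacRotation p.1.1 p.1.2 p.2.ne θ v)))

/-- `F` is the solution, for `t ≥ 0`, of the Kac master equation `∂F/∂t = L_{N,γ} F` with (bounded)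
initial datum `F₀`. The equation holds at every point of the sphere; at `t = 0` the derivative is
the right derivative. As `L_{N,γ}` is a bounded operator on bounded measurable functions, a solution
that is bounded on bounded time intervals is unique: it is `e^{t L_{N,γ}} F₀`. -/
structure IsKacSolution {N : ℕ} (γ : ℝ) (F₀ : KacSphere N → ℝ) (F : ℝ → KacSphere N → ℝ) :
    Prop where
  initial : F 0 = F₀
  measurable : ∀ t, 0 ≤ t → Measurable (F t)
  bounded : ∀ T : ℝ, ∃ B : ℝ, ∀ t, 0 ≤ t → t ≤ T → ∀ v, |F t v| ≤ B
  equation : ∀ t, 0 ≤ t → ∀ v,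
    HasDerivWithinAt (fun s => F s v) (kacGenerator γ (F t) v) (Set.Ici 0) t

/-- `F` is a probability density with respect to `σ_N`. -/
structure IsKacDensity {N : ℕ} (F : KacSphere N → ℝ) : Prop where
  measurable : Measurable F
  nonneg : ∀ v, 0 ≤ F v
  integral_eq_one : ∫ v, F v ∂(kacSigma N) = 1

/-- `F` is invariant under permutations of the coordinates. -/
def IsPermSymmetric {N : ℕ} (F : KacSphere N → ℝ) : Prop :=
  ∀ (π : Equiv.Perm (Fin N)) (v w : KacSphere N), (∀ i, w.1 i = v.1 (π i)) → F w = F v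

/-- The family of probability densities `F_N`, `N ≥ 2`, is log-scalable with constant `C`:
`sup_v |log F_N(v)| ≤ C N` for all `N`. Finiteness of `log F_N(v)` is the condition `0 < F_N(v)`. -/
def LogScalableWith (C : ℝ) (F : (N : ℕ) → KacSphere N → ℝ) : Prop :=
  0 < C ∧ ∀ N : ℕ, 2 ≤ N →
    IsKacDensity (F N) ∧ ∀ v, 0 < F N v ∧ |Real.log (F N v)| ≤ C * N

/-- The first coordinate `v_1` (the value for `N = 0` is irrelevant). -/
def firstVelocity {N : ℕ} (v : KacSphere N) : ℝ :=
  if h : 0 < N then v.1 ⟨0, h⟩ else 0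

/-- The first marginal `Π_1(F)`, as a measure on `ℝ`: the law of `v_1` under `F dσ_N`. -/
def firstMarginal {N : ℕ} (F : KacSphere N → ℝ) : Measure ℝ :=
  ((kacSigma N).withDensity fun v => ENNReal.ofReal (F v)).map firstVelocity

/-- The absolute moment `M_p(μ) = ∫ |x|^p dμ(x)`. -/
def absMoment (p : ℝ) (μ : Measure ℝ) : ℝ≥0∞ :=
  ∫⁻ x, ENNReal.ofReal (|x| ^ p) ∂μ

/-- The supremum over `N ≥ 2` of the moments of order `p` of the first marginals of `F_N`. -/
def supMarginalMoment (p : ℝ) (F : (N : ℕ) → KacSphere N → ℝ) : ℝ≥0∞ :=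
  ⨆ (N : ℕ) (_ : 2 ≤ N), absMoment p (firstMarginal (F N))

/-- The supremum over `N ≥ 2` and `t ≥ 0` of the moments of order `p` of the first marginals
of `F_N(t)`. -/
def supMarginalMomentInTime (p : ℝ) (F : (N : ℕ) → ℝ → KacSphere N → ℝ) : ℝ≥0∞ :=
  ⨆ (N : ℕ) (_ : 2 ≤ N) (t : ℝ) (_ : 0 ≤ t), absMoment p (firstMarginal (F N t))

/-- The entropy `H_N(F) = ∫ F log F dσ_N`. -/
def kacEntropy {N : ℕ} (F : KacSphere N → ℝ) : ℝ :=
  ∫ v, F v * Real.log (F v) ∂(kacSigma N)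

end

/-! ### The sphere, its rotations and the uniform measure -/

/-! The core is an entropy production bound for the quadratic rates `γ = 1`, uniform in `N`. Slower
rates are reached by interpolation with a moment, which turns exponential decay into a power law.

Write `E_ij` for the average over rotations in the `(i, j)` plane. Testing the equation against `log
F + 1` gives `H' = -D_γ`, where `D_γ` is `(N - 1)⁻¹` times the sum over ordered pairs of `∫ (1 +
v_i² + v_j²)^γ (F - E_ij F)(log F - log E_ij F)`. The key claim is `H ≤ 52 D_1`
(`relEnt_le_entropyProduction_one`). Let `F` and `E_ij F` both evolve under the heat flow generated
by `(1/2N) ∑ D_ij²`, `D_ij = x_j ∂_i - x_i ∂_j`, and follow their relative entropy with weight `w =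
1 + (v_i² + v_j²)/4`. Its dissipation contains `w` times the full squared gradient of the logarithm
of the quotient. The second solution remains rotation invariant, so the `(i, j)` component of that
gradient is `D_ij log F`; and `x_k D_ij + x_i D_jk + x_j D_ki = 0` bounds `N` times the square of
this component by `v_i² + v_j²` times the full squared gradient (`mul_sq_le_of_jacobi`). The
quadratic rate thus pays exactly for isolating one component. As the Laplacian of `w` is at most
`w`, the sum `S` over pairs obeys `S' ≤ S - (N/4) I`, with `I` the Fisher information. The
Bakry–Émery logarithmic Sobolev inequality gives `H ≤ 12 I` for `N ≥ 3` (`heatRate_mul_relEnt_le`),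
so `exp (-s) (S - N H / 52)` is nonincreasing with nonnegative limit, hence nonnegative at `s = 0`
(`relEnt_le_sum_pair_poly`). This is done for polynomials, on which the heat flow is a matrix
exponential, and carried by `L¹` density to measurable functions between positive bounds
(`relEnt_le_sum_relDensity`). For `N = 2` the single average is already the mean.

For `γ < 1`, the inequality `x ≤ R^(1-γ) x^γ + R^(1-k) x^k` gives `D_1 ≤ R^(1-γ) D_γ + R^(1-k) D_k`.
A comparison principle preserves `exp (-C_F N) ≤ F ≤ exp (C_F N)`, so logarithms are `O(N)` and,
moments being bounded, `D_k = O(N²)` (`entropyProduction_le_of_moment`). A suitable `R` yields `D_γ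
/ N ≥ c N^(-β) (H / N)^(1+β)` with `β = (1-γ)/(k-1)`, which integrates to the stated decay.

Moments are propagated by a Povzner inequality: collisions contract the moment of a pair, so the
generator maps the empirical moment `φ` below `-c φ + C` with constants free of `N`
(`exists_kacGenerator_empMoment_le`). Cross terms are harmless because `∑ (1 + v_j²) = 2N` at every
point of the sphere; no chaos is needed. -/

theorem KacSphere.sum_sq {N : ℕ} (v : KacSphere N) : ∑ i, v.1 i ^ 2 = N := by
  have h := mem_sphere_zero_iff_norm.1 v.2
  have h2 := EuclideanSpace.norm_sq_eq v.1
  rw [h, Real.sq_sqrt (Nat.cast_nonneg N)] at h2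
  simpa [sq_abs] using h2.symm

theorem KacSphere.sq_le {N : ℕ} (v : KacSphere N) (i : Fin N) : v.1 i ^ 2 ≤ N := by
  refine le_of_le_of_eq ?_ v.sum_sq
  exact Finset.single_le_sum (f := fun i => v.1 i ^ 2) (fun _ _ => sq_nonneg _) (Finset.mem_univ i)

theorem KacSphere.ext_coord {N : ℕ} {v w : KacSphere N} (h : ∀ i, v.1 i = w.1 i) : v = w :=
  Subtype.ext (PiLp.ext h)

theorem KacSphere.continuous_coord {N : ℕ} (i : Fin N) :
    Continuous fun v : KacSphere N => v.1 i := by fun_prop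

theorem KacSphere.nonempty {N : ℕ} (hN : 2 ≤ N) : Nonempty (KacSphere N) := by
  have : Nonempty (Fin N) := ⟨⟨0, by omega⟩⟩
  exact (NormedSpace.sphere_nonempty.2 (Real.sqrt_nonneg _)).to_subtype

/-- The rotation `R_{i,j,θ}`, extended by the identity to `i = j`. -/
noncomputable def kacRot {N : ℕ} (i j : Fin N) (θ : ℝ) (v : KacSphere N) : KacSphere N :=
  if h : i ≠ j then kacRotation i j h θ v else v

theorem kacRot_of_ne {N : ℕ} {i j : Fin N} (h : i ≠ j) (θ : ℝ) (v : KacSphere N) :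
    kacRot i j θ v = kacRotation i j h θ v := dif_pos h

@[simp] theorem kacRot_self {N : ℕ} (i : Fin N) (θ : ℝ) (v : KacSphere N) :
    kacRot i i θ v = v := dif_neg (by simp)

theorem kacRot_coord {N : ℕ} {i j : Fin N} (h : i ≠ j) (θ : ℝ) (v : KacSphere N) (l : Fin N) :
    (kacRot i j θ v).1 l = if l = i then v.1 i * Real.cos θ + v.1 j * Real.sin θ
      else if l = j then -(v.1 i) * Real.sin θ + v.1 j * Real.cos θ else v.1 l := by
  rw [kacRot_of_ne h]; rfl

theorem kacRot_coord_left {N : ℕ} {i j : Fin N} (h : i ≠ j) (θ : ℝ) (v : KacSphere N) :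
    (kacRot i j θ v).1 i = v.1 i * Real.cos θ + v.1 j * Real.sin θ := by
  rw [kacRot_coord h, if_pos rfl]

theorem kacRot_coord_right {N : ℕ} {i j : Fin N} (h : i ≠ j) (θ : ℝ) (v : KacSphere N) :
    (kacRot i j θ v).1 j = -(v.1 i) * Real.sin θ + v.1 j * Real.cos θ := by
  rw [kacRot_coord h, if_neg h.symm, if_pos rfl]

theorem kacRot_coord_other {N : ℕ} {i j : Fin N} (h : i ≠ j) (θ : ℝ) (v : KacSphere N) {l : Fin N}
    (hi : l ≠ i) (hj : l ≠ j) : (kacRot i j θ v).1 l = v.1 l := by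
  rw [kacRot_coord h, if_neg hi, if_neg hj]

theorem kacRot_zero {N : ℕ} (i j : Fin N) (v : KacSphere N) : kacRot i j 0 v = v := by
  rcases eq_or_ne i j with rfl | h
  · simp
  refine KacSphere.ext_coord fun l => ?_
  rw [kacRot_coord h]
  split_ifs with h1 h2 <;> simp [*]

theorem kacRot_add {N : ℕ} (i j : Fin N) (θ τ : ℝ) (v : KacSphere N) :
    kacRot i j θ (kacRot i j τ v) = kacRot i j (θ + τ) v := by
  rcases eq_or_ne i j with rfl | h
  · simp
  refine KacSphere.ext_coord fun l => ?_
  rw [kacRot_coord h, kacRot_coord h (θ + τ), kacRot_coord_left h, kacRot_coord_right h,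
    Real.cos_add, Real.sin_add]
  split_ifs with h1 h2
  · ring
  · ring
  · rw [kacRot_coord_other h _ _ h1 h2]

theorem kacRot_periodic {N : ℕ} (i j : Fin N) (v : KacSphere N) :
    Function.Periodic (fun θ => kacRot i j θ v) (2 * Real.pi) := by
  intro θ
  rcases eq_or_ne i j with rfl | h
  · simp
  refine KacSphere.ext_coord fun l => ?_
  simp only [kacRot_coord h, Real.cos_add_two_pi, Real.sin_add_two_pi]

theorem kacRot_swap {N : ℕ} (i j : Fin N) (θ : ℝ) (v : KacSphere N) :
    kacRot j i θ v = kacRot i j (-θ) v := by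
  rcases eq_or_ne i j with rfl | h
  · simp
  refine KacSphere.ext_coord fun l => ?_
  rw [kacRot_coord h, kacRot_coord h.symm, Real.cos_neg, Real.sin_neg]
  split_ifs with h1 h2
  · exact absurd (h2.symm.trans h1) h
  · ring
  · ring
  · rfl

theorem kacRot_pair_sq {N : ℕ} (i j : Fin N) (θ : ℝ) (v : KacSphere N) :
    (kacRot i j θ v).1 i ^ 2 + (kacRot i j θ v).1 j ^ 2 = v.1 i ^ 2 + v.1 j ^ 2 := by
  rcases eq_or_ne i j with rfl | h
  · simp
  rw [kacRot_coord_left h, kacRot_coord_right h]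
  nlinarith [Real.sin_sq_add_cos_sq θ]

theorem continuous_kacRot {N : ℕ} (i j : Fin N) :
    Continuous fun q : ℝ × KacSphere N => kacRot i j q.1 q.2 := by
  rcases eq_or_ne i j with rfl | h
  · simpa using continuous_snd
  simp only [kacRot_of_ne h]
  refine Continuous.subtype_mk ((PiLp.continuous_toLp 2 _).comp (continuous_pi fun l => ?_)) _
  split_ifs <;> fun_prop

theorem continuous_kacRot_angle {N : ℕ} (i j : Fin N) (v : KacSphere N) :
    Continuous fun θ => kacRot i j θ v :=
  (continuous_kacRot i j).comp (by fun_prop : Continuous fun θ : ℝ => (θ, v))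

theorem continuous_kacRot_point {N : ℕ} (i j : Fin N) (θ : ℝ) :
    Continuous (kacRot i j θ : KacSphere N → KacSphere N) :=
  (continuous_kacRot i j).comp (by fun_prop : Continuous fun v : KacSphere N => (θ, v))

/-- The restriction of a linear isometry to the sphere of radius `r`. -/
def sphereIsometry {E : Type*} [NormedAddCommGroup E] [NormedSpace ℝ E] (O : E ≃ₗᵢ[ℝ] E) (r : ℝ)
    (v : Metric.sphere (0 : E) r) : Metric.sphere (0 : E) r :=
  ⟨O v, by rw [mem_sphere_zero_iff_norm, O.norm_map]; exact mem_sphere_zero_iff_norm.1 v.2⟩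

theorem continuous_sphereIsometry {E : Type*} [NormedAddCommGroup E] [NormedSpace ℝ E]
    (O : E ≃ₗᵢ[ℝ] E) (r : ℝ) : Continuous (sphereIsometry O r) :=
  (O.continuous.comp continuous_subtype_val).subtype_mk _

/-- The surface measure of a set is a multiple of the volume of the cone over it, and a linear
isometry preserves volume and maps cones to cones. -/
theorem measurePreserving_sphereIsometry_toSphere {E : Type*} [NormedAddCommGroup E]
    [InnerProductSpace ℝ E] [FiniteDimensional ℝ E] [MeasurableSpace E] [BorelSpace E]
    (O : E ≃ₗᵢ[ℝ] E) :
    MeasurePreserving (sphereIsometry O 1) (volume : Measure E).toSphere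
      (volume : Measure E).toSphere := by
  have hc := continuous_sphereIsometry O 1
  refine ⟨hc.measurable, ?_⟩
  ext s hs
  rw [Measure.map_apply hc.measurable hs, Measure.toSphere_apply' _ hs,
    Measure.toSphere_apply' _ (hc.measurable hs)]
  congr 1
  have hO : MeasurePreserving O volume volume := O.measurePreserving
  conv_rhs => rw [← hO.measure_preimage_equiv (f := O.toMeasurableEquiv)]
  congr 1
  ext x
  simp only [Set.mem_smul, Set.mem_image, Set.mem_preimage]
  constructor
  · rintro ⟨t, ht, _, ⟨y, hy, rfl⟩, rfl⟩
    exact ⟨t, ht, O y, ⟨_, hy, rfl⟩, by simp⟩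
  · rintro ⟨t, ht, _, ⟨y, hy, rfl⟩, h⟩
    refine ⟨t, ht, O.symm y, ⟨⟨O.symm y, ?_⟩, ?_, rfl⟩, ?_⟩
    · simp
    · have : sphereIsometry O 1 ⟨O.symm y, by simp⟩ = y := Subtype.ext (by simp [sphereIsometry])
      simpa [this] using hy
    · apply O.injective
      simpa using h

theorem continuous_kacDilation (N : ℕ) : Continuous (kacDilation N) :=
  Continuous.subtype_mk (by fun_prop) _

theorem measurePreserving_sphereIsometry {N : ℕ}
    (O : EuclideanSpace ℝ (Fin N) ≃ₗᵢ[ℝ] EuclideanSpace ℝ (Fin N)) :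
    MeasurePreserving (sphereIsometry O (Real.sqrt N)) (kacSigma N) (kacSigma N) := by
  have hc := continuous_sphereIsometry O (Real.sqrt N)
  refine ⟨hc.measurable, ?_⟩
  have h1 := ((measurePreserving_sphereIsometry_toSphere O).smul_measure
    ((volume : Measure (EuclideanSpace ℝ (Fin N))).toSphere Set.univ)⁻¹).map_eq
  simp only [kacSigma]
  rw [Measure.map_map hc.measurable (continuous_kacDilation N).measurable]
  conv_rhs => rw [← h1, Measure.map_map (continuous_kacDilation N).measurable
    (continuous_sphereIsometry O 1).measurable]
  congr 1
  ext v : 1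
  exact Subtype.ext (by simp [sphereIsometry, kacDilation])

theorem isProbabilityMeasure_kacSigma {N : ℕ} (hN : 2 ≤ N) : IsProbabilityMeasure (kacSigma N) := by
  have : Nonempty (Fin N) := ⟨⟨0, by omega⟩⟩
  refine ⟨?_⟩
  have h0 : (volume : Measure (EuclideanSpace ℝ (Fin N))).toSphere Set.univ ≠ 0 := by
    rw [Ne, Measure.measure_univ_eq_zero]; exact Measure.toSphere_ne_zero _
  rw [kacSigma, Measure.map_apply (continuous_kacDilation N).measurable MeasurableSet.univ]
  simp only [Set.preimage_univ, Measure.smul_apply, smul_eq_mul]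
  exact ENNReal.inv_mul_cancel h0 (measure_ne_top _ _)

/-- The rotation as a linear isometry of Euclidean space. -/
noncomputable def kacRotationIsometry {N : ℕ} (i j : Fin N) (h : i ≠ j) (θ : ℝ) :
    EuclideanSpace ℝ (Fin N) ≃ₗᵢ[ℝ] EuclideanSpace ℝ (Fin N) :=
  LinearIsometry.toLinearIsometryEquiv
    { toFun := kacRotationVec i j θ
      map_add' := fun x y => by
        ext l; simp only [kacRotationVec, PiLp.add_apply]; split_ifs <;> ring
      map_smul' := fun c x => by
        ext l; simp only [kacRotationVec, PiLp.smul_apply, smul_eq_mul, RingHom.id_apply]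
        split_ifs <;> ring
      norm_map' := kacRotationVec_norm h θ } rfl

theorem measurePreserving_kacRot {N : ℕ} (i j : Fin N) (θ : ℝ) :
    MeasurePreserving (kacRot i j θ) (kacSigma N) (kacSigma N) := by
  rcases eq_or_ne i j with rfl | h
  · have : (kacRot i i θ : KacSphere N → KacSphere N) = id := by ext1 v; simp
    rw [this]; exact MeasurePreserving.id _
  · have : (kacRot i j θ : KacSphere N → KacSphere N) =
        sphereIsometry (kacRotationIsometry i j h θ) (Real.sqrt N) := by
      ext1 v; rw [kacRot_of_ne h]; rfl
    rw [this]; exact measurePreserving_sphereIsometry _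

/-- The point with coordinates `v (π i)`. -/
noncomputable def kacPerm {N : ℕ} (π : Equiv.Perm (Fin N)) : KacSphere N → KacSphere N :=
  sphereIsometry (LinearIsometryEquiv.piLpCongrLeft 2 ℝ ℝ π.symm) (Real.sqrt N)

theorem kacPerm_coord {N : ℕ} (π : Equiv.Perm (Fin N)) (v : KacSphere N) (i : Fin N) :
    (kacPerm π v).1 i = v.1 (π i) := by
  simp [kacPerm, sphereIsometry, LinearIsometryEquiv.piLpCongrLeft_apply, Equiv.piCongrLeft']

theorem measurePreserving_kacPerm {N : ℕ} (π : Equiv.Perm (Fin N)) :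
    MeasurePreserving (kacPerm π) (kacSigma N) (kacSigma N) :=
  measurePreserving_sphereIsometry _

theorem isPermSymmetric_iff {N : ℕ} (F : KacSphere N → ℝ) :
    IsPermSymmetric F ↔ ∀ π v, F (kacPerm π v) = F v := by
  constructor
  · intro h π v
    exact h π v _ (kacPerm_coord π v)
  · intro h π v w hw
    rw [← h π v]
    congr 1
    exact KacSphere.ext_coord fun i => by rw [hw, kacPerm_coord]

theorem kacRot_kacPerm {N : ℕ} (π : Equiv.Perm (Fin N)) (i j : Fin N) (θ : ℝ) (v : KacSphere N) :
    kacRot i j θ (kacPerm π v) = kacPerm π (kacRot (π i) (π j) θ v) := by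
  rcases eq_or_ne i j with rfl | h
  · simp
  have h' : π i ≠ π j := fun e => h (π.injective e)
  refine KacSphere.ext_coord fun l => ?_
  rw [kacRot_coord h, kacPerm_coord, kacPerm_coord, kacPerm_coord, kacPerm_coord, kacRot_coord h']
  simp

theorem integral_comp_kacRot {N : ℕ} (i j : Fin N) (θ : ℝ) (f : KacSphere N → ℝ) :
    ∫ v, f (kacRot i j θ v) ∂(kacSigma N) = ∫ v, f v ∂(kacSigma N) := by
  have hinv : Function.LeftInverse (kacRot i j (-θ) : KacSphere N → _) (kacRot i j θ) := fun v => by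
    rw [kacRot_add, neg_add_cancel, kacRot_zero]
  have hinv' : Function.RightInverse (kacRot i j (-θ) : KacSphere N → _) (kacRot i j θ) :=
    fun v => by rw [kacRot_add, add_neg_cancel, kacRot_zero]
  let e : KacSphere N ≃ᵐ KacSphere N :=
    { toFun := kacRot i j θ
      invFun := kacRot i j (-θ)
      left_inv := hinv
      right_inv := hinv'
      measurable_toFun := (continuous_kacRot_point i j θ).measurable
      measurable_invFun := (continuous_kacRot_point i j (-θ)).measurable }
  exact (measurePreserving_kacRot i j θ).integral_comp e.measurableEmbedding f

theorem integral_comp_kacPerm {N : ℕ} (π : Equiv.Perm (Fin N)) (f : KacSphere N → ℝ) :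
    ∫ v, f (kacPerm π v) ∂(kacSigma N) = ∫ v, f v ∂(kacSigma N) := by
  have hinv : ∀ π : Equiv.Perm (Fin N), Function.LeftInverse (kacPerm π⁻¹) (kacPerm π) := by
    intro π v
    exact KacSphere.ext_coord fun i => by simp [kacPerm_coord]
  let e : KacSphere N ≃ᵐ KacSphere N :=
    { toFun := kacPerm π
      invFun := kacPerm π⁻¹
      left_inv := hinv π
      right_inv := by simpa [Function.RightInverse] using hinv π⁻¹
      measurable_toFun := (measurePreserving_kacPerm π).measurable
      measurable_invFun := (measurePreserving_kacPerm π⁻¹).measurable }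
  exact (measurePreserving_kacPerm π).integral_comp e.measurableEmbedding f

/-! ### Angular derivatives of polynomials -/

open MvPolynomial in
/-- The derivation `x_j ∂_i - x_i ∂_j` of the polynomial ring. -/
noncomputable def angD {N : ℕ} (i j : Fin N) :
    Derivation ℝ (MvPolynomial (Fin N) ℝ) (MvPolynomial (Fin N) ℝ) :=
  mkDerivation ℝ fun l => (if l = i then X j else 0) - (if l = j then X i else 0)

/-- The value of a polynomial at a point of the sphere. -/
noncomputable def evalS {N : ℕ} (v : KacSphere N) : MvPolynomial (Fin N) ℝ →ₐ[ℝ] ℝ :=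
  MvPolynomial.aeval fun i => v.1 i

section
open MvPolynomial

theorem angD_X {N : ℕ} (i j l : Fin N) :
    angD i j (X l : MvPolynomial (Fin N) ℝ)
      = (if l = i then X j else 0) - (if l = j then X i else 0) := by
  rw [angD, mkDerivation_X]

@[simp] theorem evalS_X {N : ℕ} (v : KacSphere N) (i : Fin N) : evalS v (X i) = v.1 i := by
  simp [evalS]

theorem angD_self {N : ℕ} (i : Fin N) : (angD i i : Derivation ℝ (MvPolynomial (Fin N) ℝ) _) = 0 :=
  derivation_ext fun l => by simp [angD_X]

theorem angD_swap {N : ℕ} (i j : Fin N) :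
    (angD j i : Derivation ℝ (MvPolynomial (Fin N) ℝ) _) = - angD i j :=
  derivation_ext fun l => by simp [angD_X]

/-- These are the structure relations of `so(N)`. A derivation is determined by its values on the
variables, so it suffices to compare those. -/
theorem angD_commutator {N : ℕ} (i j k l : Fin N) :
    (⁅angD i j, angD k l⁆ : Derivation ℝ (MvPolynomial (Fin N) ℝ) _) =
      (if l = i then angD k j else 0) - (if l = j then angD k i else 0)
        - (if k = i then angD l j else 0) + (if k = j then angD l i else 0) := by
  refine derivation_ext fun m => ?_
  have h : ∀ (P : Prop) [Decidable P] (D : Derivation ℝ (MvPolynomial (Fin N) ℝ)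
      (MvPolynomial (Fin N) ℝ)), (if P then D else 0) (X m) = if P then D (X m) else 0 := by
    intro P _ D; split_ifs <;> simp
  have h2 : ∀ (P : Prop) [Decidable P] (a b : Fin N) (Z : MvPolynomial (Fin N) ℝ),
      angD a b (if P then Z else 0) = if P then angD a b Z else 0 := by
    intro P _ a b Z; split_ifs <;> simp
  simp only [Derivation.commutator_apply, Derivation.add_apply, Derivation.sub_apply, h, angD_X,
    map_sub, h2]
  -- Conditionals become 0/1 factors and equality tests are oriented alike, which leaves a
  -- polynomial identity for `ring`.
  have h3 : ∀ (P : Prop) [Decidable P] (Z : MvPolynomial (Fin N) ℝ),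
      (if P then Z else 0) = (if P then 1 else 0) * Z := by
    intro P _ Z; split_ifs <;> simp
  simp only [h3 (m = k) (X _), h3 (m = l) (X _), h3 (m = i) (X _), h3 (m = j) (X _),
    eq_comm (a := j) (b := k), eq_comm (a := j) (b := l), eq_comm (a := i) (b := k),
    eq_comm (a := i) (b := l)]
  simp only [h3 (l = i) (_ - _), h3 (l = j) (_ - _), h3 (k = i) (_ - _), h3 (k = j) (_ - _),
    h3 (m = i) (_ - _), h3 (m = j) (_ - _), h3 (m = k) (_ - _), h3 (m = l) (_ - _),
    h3 (l = i) (X _), h3 (l = j) (X _), h3 (k = i) (X _), h3 (k = j) (X _)]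
  ring

/-- Differentiation lowers the degree by one and the linear coefficient restores it. The invariance
of these finite-dimensional spaces is what makes the flows below matrix exponentials. -/
theorem angD_mem_restrictTotalDegree {N : ℕ} (i j : Fin N) (d : ℕ) {p : MvPolynomial (Fin N) ℝ}
    (hp : p ∈ restrictTotalDegree (Fin N) ℝ d) : angD i j p ∈ restrictTotalDegree (Fin N) ℝ d := by
  rw [mem_restrictTotalDegree] at hp ⊢
  rw [p.as_sum, map_sum]
  refine (totalDegree_finsetSum _ _).trans (Finset.sup_le fun s hs => ?_)
  rw [angD, mkDerivation_monomial, Finsupp.sum]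
  refine (totalDegree_smul_le _ _).trans ?_
  refine (totalDegree_finsetSum _ _).trans (Finset.sup_le fun l hl => ?_)
  rw [smul_eq_mul]
  refine (totalDegree_mul _ _).trans ?_
  have h1 : ((if l = i then X j else 0) - (if l = j then X i else 0) :
      MvPolynomial (Fin N) ℝ).totalDegree ≤ 1 := by
    refine (totalDegree_sub _ _).trans (max_le ?_ ?_) <;> split_ifs <;> simp
  have h2 := totalDegree_monomial_le (s - Finsupp.single l 1) (s l : ℝ)
  change _ ≤ (s - Finsupp.single l 1).sum fun _ e => e at h2
  have h3 := (le_totalDegree hs).trans hp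
  have h4 : (s - Finsupp.single l 1) + Finsupp.single l 1 = s :=
    tsub_add_cancel_of_le (Finsupp.single_le_iff.2 (Nat.one_le_iff_ne_zero.2 (Finsupp.mem_support_iff.1 hl)))
  have h5 : (s.sum fun _ e => e) = ((s - Finsupp.single l 1).sum fun _ e => e) + 1 := by
    conv_lhs => rw [← h4]
    rw [Finsupp.sum_add_index' (by simp) (by simp)]
    simp
  omega

/-- The angular Laplacian `(1/2N) ∑_{i,j} (x_j ∂_i - x_i ∂_j)²`. -/
noncomputable def angLap (N : ℕ) : MvPolynomial (Fin N) ℝ →ₗ[ℝ] MvPolynomial (Fin N) ℝ :=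
  (2 * (N : ℝ))⁻¹ • ∑ a : Fin N × Fin N, (angD a.1 a.2).toLinearMap ∘ₗ (angD a.1 a.2).toLinearMap

theorem angLap_apply {N : ℕ} (p : MvPolynomial (Fin N) ℝ) :
    angLap N p = (2 * (N : ℝ))⁻¹ • ∑ a : Fin N × Fin N, angD a.1 a.2 (angD a.1 a.2 p) := by
  simp [angLap]

theorem angLap_mem_restrictTotalDegree {N : ℕ} (d : ℕ) {p : MvPolynomial (Fin N) ℝ}
    (hp : p ∈ restrictTotalDegree (Fin N) ℝ d) : angLap N p ∈ restrictTotalDegree (Fin N) ℝ d := by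
  rw [angLap_apply]
  exact Submodule.smul_mem _ _ (Submodule.sum_mem _ fun a _ =>
    angD_mem_restrictTotalDegree _ _ _ (angD_mem_restrictTotalDegree _ _ _ hp))

theorem angD_angD_sub {N : ℕ} (i j k l : Fin N) (p : MvPolynomial (Fin N) ℝ) :
    angD i j (angD k l p) - angD k l (angD i j p) =
      (if l = i then angD k j p else 0) - (if l = j then angD k i p else 0)
        - (if k = i then angD l j p else 0) + (if k = j then angD l i p else 0) := by
  have h := congrArg (fun D => D p) (angD_commutator i j k l)
  simp only [Derivation.commutator_apply, Derivation.add_apply, Derivation.sub_apply] at h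
  rw [h]
  congr 1; congr 1; congr 1
  all_goals split_ifs <;> simp

/-- Up to a factor the angular Laplacian is the Casimir element of `so(N)`. Expanding `[D, D_a²] =
[D, D_a] D_a + D_a [D, D_a]` and summing over `a`, the eight resulting sums cancel in pairs by
antisymmetry. -/
theorem angD_angLap {N : ℕ} (i j : Fin N) (p : MvPolynomial (Fin N) ℝ) :
    angD i j (angLap N p) = angLap N (angD i j p) := by
  rw [angLap_apply, angLap_apply, Derivation.map_smul, map_sum]
  refine congrArg _ ?_
  rw [← sub_eq_zero, ← Finset.sum_sub_distrib]
  have key : ∀ a : Fin N × Fin N, angD i j (angD a.1 a.2 (angD a.1 a.2 p))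
      - angD a.1 a.2 (angD a.1 a.2 (angD i j p)) =
      ((if a.2 = i then angD a.1 j (angD a.1 a.2 p) else 0)
        - (if a.2 = j then angD a.1 i (angD a.1 a.2 p) else 0)
        - (if a.1 = i then angD a.2 j (angD a.1 a.2 p) else 0)
        + (if a.1 = j then angD a.2 i (angD a.1 a.2 p) else 0)) +
      ((if a.2 = i then angD a.1 a.2 (angD a.1 j p) else 0)
        - (if a.2 = j then angD a.1 a.2 (angD a.1 i p) else 0)
        - (if a.1 = i then angD a.1 a.2 (angD a.2 j p) else 0)
        + (if a.1 = j then angD a.1 a.2 (angD a.2 i p) else 0)) := by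
    intro a
    have h1 := angD_angD_sub i j a.1 a.2 (angD a.1 a.2 p)
    have h2 := congrArg (angD a.1 a.2) (angD_angD_sub i j a.1 a.2 p)
    have h3 : ∀ (P : Prop) [Decidable P] (b c : Fin N) (Z : MvPolynomial (Fin N) ℝ),
        angD b c (if P then Z else 0) = if P then angD b c Z else 0 := by
      intro P _ b c Z; split_ifs <;> simp
    simp only [map_add, map_sub, h3] at h2
    rw [← h1, ← h2]; ring
  rw [Finset.sum_congr rfl fun a _ => key a, Fintype.sum_prod_type]
  simp only [Finset.sum_add_distrib, Finset.sum_sub_distrib]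
  have e1 : ∀ (b : Fin N) (f : Fin N → Fin N → MvPolynomial (Fin N) ℝ),
      ∑ x, ∑ y, (if y = b then f x y else 0) = ∑ x, f x b := by
    intro b f; simp
  have e2 : ∀ (b : Fin N) (f : Fin N → Fin N → MvPolynomial (Fin N) ℝ),
      ∑ x, ∑ y, (if x = b then f x y else 0) = ∑ y, f b y := by
    intro b f; rw [Finset.sum_comm]; simp
  rw [e1 i fun x y => angD x j (angD x y p), e1 j fun x y => angD x i (angD x y p),
    e2 i fun x y => angD y j (angD x y p), e2 j fun x y => angD y i (angD x y p),
    e1 i fun x y => angD x y (angD x j p), e1 j fun x y => angD x y (angD x i p),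
    e2 i fun x y => angD x y (angD y j p), e2 j fun x y => angD x y (angD y i p)]
  simp only [angD_swap _ i, angD_swap _ j, Derivation.neg_apply, map_neg, Finset.sum_neg_distrib]
  ring

/-! ### Values on the sphere -/

/-- The derivation `angD i j` is the infinitesimal generator of `kacRot i j`; by the product rule
only the variables have to be checked. -/
theorem hasDerivAt_evalS_kacRot {N : ℕ} (i j : Fin N) (p : MvPolynomial (Fin N) ℝ)
    (v : KacSphere N) (θ : ℝ) :
    HasDerivAt (fun θ => evalS (kacRot i j θ v) p) (evalS (kacRot i j θ v) (angD i j p)) θ := by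
  rcases eq_or_ne i j with rfl | h
  · simp only [kacRot_self, angD_self, Derivation.zero_apply, map_zero]
    exact hasDerivAt_const _ _
  induction p using MvPolynomial.induction_on with
  | C a => simpa [evalS] using hasDerivAt_const θ a
  | add p q hp hq => simp only [map_add]; exact hp.add hq
  | mul_X p l hp =>
    have hX : HasDerivAt (fun θ => (kacRot i j θ v).1 l)
        (evalS (kacRot i j θ v) (angD i j (X l))) θ := by
      rw [angD_X]
      rcases eq_or_ne l i with rfl | hi
      · simp only [kacRot_coord_left h, if_true, if_neg h, sub_zero, evalS_X, kacRot_coord_right h]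
        convert! ((Real.hasDerivAt_cos θ).const_mul (v.1 l)).add
          ((Real.hasDerivAt_sin θ).const_mul (v.1 j)) using 1
        ring
      rcases eq_or_ne l j with rfl | hj
      · simp only [kacRot_coord_right h, if_true, if_neg hi, zero_sub, map_neg, evalS_X,
          kacRot_coord_left h]
        convert! ((Real.hasDerivAt_sin θ).const_mul (-v.1 i)).add
          ((Real.hasDerivAt_cos θ).const_mul (v.1 l)) using 1
        ring
      · simp only [kacRot_coord_other h _ _ hi hj, if_neg hi, if_neg hj, sub_zero, map_zero]
        exact hasDerivAt_const _ _
    have := hp.mul hX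
    simp only [map_mul, evalS_X, Derivation.leibniz, smul_eq_mul, map_add]
    convert! this using 1
    ring

theorem continuous_evalS {N : ℕ} (p : MvPolynomial (Fin N) ℝ) :
    Continuous fun v : KacSphere N => evalS v p := by
  induction p using MvPolynomial.induction_on with
  | C a => simpa [evalS] using continuous_const
  | add p q hp hq => simp only [map_add]; exact hp.add hq
  | mul_X p l hp => simp only [map_mul, evalS_X]; exact hp.mul (KacSphere.continuous_coord l)

theorem evalS_angLap {N : ℕ} (v : KacSphere N) (p : MvPolynomial (Fin N) ℝ) :
    evalS v (angLap N p)
      = (2 * (N : ℝ))⁻¹ * ∑ a : Fin N × Fin N, evalS v (angD a.1 a.2 (angD a.1 a.2 p)) := by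
  rw [angLap_apply, map_smul, map_sum, smul_eq_mul]

end

/-! ### Linear flows on polynomials and the maximum principle -/

/-- `U` solves `U' = B U` in the space of polynomials, in the weak sense of values on the sphere. -/
structure IsPolyFlow {N : ℕ} (B : MvPolynomial (Fin N) ℝ →ₗ[ℝ] MvPolynomial (Fin N) ℝ)
    (U : ℝ → MvPolynomial (Fin N) ℝ) : Prop where
  hasDerivAt_path : ∀ (D M : MvPolynomial (Fin N) ℝ →ₗ[ℝ] MvPolynomial (Fin N) ℝ)
    (c : ℝ → KacSphere N) (s : ℝ),
    (∀ p, HasDerivAt (fun s => evalS (c s) p) (evalS (c s) (M p)) s) →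
    HasDerivAt (fun s => evalS (c s) (D (U s)))
      (evalS (c s) (M (D (U s))) + evalS (c s) (D (B (U s)))) s
  continuous : ∀ D : MvPolynomial (Fin N) ℝ →ₗ[ℝ] MvPolynomial (Fin N) ℝ,
    Continuous fun q : ℝ × KacSphere N => evalS q.2 (D (U q.1))
  exists_integral : ∀ (D : MvPolynomial (Fin N) ℝ →ₗ[ℝ] MvPolynomial (Fin N) ℝ) (a b : ℝ),
    ∃ q : MvPolynomial (Fin N) ℝ, ∀ v, evalS v q = ∫ s in a..b, evalS v (D (U s))

theorem IsPolyFlow.hasDerivAt {N : ℕ} {B : MvPolynomial (Fin N) ℝ →ₗ[ℝ] MvPolynomial (Fin N) ℝ}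
    {U : ℝ → MvPolynomial (Fin N) ℝ} (h : IsPolyFlow B U)
    (D : MvPolynomial (Fin N) ℝ →ₗ[ℝ] MvPolynomial (Fin N) ℝ) (v : KacSphere N) (s : ℝ) :
    HasDerivAt (fun s => evalS v (D (U s))) (evalS v (D (B (U s)))) s := by
  simpa using h.hasDerivAt_path D 0 (fun _ => v) s fun p => by simpa using hasDerivAt_const s _

/-- The polynomials of degree at most that of `p` form a finite-dimensional invariant space, so `U`
is the matrix exponential applied to `p`. In a basis it has differentiable coefficients, from which
joint continuity, derivatives along moving points and polynomial time integrals follow at once. -/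
theorem exists_isPolyFlow {N : ℕ} (B : MvPolynomial (Fin N) ℝ →ₗ[ℝ] MvPolynomial (Fin N) ℝ)
    (hB : ∀ d p, p ∈ MvPolynomial.restrictTotalDegree (Fin N) ℝ d →
      B p ∈ MvPolynomial.restrictTotalDegree (Fin N) ℝ d) (p : MvPolynomial (Fin N) ℝ) :
    ∃ U, U 0 = p ∧ IsPolyFlow B U := by
  set V := MvPolynomial.restrictTotalDegree (Fin N) ℝ p.totalDegree with hV
  have hp : p ∈ V := by rw [hV, MvPolynomial.mem_restrictTotalDegree]
  let bs := Module.finBasis ℝ V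
  let e := bs.equivFun
  let T : (Fin (Module.finrank ℝ V) → ℝ) →L[ℝ] (Fin (Module.finrank ℝ V) → ℝ) :=
    LinearMap.toContinuousLinearMap
      (e.toLinearMap ∘ₗ (B.restrict (hB p.totalDegree)) ∘ₗ e.symm.toLinearMap)
  let x : ℝ → Fin (Module.finrank ℝ V) → ℝ := fun s => NormedSpace.exp (s • T) (e ⟨p, hp⟩)
  have hx : ∀ s, HasDerivAt x (T (x s)) s := fun s =>
    (hasDerivAt_exp_smul_const' T s).clm_apply (hasDerivAt_const s (e ⟨p, hp⟩)) |>.congr_deriv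
      (by simp [x])
  have hxc : Continuous x := continuous_iff_continuousAt.2 fun s => (hx s).continuousAt
  have hsum : ∀ s, (e.symm (x s) : MvPolynomial (Fin N) ℝ) = ∑ i, x s i • (bs i : MvPolynomial (Fin N) ℝ) := by
    intro s
    simp [e, Module.Basis.equivFun_symm_apply]
  have hT : ∀ y, (e.symm (T y) : MvPolynomial (Fin N) ℝ) = B (e.symm y) := by
    intro y; simp [T]
  refine ⟨fun s => (e.symm (x s) : MvPolynomial (Fin N) ℝ), by simp [x], ?_, ?_, ?_⟩
  · intro D M c s hc
    have h1 : HasDerivAt (fun s => ∑ i, x s i * evalS (c s) (D (bs i : MvPolynomial (Fin N) ℝ)))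
        (∑ i, (T (x s) i * evalS (c s) (D (bs i : MvPolynomial (Fin N) ℝ)) +
          x s i * evalS (c s) (M (D (bs i : MvPolynomial (Fin N) ℝ))))) s :=
      HasDerivAt.fun_sum fun i _ => (hasDerivAt_pi.1 (hx s) i).mul (hc _)
    have hTs : B (e.symm (x s) : MvPolynomial (Fin N) ℝ)
        = ∑ i, T (x s) i • (bs i : MvPolynomial (Fin N) ℝ) := by
      rw [← hT]
      simp [e, Module.Basis.equivFun_symm_apply]
    rw [hTs]
    simp only [hsum, map_sum, map_smul, smul_eq_mul]
    rw [← Finset.sum_add_distrib]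
    exact h1.congr_deriv (Finset.sum_congr rfl fun i _ => add_comm _ _)
  · intro D
    simp only [hsum, map_sum, map_smul, smul_eq_mul]
    refine continuous_finsetSum _ fun i _ => ?_
    exact (((continuous_apply i).comp hxc).comp continuous_fst).mul
      ((continuous_evalS _).comp continuous_snd)
  · intro D a b
    refine ⟨∑ i, (∫ s in a..b, x s i) • D (bs i : MvPolynomial (Fin N) ℝ), fun v => ?_⟩
    simp only [hsum, map_sum, map_smul, smul_eq_mul]
    rw [intervalIntegral.integral_finsetSum]
    · simp only [intervalIntegral.integral_mul_const]
    · intro i _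
      exact (((continuous_apply i).comp hxc).mul continuous_const).intervalIntegrable _ _

theorem IsPolyFlow.comp {N : ℕ} {B : MvPolynomial (Fin N) ℝ →ₗ[ℝ] MvPolynomial (Fin N) ℝ}
    {U : ℝ → MvPolynomial (Fin N) ℝ} (h : IsPolyFlow B U)
    (M : MvPolynomial (Fin N) ℝ →ₗ[ℝ] MvPolynomial (Fin N) ℝ) (hM : ∀ p, M (B p) = B (M p)) :
    IsPolyFlow B fun s => M (U s) := by
  refine ⟨fun D L c s hc => ?_, fun D => h.continuous (D ∘ₗ M),
    fun D => h.exists_integral (D ∘ₗ M)⟩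
  have := h.hasDerivAt_path (D ∘ₗ M) L c s hc
  simpa [hM] using this

/-- A positive second derivative would make `x` a local minimum as well, so `f` would be constant
near `x` and its second derivative zero. -/
theorem nonpos_of_isLocalMax {f f' : ℝ → ℝ} {c x : ℝ} (hf : ∀ x, HasDerivAt f (f' x) x)
    (hf' : HasDerivAt f' c x) (hx : IsLocalMax f x) : c ≤ 0 := by
  by_contra! hc
  have e : deriv f = f' := funext fun y => (hf y).deriv
  have h0 : f' x = 0 := hx.hasDerivAt_eq_zero (hf x)
  have h1 : IsLocalMin f x := isLocalMin_of_deriv_deriv_pos (by rw [e, hf'.deriv]; exact hc)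
    (by rw [e, h0]) (hf x).continuousAt
  have h2 : ∀ᶠ y in nhds x, f y = f x := by
    filter_upwards [hx, h1] with y a b using le_antisymm a b
  have h3 : f' =ᶠ[nhds x] fun _ => 0 := by
    filter_upwards [h2.eventually_nhds] with y hy
    have : HasDerivAt f 0 y := by
      refine (hasDerivAt_const y (f x)).congr_of_eventuallyEq hy
    exact (hf y).unique this
  have h4 : HasDerivAt f' 0 x := (hasDerivAt_const x 0).congr_of_eventuallyEq h3
  exact hc.ne (hf'.unique h4).symm

theorem evalS_angLap_nonpos_of_max {N : ℕ} (p : MvPolynomial (Fin N) ℝ) (v : KacSphere N)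
    (h : ∀ w, evalS w p ≤ evalS v p) : evalS v (angLap N p) ≤ 0 := by
  rw [evalS_angLap]
  refine mul_nonpos_of_nonneg_of_nonpos (by positivity) (Finset.sum_nonpos fun a _ => ?_)
  have h1 := hasDerivAt_evalS_kacRot a.1 a.2 (angD a.1 a.2 p) v 0
  rw [kacRot_zero] at h1
  refine nonpos_of_isLocalMax (hasDerivAt_evalS_kacRot a.1 a.2 p v) h1 ?_
  refine Filter.Eventually.of_forall fun θ => ?_
  simpa [kacRot_zero] using h _

/-- The parabolic maximum principle on the sphere. -/
theorem evalS_le_of_subsolution {N : ℕ} (hN : 2 ≤ N) {P P' : ℝ → MvPolynomial (Fin N) ℝ} {M : ℝ}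
    (hc : Continuous fun q : ℝ × KacSphere N => evalS q.2 (P q.1))
    (hd : ∀ s v, HasDerivAt (fun s => evalS v (P s)) (evalS v (P' s)) s)
    (hle : ∀ s v, evalS v (P' s) ≤ evalS v (angLap N (P s)))
    (h0 : ∀ v, evalS v (P 0) ≤ M) {s : ℝ} (hs : 0 ≤ s) (v : KacSphere N) :
    evalS v (P s) ≤ M := by
  have : Nonempty (KacSphere N) := KacSphere.nonempty hN
  -- Subtracting `ε s` makes the inequality strict, so that a maximum at a positive time is
  -- impossible; `ε` tends to zero at the end.
  have key : ∀ ε > 0, evalS v (P s) ≤ M + ε * s := by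
    intro ε hε
    have hcomp : IsCompact (Set.Icc 0 s ×ˢ (Set.univ : Set (KacSphere N))) :=
      isCompact_Icc.prod isCompact_univ
    obtain ⟨⟨t, w⟩, htw, hmax⟩ := hcomp.exists_isMaxOn ⟨(s, v), by simp [hs]⟩
      (f := fun q : ℝ × KacSphere N => evalS q.2 (P q.1) - ε * q.1)
      (by fun_prop)
    have hmax' : ∀ t' ∈ Set.Icc 0 s, ∀ w', evalS w' (P t') - ε * t' ≤ evalS w (P t) - ε * t :=
      fun t' ht' w' => isMaxOn_iff.1 hmax (t', w') (Set.mem_prod.2 ⟨ht', Set.mem_univ w'⟩)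
    have ht : t ∈ Set.Icc 0 s := (Set.mem_prod.1 htw).1
    rcases ht.1.eq_or_lt with rfl | hpos
    · have := hmax' s ⟨hs, le_rfl⟩ v
      have := h0 w
      simp at *
      linarith
    exfalso
    have h1 : evalS w (angLap N (P t)) ≤ 0 :=
      evalS_angLap_nonpos_of_max _ _ fun w' => by linarith [hmax' t ht w']
    have h2 : HasDerivAt (fun t => evalS w (P t) - ε * t) (evalS w (P' t) - ε) t := by
      exact ((hd t w).sub ((hasDerivAt_id t).const_mul ε)).congr_deriv (by simp)
    -- The maximum may lie at the right end of the time interval, so only slopes from the left are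
    -- used.
    have h3 : 0 ≤ evalS w (P' t) - ε := by
      have h4 : HasDerivWithinAt (fun t => evalS w (P t) - ε * t) (evalS w (P' t) - ε) (Set.Iio t) t :=
        h2.hasDerivWithinAt
      rw [hasDerivWithinAt_iff_tendsto_slope' (by simp)] at h4
      have : (nhdsWithin t (Set.Iio t)).NeBot := inferInstance
      refine ge_of_tendsto h4 ?_
      filter_upwards [Ioo_mem_nhdsLT hpos] with y hy
      rw [slope_def_field]
      exact div_nonneg_of_nonpos (by linarith [hmax' y ⟨hy.1.le, hy.2.le.trans ht.2⟩ w])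
        (by linarith [hy.2])
    linarith [hle t w]
  refine le_of_forall_pos_le_add fun ε hε => ?_
  refine (key (ε / (s + 1)) (by positivity)).trans ?_
  gcongr
  rw [div_mul_eq_mul_div, div_le_iff₀ (by positivity)]
  nlinarith

/-! ### Differentiation under the integral sign and integration by parts -/

theorem hasDerivAt_integral_of_bounded {α : Type*} [MeasurableSpace α] {μ : Measure α}
    [IsFiniteMeasure μ] {f f' : ℝ → α → ℝ} (hf : ∀ t, 0 ≤ t → Measurable (f t))
    (hf' : ∀ t, 0 < t → Measurable (f' t))
    (hb : ∀ T, ∃ B, ∀ t, 0 ≤ t → t ≤ T → ∀ v, |f t v| ≤ B)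
    (hb' : ∀ T, ∃ B, ∀ t, 0 < t → t ≤ T → ∀ v, |f' t v| ≤ B)
    (hc : ∀ v, ContinuousOn (fun t => f t v) (Set.Ici 0))
    (hd : ∀ t, 0 < t → ∀ v, HasDerivAt (fun s => f s v) (f' t v) t) :
    ContinuousOn (fun t => ∫ v, f t v ∂μ) (Set.Ici 0) ∧
      ∀ t, 0 < t → HasDerivAt (fun s => ∫ v, f s v ∂μ) (∫ v, f' t v ∂μ) t := by
  constructor
  · intro t ht
    obtain ⟨B, hB⟩ := hb (t + 1)
    have hmem : ∀ᶠ s in nhdsWithin t (Set.Ici 0), 0 ≤ s ∧ s ≤ t + 1 := by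
      filter_upwards [self_mem_nhdsWithin, mem_nhdsWithin_of_mem_nhds (Iic_mem_nhds (lt_add_one t))]
        with s h1 h2 using ⟨h1, h2⟩
    refine continuousWithinAt_of_dominated (bound := fun _ => B) ?_ ?_ (integrable_const _) ?_
    · filter_upwards [hmem] with s hs using (hf s hs.1).aestronglyMeasurable
    · filter_upwards [hmem] with s hs using Filter.Eventually.of_forall (hB s hs.1 hs.2)
    · exact Filter.Eventually.of_forall fun v => hc v t ht
  · intro t ht
    obtain ⟨B, hB⟩ := hb' (t + t)
    obtain ⟨B0, hB0⟩ := hb t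
    have hmem : ∀ s ∈ Metric.ball t t, 0 < s ∧ s ≤ t + t := by
      intro s hs
      rw [Real.ball_eq_Ioo] at hs
      exact ⟨by linarith [hs.1], hs.2.le⟩
    refine (hasDerivAt_integral_of_dominated_loc_of_deriv_le (bound := fun _ => B)
      (Metric.ball_mem_nhds t ht) ?_ ?_ (hf' t ht).aestronglyMeasurable ?_
      (integrable_const _) ?_).2
    · filter_upwards [Metric.ball_mem_nhds t ht] with s hs
        using (hf s (hmem s hs).1.le).aestronglyMeasurable
    · exact Integrable.of_bound (hf t ht.le).aestronglyMeasurable B0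
        (Filter.Eventually.of_forall (hB0 t ht.le le_rfl))
    · exact Filter.Eventually.of_forall fun v s hs => hB s (hmem s hs).1 (hmem s hs).2 v
    · exact Filter.Eventually.of_forall fun v s hs => hd s (hmem s hs).1 v

theorem hasDerivAt_integral_of_continuousOn {α : Type*} [TopologicalSpace α] [CompactSpace α]
    [MeasurableSpace α] [BorelSpace α] {μ : Measure α} [IsFiniteMeasure μ] {f f' : ℝ → α → ℝ}
    (hf : ContinuousOn (fun q : ℝ × α => f q.1 q.2) (Set.Ici 0 ×ˢ Set.univ))
    (hf' : ContinuousOn (fun q : ℝ × α => f' q.1 q.2) (Set.Ici 0 ×ˢ Set.univ))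
    (hd : ∀ t, 0 < t → ∀ v, HasDerivAt (fun s => f s v) (f' t v) t) :
    ContinuousOn (fun t => ∫ v, f t v ∂μ) (Set.Ici 0) ∧
      ∀ t, 0 < t → HasDerivAt (fun s => ∫ v, f s v ∂μ) (∫ v, f' t v ∂μ) t := by
  have hslice : ∀ {g : ℝ → α → ℝ},
      ContinuousOn (fun q : ℝ × α => g q.1 q.2) (Set.Ici 0 ×ˢ Set.univ) →
      ∀ t, 0 ≤ t → Continuous (g t) := fun hg t ht =>
    hg.comp_continuous (f := fun v => (t, v)) (by fun_prop) (fun v => ⟨ht, Set.mem_univ _⟩)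
  have hbd : ∀ {g : ℝ → α → ℝ},
      ContinuousOn (fun q : ℝ × α => g q.1 q.2) (Set.Ici 0 ×ˢ Set.univ) →
      ∀ T, ∃ B, ∀ t, 0 ≤ t → t ≤ T → ∀ v, |g t v| ≤ B := by
    intro g hg T
    obtain ⟨B, hB⟩ := (isCompact_Icc.prod isCompact_univ).exists_bound_of_continuousOn
      (hg.mono (Set.prod_mono (fun x hx => hx.1 : Set.Icc 0 T ⊆ Set.Ici 0) subset_rfl))
    exact ⟨B, fun t h0 hT v => hB (t, v) ⟨⟨h0, hT⟩, Set.mem_univ _⟩⟩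
  refine hasDerivAt_integral_of_bounded (fun t ht => (hslice hf t ht).measurable)
    (fun t ht => (hslice hf' t ht.le).measurable) (hbd hf) (fun T => ?_) (fun v => ?_) hd
  · obtain ⟨B, hB⟩ := hbd hf' T
    exact ⟨B, fun t h0 => hB t h0.le⟩
  · exact hf.comp (f := fun t => (t, v)) (by fun_prop) fun t ht => ⟨ht, Set.mem_univ _⟩

/-- The integral of `f ∘ kacRot i j θ` does not depend on `θ` because the measure is invariant. This
is integration by parts on the sphere. -/
theorem integral_eq_zero_of_hasDerivAt_kacRot {N : ℕ} (hN : 2 ≤ N) (i j : Fin N)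
    {f g : KacSphere N → ℝ} (hf : Continuous f) (hg : Continuous g)
    (h : ∀ v θ, HasDerivAt (fun θ => f (kacRot i j θ v)) (g (kacRot i j θ v)) θ) :
    ∫ v, g v ∂(kacSigma N) = 0 := by
  have := isProbabilityMeasure_kacSigma hN
  have h1 := (hasDerivAt_integral_of_continuousOn (μ := kacSigma N)
    (f := fun θ v => f (kacRot i j θ v)) (f' := fun θ v => g (kacRot i j θ v))
    (hf.comp (continuous_kacRot i j)).continuousOn (hg.comp (continuous_kacRot i j)).continuousOn
    fun t _ v => h v t).2 1 one_pos
  simp only [integral_comp_kacRot] at h1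
  exact (h1.unique (hasDerivAt_const _ _))

/-! ### The heat flow on the sphere -/

section heat
variable {N : ℕ} {U : ℝ → MvPolynomial (Fin N) ℝ}

theorem IsPolyFlow.hasDerivAt_evalS {B : MvPolynomial (Fin N) ℝ →ₗ[ℝ] MvPolynomial (Fin N) ℝ}
    (h : IsPolyFlow B U) (v : KacSphere N) (s : ℝ) :
    HasDerivAt (fun s => evalS v (U s)) (evalS v (B (U s))) s :=
  h.hasDerivAt LinearMap.id v s

theorem IsPolyFlow.continuous_evalS {B : MvPolynomial (Fin N) ℝ →ₗ[ℝ] MvPolynomial (Fin N) ℝ}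
    (h : IsPolyFlow B U) : Continuous fun q : ℝ × KacSphere N => evalS q.2 (U q.1) :=
  h.continuous LinearMap.id

/-- Rotation derivatives commute with the Laplacian, so they map solutions of the heat equation to
solutions. -/
theorem IsPolyFlow.angD (h : IsPolyFlow (angLap N) U) (i j : Fin N) :
    IsPolyFlow (angLap N) fun s => _root_.angD i j (U s) :=
  h.comp (_root_.angD i j).toLinearMap fun p => angD_angLap i j p

theorem IsPolyFlow.le_of_le (hN : 2 ≤ N) (h : IsPolyFlow (angLap N) U) {b : ℝ}
    (hb : ∀ v, evalS v (U 0) ≤ b) {s : ℝ} (hs : 0 ≤ s) (v : KacSphere N) : evalS v (U s) ≤ b :=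
  evalS_le_of_subsolution hN h.continuous_evalS (fun s v => h.hasDerivAt_evalS v s)
    (fun _ _ => le_rfl) hb hs v

theorem IsPolyFlow.ge_of_ge (hN : 2 ≤ N) (h : IsPolyFlow (angLap N) U) {a : ℝ}
    (ha : ∀ v, a ≤ evalS v (U 0)) {s : ℝ} (hs : 0 ≤ s) (v : KacSphere N) : a ≤ evalS v (U s) := by
  have h' := h.comp (-LinearMap.id) fun p => by simp
  have := h'.le_of_le hN (b := -a) (fun v => by simpa using ha v) hs v
  simpa using this

theorem IsPolyFlow.eq_zero (hN : 2 ≤ N) (h : IsPolyFlow (angLap N) U)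
    (h0 : ∀ v, evalS v (U 0) = 0) {s : ℝ} (hs : 0 ≤ s) (v : KacSphere N) : evalS v (U s) = 0 :=
  le_antisymm (h.le_of_le hN (fun v => (h0 v).le) hs v) (h.ge_of_ge hN (fun v => (h0 v).ge) hs v)

theorem integrable_kacSigma (hN : 2 ≤ N) {f : KacSphere N → ℝ} (hf : Continuous f) :
    Integrable f (kacSigma N) := by
  have := isProbabilityMeasure_kacSigma hN
  exact hf.integrable_of_hasCompactSupport (HasCompactSupport.of_compactSpace f)

theorem integral_evalS_angD (hN : 2 ≤ N) (i j : Fin N) (p : MvPolynomial (Fin N) ℝ) :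
    ∫ v, evalS v (angD i j p) ∂(kacSigma N) = 0 :=
  integral_eq_zero_of_hasDerivAt_kacRot hN i j (continuous_evalS p) (continuous_evalS _)
    (hasDerivAt_evalS_kacRot i j p)

theorem integral_evalS_angLap (hN : 2 ≤ N) (p : MvPolynomial (Fin N) ℝ) :
    ∫ v, evalS v (angLap N p) ∂(kacSigma N) = 0 := by
  simp only [evalS_angLap]
  rw [integral_const_mul, integral_finsetSum _ fun a _ => integrable_kacSigma hN (continuous_evalS _)]
  simp [integral_evalS_angD hN]

theorem antitoneOn_Ici_of_hasDerivAt {f f' : ℝ → ℝ} (hc : ContinuousOn f (Set.Ici 0))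
    (hd : ∀ t, 0 < t → HasDerivAt f (f' t) t) (hle : ∀ t, 0 < t → f' t ≤ 0) :
    AntitoneOn f (Set.Ici 0) := by
  refine antitoneOn_of_deriv_nonpos (convex_Ici 0) hc ?_ ?_
  · intro t ht
    rw [interior_Ici] at ht
    exact (hd t ht).differentiableAt.differentiableWithinAt
  · intro t ht
    rw [interior_Ici] at ht
    rw [(hd t ht).deriv]
    exact hle t ht

theorem IsPolyFlow.integral_eq (hN : 2 ≤ N) (h : IsPolyFlow (angLap N) U) {s : ℝ} (hs : 0 ≤ s) :
    ∫ v, evalS v (U s) ∂(kacSigma N) = ∫ v, evalS v (U 0) ∂(kacSigma N) := by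
  have := isProbabilityMeasure_kacSigma hN
  obtain ⟨hc, hd⟩ := hasDerivAt_integral_of_continuousOn (μ := kacSigma N)
    (f := fun s v => evalS v (U s)) (f' := fun s v => evalS v (angLap N (U s)))
    h.continuous_evalS.continuousOn (h.continuous (angLap N)).continuousOn
    fun t _ v => h.hasDerivAt_evalS v t
  simp only [integral_evalS_angLap hN] at hd
  have h1 := antitoneOn_Ici_of_hasDerivAt hc hd fun _ _ => le_rfl
  have h2 := antitoneOn_Ici_of_hasDerivAt hc.neg (fun t ht => (hd t ht).neg) fun _ _ => by simp
  have h3 := h1 (Set.mem_Ici.2 le_rfl) (Set.mem_Ici.2 hs) hs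
  have h4 := h2 (Set.mem_Ici.2 le_rfl) (Set.mem_Ici.2 hs) hs
  simp only [Pi.neg_apply] at h4
  linarith

/-- Positive curvature of the sphere, read off from the commutators of the rotation fields. -/
theorem sum_sq_evalS_angD_le (hN : 2 ≤ N) (p : MvPolynomial (Fin N) ℝ) (v : KacSphere N)
    (K : Fin N × Fin N → Fin N × Fin N → ℝ) (hK : ∀ α β, K α β = K β α) :
    ((N : ℝ) - 2) / 4 * ∑ α : Fin N × Fin N, evalS v (angD α.1 α.2 p) ^ 2 ≤
      ∑ α : Fin N × Fin N, ∑ β : Fin N × Fin N,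
        (evalS v (angD β.1 β.2 (angD α.1 α.2 p)) - K β α) ^ 2 := by
  set m : Fin N × Fin N → Fin N × Fin N → ℝ :=
    fun β α => evalS v (angD β.1 β.2 (angD α.1 α.2 p)) - K β α with hm
  -- Only the antisymmetric part of `m` is used; subtracting the symmetric `K` does not alter it.
  have h1 : ∑ α, ∑ β, (m β α - m α β) ^ 2 ≤ 4 * ∑ α, ∑ β, m β α ^ 2 := by
    have e : ∑ α, ∑ β, m α β ^ 2 = ∑ α, ∑ β, m β α ^ 2 := Finset.sum_comm
    calc ∑ α, ∑ β, (m β α - m α β) ^ 2 ≤ ∑ α, ∑ β, (2 * m β α ^ 2 + 2 * m α β ^ 2) := by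
          gcongr with α _ β _
          nlinarith [sq_nonneg (m β α + m α β)]
      _ = 4 * ∑ α, ∑ β, m β α ^ 2 := by
          simp only [Finset.sum_add_distrib, ← Finset.mul_sum]
          rw [e]; ring
  -- Two rotation fields whose planes share the axis `j` have the field `D_il` as commutator.
  have h2 : ∀ i j l : Fin N, j ≠ i → j ≠ l →
      (m (j, l) (i, j) - m (i, j) (j, l)) ^ 2 = evalS v (angD i l p) ^ 2 := by
    intro i j l hi hl
    have := congrArg (evalS v) (angD_angD_sub j l i j p)
    simp only [if_true, if_neg hl, if_neg hi.symm, sub_zero, angD_self, Derivation.zero_apply,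
      ite_self, add_zero, map_sub] at this
    simp only [hm]
    rw [hK (j, l) (i, j), ← this]
    ring
  -- Each `D_il` with `i ≠ l` arises from `N - 2` shared axes `j`; this is the source of the
  -- curvature constant.
  have h3 : ((N : ℝ) - 2) * ∑ α : Fin N × Fin N, evalS v (angD α.1 α.2 p) ^ 2 ≤
      ∑ α, ∑ β, (m β α - m α β) ^ 2 := by
    calc ((N : ℝ) - 2) * ∑ α : Fin N × Fin N, evalS v (angD α.1 α.2 p) ^ 2
        = ∑ i, ∑ l, ((N : ℝ) - 2) * evalS v (angD i l p) ^ 2 := by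
          rw [Finset.mul_sum, Fintype.sum_prod_type]
      _ ≤ ∑ i, ∑ l, ∑ j, (m (j, l) (i, j) - m (i, j) (j, l)) ^ 2 := by
          gcongr with i _ l _
          rcases eq_or_ne i l with rfl | hil
          · simp only [angD_self, Derivation.zero_apply, map_zero]
            simpa using Finset.sum_nonneg fun j _ => sq_nonneg _
          calc ((N : ℝ) - 2) * evalS v (angD i l p) ^ 2
              = ∑ j ∈ (Finset.univ.erase i).erase l, (m (j, l) (i, j) - m (i, j) (j, l)) ^ 2 := by
                rw [Finset.sum_congr rfl fun j hj => h2 i j l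
                  (Finset.ne_of_mem_erase (Finset.mem_of_mem_erase hj)) (Finset.ne_of_mem_erase hj)]
                rw [Finset.sum_const, Finset.card_erase_of_mem (by simp [hil.symm]),
                  Finset.card_erase_of_mem (Finset.mem_univ _), Finset.card_univ, Fintype.card_fin,
                  nsmul_eq_mul, Nat.sub_sub, Nat.cast_sub hN]
                norm_num
            _ ≤ _ := Finset.sum_le_sum_of_subset_of_nonneg (Finset.subset_univ _)
                fun _ _ _ => sq_nonneg _
      _ = ∑ i, ∑ j, ∑ l, (m (j, l) (i, j) - m (i, j) (j, l)) ^ 2 :=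
          Finset.sum_congr rfl fun i _ => Finset.sum_comm
      _ ≤ ∑ i, ∑ j, ∑ β, (m β (i, j) - m (i, j) β) ^ 2 := by
          gcongr with i _ j _
          rw [Fintype.sum_prod_type]
          exact Finset.single_le_sum (f := fun k => ∑ l, (m (k, l) (i, j) - m (i, j) (k, l)) ^ 2)
            (fun k _ => Finset.sum_nonneg fun l _ => sq_nonneg _) (Finset.mem_univ j)
      _ = _ := by rw [Fintype.sum_prod_type]
  linarith

/-- The rate `(N - 2) / 4N`. -/
noncomputable def heatRate (N : ℕ) : ℝ := ((N : ℝ) - 2) / (4 * N)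

theorem heatRate_ge (hN : 3 ≤ N) : 1 / 12 ≤ heatRate N := by
  have : (3 : ℝ) ≤ N := by exact_mod_cast hN
  rw [heatRate, div_le_div_iff₀ (by norm_num) (by positivity)]
  linarith

theorem evalS_angLap_sq (p : MvPolynomial (Fin N) ℝ) (v : KacSphere N) :
    evalS v (angLap N (p ^ 2)) = 2 * evalS v p * evalS v (angLap N p) +
      (N : ℝ)⁻¹ * ∑ β : Fin N × Fin N, evalS v (angD β.1 β.2 p) ^ 2 := by
  rw [evalS_angLap, evalS_angLap]
  have : ∀ β : Fin N × Fin N, evalS v (angD β.1 β.2 (angD β.1 β.2 (p ^ 2))) =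
      2 * evalS v p * evalS v (angD β.1 β.2 (angD β.1 β.2 p)) +
        2 * evalS v (angD β.1 β.2 p) ^ 2 := by
    intro β
    simp only [pow_two, Derivation.leibniz, map_add, smul_eq_mul, map_mul]
    ring
  simp only [this, Finset.sum_add_distrib, ← Finset.mul_sum]
  rcases eq_or_ne (N : ℝ) 0 with h | h
  · simp [h]
  · field_simp

/-- Bakry–Émery gradient estimate: the second-order term in the Laplacian of the squared gradient
dominates `heatRate N` times the squared gradient. Hence `exp (κ s)` times the squared gradient is a
subsolution and the maximum principle applies. -/
theorem IsPolyFlow.sum_sq_angD_le (hN : 2 ≤ N) (h : IsPolyFlow (angLap N) U) {G : ℝ}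
    (hG : ∀ v, ∑ α : Fin N × Fin N, evalS v (_root_.angD α.1 α.2 (U 0)) ^ 2 ≤ G) {s : ℝ}
    (hs : 0 ≤ s) (v : KacSphere N) :
    ∑ α : Fin N × Fin N, evalS v (_root_.angD α.1 α.2 (U s)) ^ 2 ≤
      G * Real.exp (-(heatRate N * s)) := by
  set κ := heatRate N with hκ
  have hNpos : (0 : ℝ) < N := by exact_mod_cast (by omega : 0 < N)
  have key := evalS_le_of_subsolution hN (M := G)
    (P := fun s => Real.exp (κ * s) • ∑ α : Fin N × Fin N, _root_.angD α.1 α.2 (U s) ^ 2)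
    (P' := fun s => (Real.exp (κ * s) * κ) • (∑ α : Fin N × Fin N, _root_.angD α.1 α.2 (U s) ^ 2)
      + Real.exp (κ * s) • ∑ α : Fin N × Fin N,
        (2 : ℝ) • (_root_.angD α.1 α.2 (U s) * angLap N (_root_.angD α.1 α.2 (U s))))
    ?_ ?_ ?_ ?_ hs v
  · simp only [map_smul, map_sum, map_pow, smul_eq_mul] at key
    rw [Real.exp_neg, ← div_eq_mul_inv, le_div_iff₀ (Real.exp_pos _)]
    linarith
  · simp only [map_smul, map_sum, map_pow, smul_eq_mul]
    have := fun α : Fin N × Fin N => (h.angD α.1 α.2).continuous_evalS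
    fun_prop
  · intro s v
    simp only [map_add, map_smul, map_sum, map_pow, smul_eq_mul, map_mul]
    refine HasDerivAt.mul ?_ ?_
    · simpa using ((hasDerivAt_id s).const_mul κ).exp
    · refine HasDerivAt.fun_sum fun α _ => ?_
      convert! ((h.angD α.1 α.2).hasDerivAt_evalS v s).pow 2 using 1
      ring
  · intro s v
    simp only [map_add, map_smul, map_sum, map_pow, smul_eq_mul, map_mul, evalS_angLap_sq]
    have h1 := sum_sq_evalS_angD_le hN (U s) v (fun _ _ => 0) fun _ _ => rfl
    simp only [sub_zero] at h1
    rw [mul_assoc, ← mul_add]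
    refine mul_le_mul_of_nonneg_left ?_ (Real.exp_pos _).le
    rw [Finset.sum_add_distrib, ← Finset.mul_sum, add_comm]
    refine add_le_add (le_of_eq ?_) ?_
    · rw [Finset.mul_sum]
      exact Finset.sum_congr rfl fun α _ => by ring
    rw [← Finset.mul_sum]
    refine le_trans (le_of_eq ?_) (mul_le_mul_of_nonneg_left h1 (inv_nonneg.2 hNpos.le))
    rw [hκ, heatRate]
    field_simp
  · intro v
    simpa using hG v

/-- Gram–Schmidt in the plane of `v` and `w`; the angle is the argument of the complex number formed
from the two coefficients. -/
theorem exists_greatCircle (hN : 2 ≤ N) (v w : KacSphere N) :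
    ∃ (z : KacSphere N) (t : ℝ), ∑ i, v.1 i * z.1 i = 0 ∧ |t| ≤ Real.pi ∧
      ∀ i, w.1 i = v.1 i * Real.cos t + z.1 i * Real.sin t := by
  have hNpos : (0 : ℝ) < N := by exact_mod_cast (by omega : 0 < N)
  have norm_of : ∀ z : EuclideanSpace ℝ (Fin N), z ≠ 0 → ∃ (z' : KacSphere N) (c : ℝ),
      z = c • z'.1 ∧ c ≠ 0 := by
    intro z hz
    have hz' : ‖z‖ ≠ 0 := norm_ne_zero_iff.2 hz
    have hs : Real.sqrt N ≠ 0 := (Real.sqrt_pos.2 hNpos).ne'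
    refine ⟨⟨(Real.sqrt N / ‖z‖) • z, ?_⟩, ‖z‖ / Real.sqrt N, ?_, by positivity⟩
    · rw [mem_sphere_zero_iff_norm, norm_smul, Real.norm_of_nonneg (by positivity)]
      field_simp
    · simp only [smul_smul]
      rw [div_mul_div_comm, mul_comm, div_self (by positivity), one_smul]
  have hinner : ∀ x y : EuclideanSpace ℝ (Fin N), inner ℝ x y = ∑ i, x i * y i := by
    intro x y
    rw [PiLp.inner_apply]
    exact Finset.sum_congr rfl fun i _ => by simp [mul_comm]
  have hself : ∀ x : KacSphere N, inner ℝ x.1 x.1 = (N : ℝ) := by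
    intro x
    rw [hinner]
    exact (Finset.sum_congr rfl fun i _ => by ring).trans x.sum_sq
  have hvv := hself v
  have hz : ∃ (z : KacSphere N) (α β : ℝ), inner ℝ v.1 z.1 = (0 : ℝ) ∧ w.1 = α • v.1 + β • z.1 := by
    set y := w.1 - (inner ℝ v.1 w.1 / N) • v.1 with hy
    have hvy : inner ℝ v.1 y = (0 : ℝ) := by
      rw [hy, inner_sub_right, inner_smul_right, hvv]; field_simp; ring
    by_cases hy0 : y = 0
    -- Here `w` is proportional to `v`, and any direction orthogonal to `v` serves. It exists
    -- because `N ≥ 2`.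
    · have : ∃ z0 : EuclideanSpace ℝ (Fin N), z0 ≠ 0 ∧ inner ℝ v.1 z0 = (0 : ℝ) := by
        have hne : (Submodule.span ℝ {v.1})ᗮ ≠ ⊥ := by
          intro hbot
          rw [Submodule.orthogonal_eq_bot_iff] at hbot
          have h1 := finrank_span_le_card (R := ℝ) ({v.1} : Set (EuclideanSpace ℝ (Fin N)))
          rw [hbot, finrank_top, finrank_euclideanSpace_fin] at h1
          simp only [Set.toFinset_singleton, Finset.card_singleton] at h1
          omega
        obtain ⟨z0, hz0, hne0⟩ := Submodule.exists_mem_ne_zero_of_ne_bot hne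
        exact ⟨z0, hne0, Submodule.mem_orthogonal_singleton_iff_inner_right.1 hz0⟩
      obtain ⟨z0, hz0, hv0⟩ := this
      obtain ⟨z, c, rfl, hc⟩ := norm_of z0 hz0
      refine ⟨z, inner ℝ v.1 w.1 / N, 0, ?_, ?_⟩
      · rw [inner_smul_right] at hv0
        exact (mul_eq_zero.1 hv0).resolve_left hc
      · rw [zero_smul, add_zero]; exact sub_eq_zero.1 hy0
    · obtain ⟨z, c, hzc, hc⟩ := norm_of y hy0
      refine ⟨z, inner ℝ v.1 w.1 / N, c, ?_, ?_⟩
      · rw [hzc, inner_smul_right] at hvy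
        exact (mul_eq_zero.1 hvy).resolve_left hc
      · rw [← hzc, hy]; abel
  obtain ⟨z, α, β, hvz, hw⟩ := hz
  have hzz := hself z
  have hww := hself w
  have hαβ : α ^ 2 + β ^ 2 = 1 := by
    rw [hw] at hww
    simp only [inner_add_left, inner_add_right, inner_smul_left, inner_smul_right, hvv, hzz, hvz,
      real_inner_comm v.1 z.1, RCLike.conj_to_real] at hww
    have : (N : ℝ) * (α ^ 2 + β ^ 2) = N * 1 := by linarith
    exact mul_left_cancel₀ hNpos.ne' this
  have hn : ‖(⟨α, β⟩ : ℂ)‖ = 1 := by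
    rw [Complex.norm_eq_sqrt_sq_add_sq, hαβ, Real.sqrt_one]
  refine ⟨z, Complex.arg ⟨α, β⟩, by rw [← hinner, hvz], Complex.abs_arg_le_pi _, fun i => ?_⟩
  have hne : (⟨α, β⟩ : ℂ) ≠ 0 := by
    intro h; rw [h, norm_zero] at hn; exact zero_ne_one hn
  rw [Complex.cos_arg hne, Complex.sin_arg, hn, hw]
  simp [mul_comm]

/-- A gradient bound gives an oscillation bound by integration along a great circle, over an angle
of at most `π`. -/
theorem abs_evalS_sub_le (hN : 2 ≤ N) (p : MvPolynomial (Fin N) ℝ) {K : ℝ}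
    (hK : ∀ v, ∑ α : Fin N × Fin N, evalS v (angD α.1 α.2 p) ^ 2 ≤ K) (v w : KacSphere N) :
    |evalS w p - evalS v p| ≤ Real.sqrt K * Real.pi := by
  have hNpos : (0 : ℝ) < N := by exact_mod_cast (by omega : 0 < N)
  obtain ⟨z, t, hvz, ht, hw⟩ := exists_greatCircle hN v w
  have hcoord : ∀ x : EuclideanSpace ℝ (Fin N), (∑ i, x i ^ 2 = N) →
      x ∈ Metric.sphere (0 : EuclideanSpace ℝ (Fin N)) (Real.sqrt N) := by
    intro x hx
    rw [mem_sphere_zero_iff_norm, EuclideanSpace.norm_eq]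
    simp [sq_abs, hx]
  have hc2 : ∀ s, ∑ i, (v.1 i * Real.cos s + z.1 i * Real.sin s) ^ 2 = N := by
    intro s
    have : ∀ i, (v.1 i * Real.cos s + z.1 i * Real.sin s) ^ 2 = v.1 i ^ 2 * Real.cos s ^ 2
        + v.1 i * z.1 i * (2 * Real.cos s * Real.sin s) + z.1 i ^ 2 * Real.sin s ^ 2 := by
      intro i; ring
    simp only [this, Finset.sum_add_distrib, ← Finset.sum_mul, v.sum_sq, z.sum_sq, hvz]
    nlinarith [Real.sin_sq_add_cos_sq s]
  let c : ℝ → KacSphere N := fun s =>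
    ⟨WithLp.toLp 2 fun i => v.1 i * Real.cos s + z.1 i * Real.sin s, hcoord _ (hc2 s)⟩
  let c' : ℝ → Fin N → ℝ := fun s i => -(v.1 i) * Real.sin s + z.1 i * Real.cos s
  have hcc' : ∀ s, ∑ i, (c s).1 i * c' s i = 0 := by
    intro s
    have : ∀ i, (c s).1 i * c' s i = (z.1 i ^ 2 - v.1 i ^ 2) * (Real.cos s * Real.sin s)
        + v.1 i * z.1 i * (Real.cos s ^ 2 - Real.sin s ^ 2) := by
      intro i; simp only [c, c']; ring
    simp only [this, Finset.sum_add_distrib, ← Finset.sum_mul, Finset.sum_sub_distrib, v.sum_sq,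
      z.sum_sq, hvz]
    ring
  have hc'2 : ∀ s, ∑ i, c' s i ^ 2 = N := by
    intro s
    have : ∀ i, c' s i ^ 2 = v.1 i ^ 2 * Real.sin s ^ 2
        - v.1 i * z.1 i * (2 * Real.cos s * Real.sin s) + z.1 i ^ 2 * Real.cos s ^ 2 := by
      intro i; simp only [c']; ring
    simp only [this, Finset.sum_add_distrib, Finset.sum_sub_distrib, ← Finset.sum_mul, v.sum_sq,
      z.sum_sq, hvz]
    nlinarith [Real.sin_sq_add_cos_sq s]
  have hcd : ∀ s i, HasDerivAt (fun s => (c s).1 i) (c' s i) s := by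
    intro s i
    convert! ((Real.hasDerivAt_cos s).const_mul (v.1 i)).add
      ((Real.hasDerivAt_sin s).const_mul (z.1 i)) using 1
    simp only [c']; ring
  -- The velocity `c'` is orthogonal to `c` and `|c|² = N`, so `N⁻¹ ∑ c_{α.2} c'_{α.1} D_α` acts on
  -- each coordinate as differentiation along the curve.
  have hderiv : ∀ s, HasDerivAt (fun s => evalS (c s) p)
      ((N : ℝ)⁻¹ * ∑ α : Fin N × Fin N, (c s).1 α.2 * c' s α.1 * evalS (c s) (angD α.1 α.2 p)) s := by
    intro s
    clear hK
    induction p using MvPolynomial.induction_on with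
    | C a => simpa [evalS] using hasDerivAt_const s a
    | add p q hp hq =>
      simp only [map_add, mul_add, Finset.sum_add_distrib]
      exact hp.add hq
    | mul_X p l hp =>
      have hX : HasDerivAt (fun s => (c s).1 l)
          ((N : ℝ)⁻¹ * ∑ α : Fin N × Fin N,
            (c s).1 α.2 * c' s α.1 * evalS (c s) (angD α.1 α.2 (MvPolynomial.X l))) s := by
        have hα : ∀ α : Fin N × Fin N,
            (c s).1 α.2 * c' s α.1 * evalS (c s) (angD α.1 α.2 (MvPolynomial.X l)) =
            (if l = α.1 then (c s).1 α.2 ^ 2 * c' s α.1 else 0)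
              - (if l = α.2 then (c s).1 α.2 * ((c s).1 α.1 * c' s α.1) else 0) := by
          intro α
          rw [angD_X, map_sub]
          split_ifs <;> simp <;> ring
        simp only [hα, Finset.sum_sub_distrib]
        rw [Fintype.sum_prod_type, Fintype.sum_prod_type]
        rw [Finset.sum_comm]
        simp only [Finset.sum_ite_eq, Finset.mem_univ, if_true, ← Finset.sum_mul, ← Finset.mul_sum,
          (c s).sum_sq, hcc']
        convert! hcd s l using 1
        field_simp
        ring
      have := hp.mul hX
      simp only [map_mul, evalS_X, Derivation.leibniz, smul_eq_mul, map_add]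
      convert! this using 1
      simp only [Finset.mul_sum, Finset.sum_mul, ← Finset.sum_add_distrib]
      exact Finset.sum_congr rfl fun α _ => by ring
  have hbound : ∀ s, ‖(N : ℝ)⁻¹ * ∑ α : Fin N × Fin N,
      (c s).1 α.2 * c' s α.1 * evalS (c s) (angD α.1 α.2 p)‖ ≤ Real.sqrt K := by
    intro s
    rw [norm_mul, Real.norm_eq_abs, Real.norm_eq_abs, abs_of_pos (inv_pos.2 hNpos),
      inv_mul_le_iff₀ hNpos]
    have h1 := Finset.sum_mul_sq_le_sq_mul_sq Finset.univ
      (fun α : Fin N × Fin N => (c s).1 α.2 * c' s α.1)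
      (fun α : Fin N × Fin N => evalS (c s) (angD α.1 α.2 p))
    have h2 : ∑ α : Fin N × Fin N, ((c s).1 α.2 * c' s α.1) ^ 2 = (N : ℝ) ^ 2 := by
      simp only [mul_pow]
      rw [Fintype.sum_prod_type]
      simp only [← Finset.sum_mul, (c s).sum_sq, ← Finset.mul_sum, hc'2]
      ring
    rw [h2] at h1
    refine (Real.abs_le_sqrt (h1.trans (mul_le_mul_of_nonneg_left (hK (c s))
      (sq_nonneg _)))).trans_eq ?_
    rw [Real.sqrt_mul (sq_nonneg _), Real.sqrt_sq hNpos.le]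
  have := Convex.norm_image_sub_le_of_norm_hasDerivWithin_le (f := fun s => evalS (c s) p)
    (s := Set.univ) (C := Real.sqrt K) (x := 0) (y := t)
    (fun s _ => (hderiv s).hasDerivWithinAt) (fun s _ => hbound s) convex_univ
    (Set.mem_univ _) (Set.mem_univ _)
  have e0 : c 0 = v := KacSphere.ext_coord fun i => by simp [c]
  have et : c t = w := KacSphere.ext_coord fun i => by simp [c, hw]
  rw [e0, et, Real.norm_eq_abs, Real.norm_eq_abs, sub_zero] at this
  exact this.trans (mul_le_mul_of_nonneg_left ht (Real.sqrt_nonneg _))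

end heat

/-! ### Entropy and Fisher information along the heat flow -/

section fisher
variable {N : ℕ}

/-- Common frame for the three integrations by parts below. The hypothesis says that, direction by
direction, the second-order terms plus the remainder `R β` have zero integral, as exact rotation
derivatives do; what survives is the sum of the remainders. -/
theorem integral_mul_angLap (hN : 2 ≤ N) {φ₁ φ₂ φ₃ : KacSphere N → ℝ}
    (p₁ p₂ p₃ : MvPolynomial (Fin N) ℝ) (R : Fin N × Fin N → KacSphere N → ℝ)
    (h₁ : Continuous φ₁) (h₂ : Continuous φ₂) (h₃ : Continuous φ₃) (hR : ∀ β, Continuous (R β))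
    (h : ∀ β : Fin N × Fin N, ∫ v, (φ₁ v * evalS v (angD β.1 β.2 (angD β.1 β.2 p₁))
      + φ₂ v * evalS v (angD β.1 β.2 (angD β.1 β.2 p₂))
      + φ₃ v * evalS v (angD β.1 β.2 (angD β.1 β.2 p₃)) + R β v) ∂(kacSigma N) = 0) :
    ∫ v, (φ₁ v * evalS v (angLap N p₁) + φ₂ v * evalS v (angLap N p₂)
      + φ₃ v * evalS v (angLap N p₃)) ∂(kacSigma N)
      = -((2 * (N : ℝ))⁻¹ * ∑ β, ∫ v, R β v ∂(kacSigma N)) := by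
  have hc := fun p : MvPolynomial (Fin N) ℝ => continuous_evalS p
  have e : ∀ v, φ₁ v * evalS v (angLap N p₁) + φ₂ v * evalS v (angLap N p₂)
      + φ₃ v * evalS v (angLap N p₃) = (2 * (N : ℝ))⁻¹ * ∑ β : Fin N × Fin N,
        ((φ₁ v * evalS v (angD β.1 β.2 (angD β.1 β.2 p₁))
      + φ₂ v * evalS v (angD β.1 β.2 (angD β.1 β.2 p₂))
      + φ₃ v * evalS v (angD β.1 β.2 (angD β.1 β.2 p₃)) + R β v) - R β v) := by
    intro v
    simp only [evalS_angLap, add_sub_cancel_right, Finset.sum_add_distrib, ← Finset.mul_sum]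
    ring
  simp only [e]
  rw [integral_const_mul, integral_finsetSum _ fun β _ =>
    integrable_kacSigma hN (by have := hR β; fun_prop)]
  rw [← mul_neg, ← Finset.sum_neg_distrib]
  refine congrArg _ (Finset.sum_congr rfl fun β _ => ?_)
  rw [integral_sub (integrable_kacSigma hN (by have := hR β; fun_prop))
    (integrable_kacSigma hN (hR β)), h β, zero_sub]

/-- The Fisher information of a polynomial density. -/
noncomputable def fisherInfo (p : MvPolynomial (Fin N) ℝ) : ℝ :=
  (2 * (N : ℝ))⁻¹ * ∑ α : Fin N × Fin N,
    ∫ v, evalS v (angD α.1 α.2 p) ^ 2 / evalS v p ∂(kacSigma N)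

/-- The left side is the time derivative of the entropy along the heat flow; the exact derivative is
that of `(log p + 1) D_β p`. -/
theorem integral_entropy_angLap (hN : 2 ≤ N) {p : MvPolynomial (Fin N) ℝ}
    (hp : ∀ v, 0 < evalS v p) :
    ∫ v, (Real.log (evalS v p) + 1) * evalS v (angLap N p) ∂(kacSigma N) = -fisherInfo p := by
  have hc := fun p : MvPolynomial (Fin N) ℝ => continuous_evalS p
  have hlog : Continuous fun v : KacSphere N => Real.log (evalS v p) :=
    (hc p).log fun v => (hp v).ne'
  have hR : ∀ β : Fin N × Fin N, Continuous fun v : KacSphere N =>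
      evalS v (angD β.1 β.2 p) ^ 2 / evalS v p :=
    fun β => ((hc _).pow 2).div (hc p) fun v => (hp v).ne'
  have := integral_mul_angLap hN p 0 0 (fun (β : Fin N × Fin N) (v : KacSphere N) =>
    evalS v (angD β.1 β.2 p) ^ 2 / evalS v p)
    (by fun_prop : Continuous fun v => Real.log (evalS v p) + 1)
    continuous_zero continuous_zero hR ?_
  · simpa [fisherInfo] using this
  intro β
  simp only [Pi.zero_apply, zero_mul, add_zero]
  refine integral_eq_zero_of_hasDerivAt_kacRot hN β.1 β.2
    (f := fun v => (Real.log (evalS v p) + 1) * evalS v (angD β.1 β.2 p))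
    (by fun_prop) (by have := hR β; fun_prop) fun v θ => ?_
  have h0 := hasDerivAt_evalS_kacRot β.1 β.2 p v θ
  have h1 := hasDerivAt_evalS_kacRot β.1 β.2 (angD β.1 β.2 p) v θ
  have hpos := (hp (kacRot β.1 β.2 θ v)).ne'
  refine (((h0.log hpos).add_const 1).mul h1).congr_deriv ?_
  ring

/-- The left side is the time derivative of `∫ f² / p` when `f` and `p` both solve the heat
equation. The Hessian of the jointly convex function `f² / p` is a perfect square, which appears on
the right; the application is `f = D_α p`. -/
theorem integral_fisher_angLap (hN : 2 ≤ N) {p : MvPolynomial (Fin N) ℝ}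
    (hp : ∀ v, 0 < evalS v p) (f : MvPolynomial (Fin N) ℝ) :
    ∫ v, (2 * evalS v f / evalS v p * evalS v (angLap N f)
      + -(evalS v f / evalS v p) ^ 2 * evalS v (angLap N p)) ∂(kacSigma N) =
    -((2 * (N : ℝ))⁻¹ * ∑ β : Fin N × Fin N, ∫ v, 2 / evalS v p * (evalS v (angD β.1 β.2 f)
      - evalS v f * evalS v (angD β.1 β.2 p) / evalS v p) ^ 2 ∂(kacSigma N)) := by
  have hc := fun p : MvPolynomial (Fin N) ℝ => continuous_evalS p
  have hp0 : ∀ v : KacSphere N, evalS v p ≠ 0 := fun v => (hp v).ne'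
  have hR : ∀ β : Fin N × Fin N, Continuous fun v : KacSphere N =>
      2 / evalS v p * (evalS v (angD β.1 β.2 f)
      - evalS v f * evalS v (angD β.1 β.2 p) / evalS v p) ^ 2 := by
    intro β; fun_prop (disch := exact hp0 _)
  have := integral_mul_angLap hN f p 0 (fun (β : Fin N × Fin N) (v : KacSphere N) =>
      2 / evalS v p * (evalS v (angD β.1 β.2 f)
      - evalS v f * evalS v (angD β.1 β.2 p) / evalS v p) ^ 2)
    (by fun_prop (disch := exact hp0 _) : Continuous fun v => 2 * evalS v f / evalS v p)
    (by fun_prop (disch := exact hp0 _) : Continuous fun v => -(evalS v f / evalS v p) ^ 2)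
    continuous_zero hR ?_
  · simpa using this
  intro β
  simp only [Pi.zero_apply, zero_mul, add_zero]
  refine integral_eq_zero_of_hasDerivAt_kacRot hN β.1 β.2
    (f := fun v => 2 * evalS v f / evalS v p * evalS v (angD β.1 β.2 f)
      - (evalS v f / evalS v p) ^ 2 * evalS v (angD β.1 β.2 p))
    (by fun_prop (disch := exact hp0 _)) (by fun_prop (disch := exact hp0 _)) fun v θ => ?_
  have h0 := hasDerivAt_evalS_kacRot β.1 β.2 p v θ
  have h1 := hasDerivAt_evalS_kacRot β.1 β.2 (angD β.1 β.2 p) v θ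
  have h2 := hasDerivAt_evalS_kacRot β.1 β.2 f v θ
  have h3 := hasDerivAt_evalS_kacRot β.1 β.2 (angD β.1 β.2 f) v θ
  have hpos := hp0 (kacRot β.1 β.2 θ v)
  refine ((((h2.const_mul 2).div h0 hpos).mul h3).sub (((h2.div h0 hpos).pow 2).mul h1)).congr_deriv ?_
  simp
  field_simp
  ring

/-- With `p` and `q` both evolving, the first two terms are the time derivative of the relative
entropy weighted by `w`. The weight costs one extra term, in which the Laplacian has been moved onto
`w`, and the dissipation is the squared gradient of `log (p / q)`. -/
theorem integral_relEntropy_angLap (hN : 2 ≤ N) {p q : MvPolynomial (Fin N) ℝ}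
    (hp : ∀ v, 0 < evalS v p) (hq : ∀ v, 0 < evalS v q) (w : MvPolynomial (Fin N) ℝ) :
    ∫ v, (evalS v w * (Real.log (evalS v p) - Real.log (evalS v q)) * evalS v (angLap N p)
      + evalS v w * (1 - evalS v p / evalS v q) * evalS v (angLap N q)
      + -(evalS v p * (Real.log (evalS v p) - Real.log (evalS v q)) - evalS v p + evalS v q)
        * evalS v (angLap N w)) ∂(kacSigma N) =
    -((2 * (N : ℝ))⁻¹ * ∑ β : Fin N × Fin N, ∫ v, evalS v w * (evalS v p *
      (evalS v (angD β.1 β.2 p) / evalS v p - evalS v (angD β.1 β.2 q) / evalS v q) ^ 2)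
        ∂(kacSigma N)) := by
  have hc := fun p : MvPolynomial (Fin N) ℝ => continuous_evalS p
  have hp0 : ∀ v : KacSphere N, evalS v p ≠ 0 := fun v => (hp v).ne'
  have hq0 : ∀ v : KacSphere N, evalS v q ≠ 0 := fun v => (hq v).ne'
  have hlp : Continuous fun v : KacSphere N => Real.log (evalS v p) := (hc p).log hp0
  have hlq : Continuous fun v : KacSphere N => Real.log (evalS v q) := (hc q).log hq0
  refine integral_mul_angLap hN p q w (fun (β : Fin N × Fin N) (v : KacSphere N) =>
      evalS v w * (evalS v p * (evalS v (angD β.1 β.2 p) / evalS v p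
        - evalS v (angD β.1 β.2 q) / evalS v q) ^ 2))
    (φ₁ := fun v => evalS v w * (Real.log (evalS v p) - Real.log (evalS v q)))
    (φ₂ := fun v => evalS v w * (1 - evalS v p / evalS v q))
    (φ₃ := fun v => -(evalS v p * (Real.log (evalS v p) - Real.log (evalS v q))
      - evalS v p + evalS v q))
    (by fun_prop) (by fun_prop (disch := exact hq0 _)) (by fun_prop) (fun β => ?_) ?_
  · fun_prop (disch := first | exact hp0 _ | exact hq0 _)
  intro β
  refine integral_eq_zero_of_hasDerivAt_kacRot hN β.1 β.2
    (f := fun v => evalS v w * ((Real.log (evalS v p) - Real.log (evalS v q))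
        * evalS v (angD β.1 β.2 p)
      + (1 - evalS v p / evalS v q) * evalS v (angD β.1 β.2 q))
      - evalS v (angD β.1 β.2 w) * (evalS v p * (Real.log (evalS v p) - Real.log (evalS v q))
      - evalS v p + evalS v q))
    (by fun_prop (disch := first | exact hp0 _ | exact hq0 _))
    (by fun_prop (disch := first | exact hp0 _ | exact hq0 _)) fun v θ => ?_
  have hP := hp0 (kacRot β.1 β.2 θ v)
  have hQ := hq0 (kacRot β.1 β.2 θ v)
  have p0 := hasDerivAt_evalS_kacRot β.1 β.2 p v θ
  have p1 := hasDerivAt_evalS_kacRot β.1 β.2 (angD β.1 β.2 p) v θ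
  have q0 := hasDerivAt_evalS_kacRot β.1 β.2 q v θ
  have q1 := hasDerivAt_evalS_kacRot β.1 β.2 (angD β.1 β.2 q) v θ
  have w0 := hasDerivAt_evalS_kacRot β.1 β.2 w v θ
  have w1 := hasDerivAt_evalS_kacRot β.1 β.2 (angD β.1 β.2 w) v θ
  have hl := (p0.log hP).sub (q0.log hQ)
  have hr := ((hasDerivAt_const θ (1 : ℝ)).sub (p0.div q0 hQ)).mul q1
  refine ((w0.mul ((hl.mul p1).add hr)).sub (w1.mul (((p0.mul hl).sub p0).add q0))).congr_deriv ?_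
  simp
  field_simp
  ring

end fisher

/-! ### Convergence of the heat flow and the logarithmic Sobolev inequality -/

section logSobolev
variable {N : ℕ} {U : ℝ → MvPolynomial (Fin N) ℝ}

theorem IsPolyFlow.entropy (hN : 2 ≤ N) (h : IsPolyFlow (angLap N) U) {a : ℝ} (ha : 0 < a)
    (h0 : ∀ v, a ≤ evalS v (U 0)) :
    ContinuousOn (fun s => ∫ v, evalS v (U s) * Real.log (evalS v (U s)) ∂(kacSigma N))
      (Set.Ici 0) ∧
    ∀ s, 0 < s → HasDerivAt
      (fun s => ∫ v, evalS v (U s) * Real.log (evalS v (U s)) ∂(kacSigma N))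
      (-fisherInfo (U s)) s := by
  have := isProbabilityMeasure_kacSigma hN
  have hpos : ∀ s, 0 ≤ s → ∀ v, 0 < evalS v (U s) := fun s hs v =>
    ha.trans_le (h.ge_of_ge hN h0 hs v)
  have hU := h.continuous_evalS.continuousOn (s := Set.Ici 0 ×ˢ Set.univ)
  have hA := (h.continuous (angLap N)).continuousOn (s := Set.Ici 0 ×ˢ Set.univ)
  have hL : ContinuousOn (fun q : ℝ × KacSphere N => Real.log (evalS q.2 (U q.1)))
      (Set.Ici 0 ×ˢ Set.univ) := hU.log fun q hq => (hpos _ hq.1 _).ne'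
  obtain ⟨h1, h2⟩ := hasDerivAt_integral_of_continuousOn (μ := kacSigma N)
    (f := fun s v => evalS v (U s) * Real.log (evalS v (U s)))
    (f' := fun s v => (Real.log (evalS v (U s)) + 1) * evalS v (angLap N (U s)))
    (hU.mul hL) ((hL.add continuousOn_const).mul hA) (fun t ht v => by
      have hd := h.hasDerivAt_evalS v t
      have hne := (hpos t ht.le v).ne'
      refine (hd.mul (hd.log hne)).congr_deriv ?_
      field_simp)
  refine ⟨h1, fun s hs => ?_⟩
  rw [← integral_entropy_angLap hN (hpos s hs.le)]
  exact h2 s hs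

theorem fisherInfo_nonneg {p : MvPolynomial (Fin N) ℝ} (hp : ∀ v, 0 < evalS v p) :
    0 ≤ fisherInfo p :=
  mul_nonneg (by positivity) (Finset.sum_nonneg fun _ _ => integral_nonneg fun v =>
    div_nonneg (sq_nonneg _) (hp v).le)

/-- Second step of the Bakry–Émery argument: the dissipation of the Fisher information is bounded
below by curvature. -/
theorem IsPolyFlow.fisherInfo (hN : 2 ≤ N) (h : IsPolyFlow (angLap N) U) {a : ℝ} (ha : 0 < a)
    (h0 : ∀ v, a ≤ evalS v (U 0)) :
    ContinuousOn (fun s => _root_.fisherInfo (U s)) (Set.Ici 0) ∧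
    ∃ d : ℝ → ℝ, ∀ s, 0 < s → HasDerivAt (fun s => _root_.fisherInfo (U s)) (d s) s ∧
      d s ≤ -(heatRate N * _root_.fisherInfo (U s)) := by
  have := isProbabilityMeasure_kacSigma hN
  have hNpos : (0 : ℝ) < N := by exact_mod_cast (by omega : 0 < N)
  have hpos : ∀ s, 0 ≤ s → ∀ v, 0 < evalS v (U s) := fun s hs v =>
    ha.trans_le (h.ge_of_ge hN h0 hs v)
  have hU := h.continuous_evalS.continuousOn (s := Set.Ici 0 ×ˢ Set.univ)
  have hA := (h.continuous (angLap N)).continuousOn (s := Set.Ici 0 ×ˢ Set.univ)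
  have hne : ∀ q ∈ Set.Ici (0 : ℝ) ×ˢ (Set.univ : Set (KacSphere N)), evalS q.2 (U q.1) ≠ 0 :=
    fun q hq => (hpos _ hq.1 _).ne'
  have key : ∀ α : Fin N × Fin N, _ := fun α => by
    have hα := h.angD α.1 α.2
    have hf := hα.continuous_evalS.continuousOn (s := Set.Ici 0 ×ˢ Set.univ)
    have hfA := (hα.continuous (angLap N)).continuousOn (s := Set.Ici 0 ×ˢ Set.univ)
    exact hasDerivAt_integral_of_continuousOn (μ := kacSigma N)
      (f := fun s v => evalS v (_root_.angD α.1 α.2 (U s)) ^ 2 / evalS v (U s))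
      (f' := fun s v => 2 * evalS v (_root_.angD α.1 α.2 (U s)) / evalS v (U s)
          * evalS v (angLap N (_root_.angD α.1 α.2 (U s)))
        + -(evalS v (_root_.angD α.1 α.2 (U s)) / evalS v (U s)) ^ 2 * evalS v (angLap N (U s)))
      ((hf.pow 2).div hU hne)
      ((((continuousOn_const.mul hf).div hU hne).mul hfA).add (((hf.div hU hne).pow 2).neg.mul hA))
      (fun t ht v => by
        have hd := h.hasDerivAt_evalS v t
        have hd' := hα.hasDerivAt_evalS v t
        have hne := (hpos t ht.le v).ne'
        refine ((hd'.pow 2).div hd hne).congr_deriv ?_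
        simp
        field_simp
        ring)
  refine ⟨continuousOn_const.mul (continuousOn_finsetSum _ fun α _ => (key α).1), ?_⟩
  refine ⟨_, fun s hs => ⟨(HasDerivAt.fun_sum fun α _ => (key α).2 s hs).const_mul _, ?_⟩⟩
  have hp := hpos s hs.le
  have hp0 : ∀ v : KacSphere N, evalS v (U s) ≠ 0 := fun v => (hp v).ne'
  have hc := fun p : MvPolynomial (Fin N) ℝ => _root_.continuous_evalS p
  simp only [integral_fisher_angLap hN hp]
  rw [_root_.fisherInfo, Finset.sum_neg_distrib, mul_neg, neg_le_neg_iff, mul_left_comm]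
  refine mul_le_mul_of_nonneg_left ?_ (by positivity)
  rw [← Finset.mul_sum]
  have hint1 : ∀ α β : Fin N × Fin N, Integrable (fun v : KacSphere N =>
      2 / evalS v (U s) * (evalS v (_root_.angD β.1 β.2 (_root_.angD α.1 α.2 (U s))) -
        evalS v (_root_.angD α.1 α.2 (U s)) * evalS v (_root_.angD β.1 β.2 (U s)) /
          evalS v (U s)) ^ 2) (kacSigma N) := fun α β =>
    integrable_kacSigma hN (by fun_prop (disch := exact hp0 _))
  have hint2 : ∀ α : Fin N × Fin N, Integrable (fun v : KacSphere N =>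
      evalS v (_root_.angD α.1 α.2 (U s)) ^ 2 / evalS v (U s)) (kacSigma N) := fun α =>
    integrable_kacSigma hN (by fun_prop (disch := exact hp0 _))
  rw [Finset.sum_congr rfl fun α _ => (integral_finsetSum _ fun β _ => hint1 α β).symm,
    ← integral_finsetSum _ fun α _ => integrable_finsetSum _ fun β _ => hint1 α β,
    ← integral_finsetSum _ fun α _ => hint2 α, ← integral_const_mul, ← integral_const_mul]
  refine integral_mono ((integrable_finsetSum _ fun α _ => hint2 α).const_mul _)
    ((integrable_finsetSum _ fun α _ => integrable_finsetSum _ fun β _ => hint1 α β).const_mul _)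
    fun v => ?_
  -- With this symmetric correction, `D_β D_α p - K β α` equals `p D_β D_α log p`.
  have hcurv := sum_sq_evalS_angD_le hN (U s) v (fun β α =>
    evalS v (_root_.angD α.1 α.2 (U s)) * evalS v (_root_.angD β.1 β.2 (U s)) / evalS v (U s))
    fun α β => by ring
  simp only [← Finset.mul_sum, ← Finset.sum_div]
  have hpv := hp v
  calc heatRate N * ((∑ α : Fin N × Fin N, evalS v (_root_.angD α.1 α.2 (U s)) ^ 2) / evalS v (U s))
      = (2 * (N : ℝ))⁻¹ * (2 / evalS v (U s) * (((N : ℝ) - 2) / 4 *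
        ∑ α : Fin N × Fin N, evalS v (_root_.angD α.1 α.2 (U s)) ^ 2)) := by
        rw [heatRate]; field_simp
    _ ≤ _ := by gcongr

/-- The gradient decays exponentially, hence so does the oscillation, and the mean is conserved. -/
theorem IsPolyFlow.abs_sub_integral_le (hN : 2 ≤ N) (h : IsPolyFlow (angLap N) U) :
    ∃ K : ℝ, 0 ≤ K ∧ ∀ s, 0 ≤ s → ∀ v,
      |evalS v (U s) - ∫ w, evalS w (U 0) ∂(kacSigma N)| ≤
        K * Real.sqrt (Real.exp (-(heatRate N * s))) := by
  have := isProbabilityMeasure_kacSigma hN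
  have := KacSphere.nonempty hN
  have hcont : Continuous fun v : KacSphere N =>
      ∑ α : Fin N × Fin N, evalS v (_root_.angD α.1 α.2 (U 0)) ^ 2 :=
    continuous_finsetSum _ fun α _ => (_root_.continuous_evalS _).pow 2
  obtain ⟨w0, -, hw0⟩ := isCompact_univ.exists_isMaxOn Set.univ_nonempty hcont.continuousOn
  set G := ∑ α : Fin N × Fin N, evalS w0 (_root_.angD α.1 α.2 (U 0)) ^ 2 with hG
  have hG0 : 0 ≤ G := Finset.sum_nonneg fun _ _ => sq_nonneg _
  refine ⟨Real.sqrt G * Real.pi, by positivity, fun s hs v => ?_⟩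
  have h1 := abs_evalS_sub_le hN (U s) (h.sum_sq_angD_le hN (G := G)
    (fun v => isMaxOn_iff.1 hw0 v (Set.mem_univ v)) hs)
  rw [← h.integral_eq hN hs]
  have hint := integrable_kacSigma hN (_root_.continuous_evalS (U s))
  have e : evalS v (U s) - ∫ w, evalS w (U s) ∂(kacSigma N)
      = ∫ w, (evalS v (U s) - evalS w (U s)) ∂(kacSigma N) := by
    rw [integral_sub (integrable_const _) hint]; simp
  rw [e, ← Real.norm_eq_abs]
  refine (norm_integral_le_of_norm_le_const (C := Real.sqrt G * Real.pi *
    Real.sqrt (Real.exp (-(heatRate N * s)))) (Filter.Eventually.of_forall fun w => ?_)).trans ?_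
  · rw [Real.norm_eq_abs]
    refine (h1 w v).trans (le_of_eq ?_)
    rw [Real.sqrt_mul hG0]; ring
  · simp

/-- The entropy `∫ p log p - m log m`, `m = ∫ p`, of a function on the sphere. -/
noncomputable def relEnt (f : KacSphere N → ℝ) : ℝ :=
  ∫ v, f v * Real.log (f v) ∂(kacSigma N)
    - (∫ v, f v ∂(kacSigma N)) * Real.log (∫ v, f v ∂(kacSigma N))

/-- Since `log (f / m) ≤ (f - m) / m`, uniform closeness of `f` to its mean bounds the entropy. -/
theorem IsPolyFlow.relEnt_le (hN : 2 ≤ N) (h : IsPolyFlow (angLap N) U) {a : ℝ} (ha : 0 < a)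
    (h0 : ∀ v, a ≤ evalS v (U 0)) :
    ∃ K : ℝ, ∀ s, 0 ≤ s → relEnt (fun v => evalS v (U s)) ≤
        K * Real.sqrt (Real.exp (-(heatRate N * s))) := by
  have := isProbabilityMeasure_kacSigma hN
  obtain ⟨K, hK0, hK⟩ := h.abs_sub_integral_le hN
  set m := ∫ w, evalS w (U 0) ∂(kacSigma N) with hm
  have hint := fun s => integrable_kacSigma hN (_root_.continuous_evalS (U s))
  have hma : a ≤ m := by
    have := integral_mono (integrable_const a) (hint 0) h0
    simpa using this
  have hmpos : 0 < m := ha.trans_le hma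
  refine ⟨K, fun s hs => ?_⟩
  have hpos : ∀ v, 0 < evalS v (U s) := fun v => ha.trans_le (h.ge_of_ge hN h0 hs v)
  set δ := K * Real.sqrt (Real.exp (-(heatRate N * s))) with hδ
  have hcl : Continuous fun v : KacSphere N => Real.log (evalS v (U s)) :=
    (_root_.continuous_evalS _).log fun v => (hpos v).ne'
  have hmean := h.integral_eq hN hs
  have e : relEnt (fun v => evalS v (U s)) =
      ∫ v, evalS v (U s) * (Real.log (evalS v (U s)) - Real.log m) ∂(kacSigma N) := by
    have hi : Integrable (fun v : KacSphere N => evalS v (U s) * Real.log (evalS v (U s)))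
        (kacSigma N) := integrable_kacSigma hN ((_root_.continuous_evalS _).mul hcl)
    simp only [mul_sub]
    rw [integral_sub hi
      ((hint s).mul_const _), integral_mul_const, relEnt, hmean]
  rw [e]
  calc _ ≤ ∫ v, evalS v (U s) * (δ / m) ∂(kacSigma N) := by
        refine integral_mono (integrable_kacSigma hN ((_root_.continuous_evalS _).mul
          (hcl.sub continuous_const))) ((hint s).mul_const _) fun v => ?_
        refine mul_le_mul_of_nonneg_left ?_ (hpos v).le
        rw [← Real.log_div (hpos v).ne' hmpos.ne']
        refine (Real.log_le_sub_one_of_pos (div_pos (hpos v) hmpos)).trans ?_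
        rw [div_sub_one hmpos.ne']
        gcongr
        exact (abs_le.1 (hK s hs v)).2
    _ = δ := by rw [integral_mul_const, hmean, ← hm]; field_simp

theorem tendsto_heat_decay (hN : 3 ≤ N) (K : ℝ) :
    Filter.Tendsto (fun s => K * Real.sqrt (Real.exp (-(heatRate N * s)))) Filter.atTop (nhds 0) := by
  have hκ : 0 < heatRate N := by linarith [heatRate_ge hN]
  have h1 : Filter.Tendsto (fun s => Real.exp (-(heatRate N * s))) Filter.atTop (nhds 0) :=
    Real.tendsto_exp_neg_atTop_nhds_zero.comp (Filter.tendsto_id.const_mul_atTop hκ)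
  simpa using ((Real.continuous_sqrt.tendsto 0).comp h1).const_mul K

/-- A logarithmic Sobolev inequality on the sphere. -/
theorem heatRate_mul_relEnt_le (hN : 3 ≤ N) {p : MvPolynomial (Fin N) ℝ} {a : ℝ} (ha : 0 < a)
    (hp : ∀ v, a ≤ evalS v p) : heatRate N * relEnt (fun v => evalS v p) ≤ fisherInfo p := by
  have hN2 : 2 ≤ N := by omega
  have hκ : 0 < heatRate N := by linarith [heatRate_ge hN]
  obtain ⟨U, rfl, h⟩ := exists_isPolyFlow (angLap N)
    (fun d p hp => angLap_mem_restrictTotalDegree d hp) p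
  obtain ⟨c1, d1⟩ := h.entropy hN2 ha hp
  obtain ⟨c2, d, d2⟩ := h.fisherInfo hN2 ha hp
  set m := ∫ w, evalS w (U 0) ∂(kacSigma N) with hm
  -- Along the flow `H' = -I` and `I' ≤ -κ I`, so `I - κ H` is nonincreasing. With `I ≥ 0` and the
  -- entropy relative to the mean tending to zero, its initial value is nonnegative once `H` is
  -- centred.
  have hanti := antitoneOn_Ici_of_hasDerivAt (f := fun s => fisherInfo (U s) -
      heatRate N * ∫ v, evalS v (U s) * Real.log (evalS v (U s)) ∂(kacSigma N))
    (c2.sub (continuousOn_const.mul c1))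
    (fun t ht => (d2 t ht).1.sub ((d1 t ht).const_mul (heatRate N)))
    (fun t ht => by linarith [(d2 t ht).2])
  obtain ⟨K, hK⟩ := h.relEnt_le hN2 ha hp
  have hlim := tendsto_heat_decay hN (heatRate N * K)
  have hlim' : Filter.Tendsto (fun s => -(heatRate N * K *
    Real.sqrt (Real.exp (-(heatRate N * s))))) Filter.atTop (nhds 0) := by simpa using hlim.neg
  refine sub_nonneg.1 (le_of_tendsto hlim' ?_)
  filter_upwards [Filter.eventually_ge_atTop 0] with s hs
  have h1 := hanti (Set.mem_Ici.2 le_rfl) (Set.mem_Ici.2 hs) hs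
  simp only at h1
  have h2 := hK s hs
  rw [relEnt, h.integral_eq hN2 hs] at h2
  rw [relEnt]
  have h3 : 0 ≤ fisherInfo (U s) :=
    fisherInfo_nonneg fun v => ha.trans_le (h.ge_of_ge hN2 hp hs v)
  have h4 := mul_le_mul_of_nonneg_left h2 hκ.le
  nlinarith

end logSobolev

/-! ### Averages over rotations -/

/-- The average of `F` over the rotations in the plane of the coordinates `i` and `j`. -/
noncomputable def kacAvg {N : ℕ} (i j : Fin N) (F : KacSphere N → ℝ) (v : KacSphere N) : ℝ :=
  1 / (2 * Real.pi) * ∫ θ in (-Real.pi)..Real.pi, F (kacRot i j θ v)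

section avg
variable {N : ℕ}

theorem kacAvg_const (i j : Fin N) (c : ℝ) (v : KacSphere N) : kacAvg i j (fun _ => c) v = c := by
  simp only [kacAvg, intervalIntegral.integral_const, smul_eq_mul]
  field_simp
  ring

theorem kacAvg_self (i : Fin N) (F : KacSphere N → ℝ) (v : KacSphere N) :
    kacAvg i i F v = F v := by
  have := kacAvg_const i i (F v) v
  simpa [kacAvg] using this

theorem kacAvg_kacRot (i j : Fin N) (F : KacSphere N → ℝ) (τ : ℝ) (v : KacSphere N) :
    kacAvg i j F (kacRot i j τ v) = kacAvg i j F v := by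
  simp only [kacAvg, kacRot_add]
  congr 1
  have hper : Function.Periodic (fun θ => F (kacRot i j θ v)) (2 * Real.pi) := fun θ => by
    have := kacRot_periodic i j v θ
    simp only at this ⊢
    rw [this]
  have h1 := hper.intervalIntegral_add_eq (-Real.pi + τ) (-Real.pi)
  rw [intervalIntegral.integral_comp_add_right fun θ => F (kacRot i j θ v)]
  convert h1 using 2 <;> ring

theorem kacAvg_mul_of_invariant (i j : Fin N) {w : KacSphere N → ℝ}
    (hw : ∀ θ v, w (kacRot i j θ v) = w v) (F : KacSphere N → ℝ) (v : KacSphere N) :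
    kacAvg i j (fun v => w v * F v) v = w v * kacAvg i j F v := by
  simp only [kacAvg, hw, intervalIntegral.integral_const_mul]
  ring

theorem kacAvg_swap (i j : Fin N) (F : KacSphere N → ℝ) (v : KacSphere N) :
    kacAvg j i F v = kacAvg i j F v := by
  simp only [kacAvg, kacRot_swap i j]
  rw [intervalIntegral.integral_comp_neg fun θ => F (kacRot i j θ v), neg_neg]

/-- Rotating the argument of a polynomial is the linear flow of `angD i j` on polynomials, and time
integrals of such flows are again polynomials. -/
theorem exists_evalS_eq_kacAvg (i j : Fin N) (p : MvPolynomial (Fin N) ℝ) :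
    ∃ q, ∀ v, evalS v q = kacAvg i j (fun v => evalS v p) v := by
  obtain ⟨W, hW0, hW⟩ := exists_isPolyFlow (angD i j).toLinearMap
    (fun d p hp => angD_mem_restrictTotalDegree i j d hp) p
  have key : ∀ v θ, evalS v (W θ) = evalS (kacRot i j θ v) p := by
    intro v θ
    -- The polynomial flows forward while the point rotates backward, so the value is constant in
    -- `τ`; compare `τ = θ` with `τ = 0`.
    have hd : ∀ τ, HasDerivAt (fun τ => evalS (kacRot i j (θ - τ) v) (W τ)) 0 τ := by
      intro τ
      have h1 := hW.hasDerivAt_path LinearMap.id (-(angD i j).toLinearMap)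
        (fun τ => kacRot i j (θ - τ) v) τ fun p => by
          have := (hasDerivAt_evalS_kacRot i j p v (θ - τ)).scomp τ
            ((hasDerivAt_id τ).const_sub θ)
          simpa [Function.comp_def] using this
      simpa using h1
    have := is_const_of_deriv_eq_zero (fun τ => (hd τ).differentiableAt)
      (fun τ => (hd τ).deriv) θ 0
    simpa [kacRot_zero, hW0] using this
  obtain ⟨q, hq⟩ := hW.exists_integral LinearMap.id (-Real.pi) Real.pi
  refine ⟨(1 / (2 * Real.pi)) • q, fun v => ?_⟩
  rw [map_smul, hq, smul_eq_mul, kacAvg]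
  simp [key]

theorem evalS_angD_eq_zero_of_kacAvg {i j : Fin N} {F : KacSphere N → ℝ}
    {q : MvPolynomial (Fin N) ℝ} (hq : ∀ v, evalS v q = kacAvg i j F v) (v : KacSphere N) :
    evalS v (angD i j q) = 0 := by
  have h1 := hasDerivAt_evalS_kacRot i j q v 0
  simp only [hq, kacAvg_kacRot, kacRot_zero] at h1
  exact h1.unique (hasDerivAt_const _ _)

/-- The `angD i j` are, up to sign, the two-by-two minors of the pair `(x, ∇)`, and expanding a
three-by-three determinant with the row `x` repeated gives zero. -/
theorem angD_jacobi (i j k : Fin N) (p : MvPolynomial (Fin N) ℝ) :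
    MvPolynomial.X k * angD i j p + MvPolynomial.X i * angD j k p
      + MvPolynomial.X j * angD k i p = 0 := by
  have : (MvPolynomial.X k : MvPolynomial (Fin N) ℝ) • angD i j
      + (MvPolynomial.X i : MvPolynomial (Fin N) ℝ) • angD j k
      + (MvPolynomial.X j : MvPolynomial (Fin N) ℝ) • angD k i = 0 := by
    refine MvPolynomial.derivation_ext fun l => ?_
    simp only [Derivation.add_apply, Derivation.smul_apply, angD_X, smul_eq_mul,
      Derivation.zero_apply]
    split_ifs <;> ring
  simpa using congrArg (fun D => D p) this

/-- Multiply the cyclic relation by `v_k`, sum over `k` using `∑ v_k² = N`, and apply Cauchy–Schwarz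
twice. One component is thereby controlled by the whole gradient at the cost of the energy of the
pair, which is why quadratic collision rates suffice uniformly in `N`. -/
theorem mul_sq_le_of_jacobi (v : KacSphere N) {a : Fin N → Fin N → ℝ}
    (hanti : ∀ i j, a j i = -a i j)
    (hjac : ∀ i j k, v.1 k * a i j + v.1 i * a j k + v.1 j * a k i = 0) {i j : Fin N} (hN : 0 < N) :
    N * a i j ^ 2 ≤ (v.1 i ^ 2 + v.1 j ^ 2) * ∑ β : Fin N × Fin N, a β.1 β.2 ^ 2 := by
  have hNpos : (0 : ℝ) < N := by exact_mod_cast hN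
  have hsum : 0 ≤ ∑ β : Fin N × Fin N, a β.1 β.2 ^ 2 := Finset.sum_nonneg fun _ _ => sq_nonneg _
  rcases eq_or_ne i j with rfl | hij
  · have : a i i = 0 := by linarith [hanti i i]
    rw [this]
    simp only [ne_eq, OfNat.ofNat_ne_zero, not_false_eq_true, zero_pow, mul_zero]
    positivity
  have h1 : (N : ℝ) * a i j = ∑ k, v.1 k * -(v.1 i * a j k + v.1 j * a k i) := by
    have : ∀ k, v.1 k * -(v.1 i * a j k + v.1 j * a k i) = v.1 k ^ 2 * a i j := by
      intro k
      have := hjac i j k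
      linear_combination (-v.1 k) * this
    simp only [this, ← Finset.sum_mul, v.sum_sq]
  have h2 := Finset.sum_mul_sq_le_sq_mul_sq Finset.univ (fun k => v.1 k)
    (fun k => -(v.1 i * a j k + v.1 j * a k i))
  rw [← h1, v.sum_sq] at h2
  have h3 : ∑ k, (-(v.1 i * a j k + v.1 j * a k i)) ^ 2 ≤
      (v.1 i ^ 2 + v.1 j ^ 2) * ∑ β : Fin N × Fin N, a β.1 β.2 ^ 2 := by
    calc ∑ k, (-(v.1 i * a j k + v.1 j * a k i)) ^ 2
        ≤ ∑ k, (v.1 i ^ 2 + v.1 j ^ 2) * (a j k ^ 2 + a i k ^ 2) := by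
          gcongr with k _
          rw [hanti i k]
          nlinarith [sq_nonneg (v.1 j * a j k + v.1 i * a i k)]
      _ = (v.1 i ^ 2 + v.1 j ^ 2) * (∑ k, a j k ^ 2 + ∑ k, a i k ^ 2) := by
          rw [← Finset.mul_sum, Finset.sum_add_distrib]
      _ ≤ _ := by
          gcongr
          rw [Fintype.sum_prod_type, ← Finset.sum_pair (f := fun l => ∑ k, a l k ^ 2) hij.symm]
          exact Finset.sum_le_sum_of_subset_of_nonneg (Finset.subset_univ _)
            fun _ _ _ => Finset.sum_nonneg fun _ _ => sq_nonneg _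
  have h4 : (N : ℝ) * (N * a i j ^ 2) ≤ N * ((v.1 i ^ 2 + v.1 j ^ 2) *
      ∑ β : Fin N × Fin N, a β.1 β.2 ^ 2) := by nlinarith
  exact le_of_mul_le_mul_left h4 hNpos

/-- By the formula for the Laplacian of a square: the term `2 x_i Δ x_i` is nonpositive, and the
squared gradient of `x_i` contributes at most `2`. -/
theorem evalS_angLap_X_sq_le (hN : 0 < N) (i : Fin N) (v : KacSphere N) :
    evalS v (angLap N (MvPolynomial.X i ^ 2)) ≤ 2 := by
  have hNpos : (0 : ℝ) < N := by exact_mod_cast hN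
  rw [evalS_angLap_sq, evalS_X, evalS_angLap]
  have h1 : v.1 i * ∑ β : Fin N × Fin N, evalS v (angD β.1 β.2 (angD β.1 β.2 (MvPolynomial.X i)))
      ≤ 0 := by
    rw [Finset.mul_sum]
    refine Finset.sum_nonpos fun β _ => ?_
    rw [angD_X, map_sub]
    split_ifs with h2 h3 h3
    · rw [← h2, ← h3]; simp
    · rw [angD_X, ← h2]
      simp only [if_true, map_zero, sub_zero, map_sub, evalS_X]
      rw [if_neg (fun e => h3 e.symm)]
      simp only [map_zero]
      nlinarith [sq_nonneg (v.1 i)]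
    · rw [angD_X, ← h3]
      simp only [if_true, map_zero, zero_sub, map_sub, map_neg, evalS_X]
      rw [if_neg (fun e => h2 e.symm)]
      simp only [map_zero]
      nlinarith [sq_nonneg (v.1 i)]
    · simp
  have h2 : ∑ β : Fin N × Fin N, evalS v (angD β.1 β.2 (MvPolynomial.X i)) ^ 2 ≤ 2 * N := by
    calc _ ≤ ∑ β : Fin N × Fin N, ((if i = β.1 then v.1 β.2 ^ 2 else 0)
          + (if i = β.2 then v.1 β.1 ^ 2 else 0)) := by
          gcongr with β _
          rw [angD_X, map_sub]
          split_ifs with h2 h3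
          · rw [← h2, ← h3]; simp; positivity
          all_goals simp
      _ = 2 * N := by
          rw [Finset.sum_add_distrib, Fintype.sum_prod_type, Fintype.sum_prod_type_right]
          have e1 : ∑ x, ∑ y, (if i = x then v.1 y ^ 2 else 0) = (N : ℝ) := by
            rw [Finset.sum_comm]; simpa using v.sum_sq
          simp only [e1]; ring
  have h3 : (N : ℝ)⁻¹ * ∑ β : Fin N × Fin N, evalS v (angD β.1 β.2 (MvPolynomial.X i)) ^ 2 ≤ 2 := by
    rw [inv_mul_le_iff₀ hNpos]; linarith
  have h4 : 2 * v.1 i * ((2 * (N : ℝ))⁻¹ * ∑ β : Fin N × Fin N,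
      evalS v (angD β.1 β.2 (angD β.1 β.2 (MvPolynomial.X i)))) ≤ 0 := by
    have : (0 : ℝ) ≤ 2 * (2 * (N : ℝ))⁻¹ := by positivity
    nlinarith
  linarith

/-- The weight `1 + (x_i² + x_j²) / 4`. -/
noncomputable def pairWeight (i j : Fin N) : MvPolynomial (Fin N) ℝ :=
  1 + (1 / 4 : ℝ) • (MvPolynomial.X i ^ 2 + MvPolynomial.X j ^ 2)

theorem evalS_pairWeight (i j : Fin N) (v : KacSphere N) :
    evalS v (pairWeight i j) = 1 + (v.1 i ^ 2 + v.1 j ^ 2) / 4 := by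
  simp [pairWeight]; ring

/-- The factor `1/4` is chosen here: each of the two squares contributes at most `2`, so the
Laplacian is at most `1`, the constant term of the weight. -/
theorem evalS_angLap_pairWeight_le (hN : 0 < N) (i j : Fin N) (v : KacSphere N) :
    evalS v (angLap N (pairWeight i j)) ≤ evalS v (pairWeight i j) := by
  rw [evalS_pairWeight]
  have h1 : angLap N (1 : MvPolynomial (Fin N) ℝ) = 0 := by simp [angLap_apply]
  rw [pairWeight, map_add, h1, zero_add, map_smul, map_add, map_smul, map_add, smul_eq_mul]
  have := evalS_angLap_X_sq_le hN i v
  have := evalS_angLap_X_sq_le hN j v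
  nlinarith [sq_nonneg (v.1 i), sq_nonneg (v.1 j)]

end avg

/-! ### Weighted relative entropy of a density and its pair averages -/

section pair
variable {N : ℕ}

/-- The relative entropy density `x log (x/y) - x + y`. -/
noncomputable def relDensity (x y : ℝ) : ℝ := x * (Real.log x - Real.log y) - x + y

theorem relDensity_nonneg {x y : ℝ} (hx : 0 < x) (hy : 0 < y) : 0 ≤ relDensity x y := by
  have h := Real.log_le_sub_one_of_pos (div_pos hy hx)
  rw [Real.log_div hy.ne' hx.ne'] at h
  have h2 := mul_le_mul_of_nonneg_left h hx.le
  have : x * (y / x - 1) = y - x := by field_simp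
  rw [relDensity]
  linarith

/-- The field `b = D log p - D log q` inherits the cyclic relation, and its `(i, j)` component is
that of `log p` alone because `D_ij q = 0`. Then `mul_sq_le_of_jacobi` applies, with `v_i² + v_j² ≤
4 w`. -/
theorem pair_gradient_le (hN : 0 < N) {p q : MvPolynomial (Fin N) ℝ} {v : KacSphere N}
    (hp : 0 < evalS v p) (i j : Fin N) (hinv : evalS v (angD i j q) = 0) :
    1 / 8 * (evalS v (angD i j p) ^ 2 / evalS v p) ≤
      (2 * (N : ℝ))⁻¹ * (evalS v (pairWeight i j) * (evalS v p * ∑ β : Fin N × Fin N,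
        (evalS v (angD β.1 β.2 p) / evalS v p - evalS v (angD β.1 β.2 q) / evalS v q) ^ 2)) := by
  have hNpos : (0 : ℝ) < N := by exact_mod_cast hN
  set b : Fin N → Fin N → ℝ := fun k l => evalS v (angD k l p) / evalS v p
      - evalS v (angD k l q) / evalS v q with hb
  have hjac := mul_sq_le_of_jacobi v (a := b) (i := i) (j := j)
    (fun k l => by
      simp only [hb, angD_swap k l, Derivation.neg_apply, map_neg]; ring)
    (fun k l m => by
      have j1 := congrArg (evalS v) (angD_jacobi k l m p)
      have j2 := congrArg (evalS v) (angD_jacobi k l m q)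
      simp only [map_add, map_mul, evalS_X, map_zero] at j1 j2
      simp only [hb]
      linear_combination (1 / evalS v p) * j1 - (1 / evalS v q) * j2) (by omega)
  have hbij : b i j = evalS v (angD i j p) / evalS v p := by simp only [hb, hinv, zero_div, sub_zero]
  have hS : 0 ≤ ∑ β : Fin N × Fin N, b β.1 β.2 ^ 2 := Finset.sum_nonneg fun _ _ => sq_nonneg _
  have hw : (v.1 i ^ 2 + v.1 j ^ 2) / 4 ≤ evalS v (pairWeight i j) := by
    rw [evalS_pairWeight]; linarith
  change _ ≤ (2 * (N : ℝ))⁻¹ * (evalS v (pairWeight i j) * (evalS v p *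
    ∑ β : Fin N × Fin N, b β.1 β.2 ^ 2))
  calc 1 / 8 * (evalS v (angD i j p) ^ 2 / evalS v p)
      = evalS v p * ((8 * (N : ℝ))⁻¹ * (N * b i j ^ 2)) := by
        rw [hbij]; field_simp
    _ ≤ evalS v p * ((8 * (N : ℝ))⁻¹ * ((v.1 i ^ 2 + v.1 j ^ 2) *
        ∑ β : Fin N × Fin N, b β.1 β.2 ^ 2)) := by gcongr
    _ = (2 * (N : ℝ))⁻¹ * ((v.1 i ^ 2 + v.1 j ^ 2) / 4 * (evalS v p *
        ∑ β : Fin N × Fin N, b β.1 β.2 ^ 2)) := by field_simp; ring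
    _ ≤ _ := mul_le_mul_of_nonneg_left (mul_le_mul_of_nonneg_right hw (mul_nonneg hp.le hS))
        (by positivity)

/-- The derivative of the weighted relative entropy of two solutions of the heat equation, the second
of which is invariant under rotations in the `(i, j)` plane. -/
theorem IsPolyFlow.pairEntropy (hN : 2 ≤ N) {U Y : ℝ → MvPolynomial (Fin N) ℝ}
    (hU : IsPolyFlow (angLap N) U) (hY : IsPolyFlow (angLap N) Y) {a : ℝ} (ha : 0 < a)
    (hU0 : ∀ v, a ≤ evalS v (U 0)) (hY0 : ∀ v, a ≤ evalS v (Y 0)) (i j : Fin N)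
    (hinv : ∀ v, evalS v (_root_.angD i j (Y 0)) = 0) :
    ContinuousOn (fun s => ∫ v, evalS v (pairWeight i j) * relDensity (evalS v (U s)) (evalS v (Y s))
      ∂(kacSigma N)) (Set.Ici 0) ∧
    ∃ d : ℝ → ℝ, ∀ s, 0 < s → HasDerivAt (fun s => ∫ v, evalS v (pairWeight i j) *
        relDensity (evalS v (U s)) (evalS v (Y s)) ∂(kacSigma N)) (d s) s ∧
      d s ≤ (∫ v, evalS v (pairWeight i j) * relDensity (evalS v (U s)) (evalS v (Y s))
          ∂(kacSigma N))
        - 1 / 8 * ∫ v, evalS v (_root_.angD i j (U s)) ^ 2 / evalS v (U s) ∂(kacSigma N) := by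
  have := isProbabilityMeasure_kacSigma hN
  have hNpos : (0 : ℝ) < N := by exact_mod_cast (by omega : 0 < N)
  have hUpos : ∀ s, 0 ≤ s → ∀ v, 0 < evalS v (U s) := fun s hs v =>
    ha.trans_le (hU.ge_of_ge hN hU0 hs v)
  have hYpos : ∀ s, 0 ≤ s → ∀ v, 0 < evalS v (Y s) := fun s hs v =>
    ha.trans_le (hY.ge_of_ge hN hY0 hs v)
  have cU := hU.continuous_evalS.continuousOn (s := Set.Ici 0 ×ˢ Set.univ)
  have cY := hY.continuous_evalS.continuousOn (s := Set.Ici 0 ×ˢ Set.univ)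
  have cAU := (hU.continuous (angLap N)).continuousOn (s := Set.Ici 0 ×ˢ Set.univ)
  have cAY := (hY.continuous (angLap N)).continuousOn (s := Set.Ici 0 ×ˢ Set.univ)
  have cw : ContinuousOn (fun q : ℝ × KacSphere N => evalS q.2 (pairWeight i j))
      (Set.Ici 0 ×ˢ Set.univ) :=
    ((_root_.continuous_evalS (pairWeight i j)).comp continuous_snd).continuousOn
  have neY : ∀ q ∈ Set.Ici (0 : ℝ) ×ˢ (Set.univ : Set (KacSphere N)), evalS q.2 (Y q.1) ≠ 0 :=
    fun q hq => (hYpos _ hq.1 _).ne'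
  have clU := cU.log fun q hq => (hUpos _ hq.1 _).ne'
  have clY := cY.log neY
  obtain ⟨h1, h2⟩ := hasDerivAt_integral_of_continuousOn (μ := kacSigma N)
    (f := fun s v => evalS v (pairWeight i j) * relDensity (evalS v (U s)) (evalS v (Y s)))
    (f' := fun s v => evalS v (pairWeight i j) * (Real.log (evalS v (U s))
        - Real.log (evalS v (Y s))) * evalS v (angLap N (U s))
      + evalS v (pairWeight i j) * (1 - evalS v (U s) / evalS v (Y s)) * evalS v (angLap N (Y s)))
    (cw.mul (((cU.mul (clU.sub clY)).sub cU).add cY))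
    (((cw.mul (clU.sub clY)).mul cAU).add
      ((cw.mul (continuousOn_const.sub (cU.div cY neY))).mul cAY))
    (fun t ht v => by
      have hd := hU.hasDerivAt_evalS v t
      have hd' := hY.hasDerivAt_evalS v t
      have hne := (hUpos t ht.le v).ne'
      have hne' := (hYpos t ht.le v).ne'
      refine ((((hd.mul ((hd.log hne).sub (hd'.log hne'))).sub hd).add hd').const_mul
        (evalS v (pairWeight i j))).congr_deriv ?_
      simp
      field_simp
      ring)
  refine ⟨h1, _, fun s hs => ⟨h2 s hs, ?_⟩⟩
  have hp := hUpos s hs.le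
  have hq := hYpos s hs.le
  have hp0 : ∀ v : KacSphere N, evalS v (U s) ≠ 0 := fun v => (hp v).ne'
  have hq0 : ∀ v : KacSphere N, evalS v (Y s) ≠ 0 := fun v => (hq v).ne'
  have hc := fun p : MvPolynomial (Fin N) ℝ => _root_.continuous_evalS p
  have hlp : Continuous fun v : KacSphere N => Real.log (evalS v (U s)) := (hc _).log hp0
  have hlq : Continuous fun v : KacSphere N => Real.log (evalS v (Y s)) := (hc _).log hq0
  have hg : Continuous fun v : KacSphere N => relDensity (evalS v (U s)) (evalS v (Y s)) := by
    unfold relDensity; fun_prop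
  have hibp := integral_relEntropy_angLap hN hp hq (pairWeight i j)
  rw [integral_add (integrable_kacSigma hN (by fun_prop (disch := exact hq0 _)))
    (integrable_kacSigma hN (by fun_prop))] at hibp
  set J := ∫ v, (evalS v (pairWeight i j) * (Real.log (evalS v (U s))
        - Real.log (evalS v (Y s))) * evalS v (angLap N (U s))
      + evalS v (pairWeight i j) * (1 - evalS v (U s) / evalS v (Y s)) * evalS v (angLap N (Y s)))
      ∂(kacSigma N) with hJ
  have e1 : ∫ v, -(evalS v (U s) * (Real.log (evalS v (U s)) - Real.log (evalS v (Y s)))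
      - evalS v (U s) + evalS v (Y s)) * evalS v (angLap N (pairWeight i j)) ∂(kacSigma N) =
      -∫ v, relDensity (evalS v (U s)) (evalS v (Y s)) * evalS v (angLap N (pairWeight i j))
        ∂(kacSigma N) := by
    rw [← integral_neg]
    refine integral_congr_ae (Filter.Eventually.of_forall fun v => ?_)
    simp only [relDensity]; ring
  rw [e1] at hibp
  -- The term in which the Laplacian falls on the weight costs at most the functional itself, since
  -- the relative entropy density is nonnegative.
  have e2 : ∫ v, relDensity (evalS v (U s)) (evalS v (Y s)) * evalS v (angLap N (pairWeight i j))
        ∂(kacSigma N) ≤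
      ∫ v, evalS v (pairWeight i j) * relDensity (evalS v (U s)) (evalS v (Y s)) ∂(kacSigma N) := by
    refine integral_mono (integrable_kacSigma hN (by fun_prop))
      (integrable_kacSigma hN (by fun_prop)) fun v => ?_
    simp only
    rw [mul_comm]
    exact mul_le_mul_of_nonneg_right (evalS_angLap_pairWeight_le (by omega) i j v)
      (relDensity_nonneg (hp v) (hq v))
  have hint : ∀ β : Fin N × Fin N, Integrable (fun v : KacSphere N => evalS v (pairWeight i j) *
      (evalS v (U s) * (evalS v (_root_.angD β.1 β.2 (U s)) / evalS v (U s)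
        - evalS v (_root_.angD β.1 β.2 (Y s)) / evalS v (Y s)) ^ 2)) (kacSigma N) := fun β =>
    integrable_kacSigma hN (by fun_prop (disch := first | exact hp0 _ | exact hq0 _))
  -- The dissipation retains the `(i, j)` part of the Fisher information, because invariance under
  -- the rotations of the pair survives the heat flow.
  have e3 : 1 / 8 * ∫ v, evalS v (_root_.angD i j (U s)) ^ 2 / evalS v (U s) ∂(kacSigma N) ≤
      (2 * (N : ℝ))⁻¹ * ∑ β : Fin N × Fin N, ∫ v, evalS v (pairWeight i j) *
      (evalS v (U s) * (evalS v (_root_.angD β.1 β.2 (U s)) / evalS v (U s)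
        - evalS v (_root_.angD β.1 β.2 (Y s)) / evalS v (Y s)) ^ 2) ∂(kacSigma N) := by
    rw [← integral_finsetSum _ fun β _ => hint β, ← integral_const_mul, ← integral_const_mul]
    refine integral_mono (integrable_kacSigma hN (by fun_prop (disch := exact hp0 _)))
      ((integrable_finsetSum _ fun β _ => hint β).const_mul _) fun v => ?_
    simp only
    rw [← Finset.mul_sum, ← Finset.mul_sum]
    exact pair_gradient_le (by omega) (hp v) i j ((hY.angD i j).eq_zero hN hinv hs.le v)
  linarith

theorem kacAvg_ge {F : KacSphere N → ℝ} (hF : Continuous F) {a : ℝ} (h : ∀ v, a ≤ F v)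
    (i j : Fin N) (v : KacSphere N) : a ≤ kacAvg i j F v := by
  have h1 : kacAvg i j (fun _ => a) v ≤ kacAvg i j F v := by
    refine mul_le_mul_of_nonneg_left ?_ (by positivity)
    refine intervalIntegral.integral_mono_on (by linarith [Real.pi_pos]) (by simp)
      ((hF.comp (continuous_kacRot_angle i j v)).intervalIntegrable _ _) fun θ _ => h _
  rwa [kacAvg_const] at h1

/-- The pairwise entropy inequality for polynomial densities. -/
theorem relEnt_le_sum_pair_poly (hN : 3 ≤ N) {p : MvPolynomial (Fin N) ℝ} {a : ℝ} (ha : 0 < a)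
    (hp : ∀ v, a ≤ evalS v p) :
    (N : ℝ) / 52 * relEnt (fun v => evalS v p) ≤
      ∑ α : Fin N × Fin N, ∫ v, evalS v (pairWeight α.1 α.2) *
        relDensity (evalS v p) (kacAvg α.1 α.2 (fun v => evalS v p) v) ∂(kacSigma N) := by
  have hN2 : 2 ≤ N := by omega
  have hNpos : (0 : ℝ) < N := by exact_mod_cast (by omega : 0 < N)
  obtain ⟨U, rfl, hU⟩ := exists_isPolyFlow (angLap N)
    (fun d p hp => angLap_mem_restrictTotalDegree d hp) p
  have hq : ∀ α : Fin N × Fin N, ∃ Y : ℝ → MvPolynomial (Fin N) ℝ, IsPolyFlow (angLap N) Y ∧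
      ∀ v, evalS v (Y 0) = kacAvg α.1 α.2 (fun v => evalS v (U 0)) v := by
    intro α
    obtain ⟨q, hq⟩ := exists_evalS_eq_kacAvg α.1 α.2 (U 0)
    obtain ⟨Y, rfl, hY⟩ := exists_isPolyFlow (angLap N)
      (fun d p hp => angLap_mem_restrictTotalDegree d hp) q
    exact ⟨Y, hY, hq⟩
  choose Y hY hY0 using hq
  have key := fun α : Fin N × Fin N => hU.pairEntropy hN2 (hY α) ha hp
    (fun v => by rw [hY0]; exact kacAvg_ge (continuous_evalS _) hp _ _ _) α.1 α.2
    (evalS_angD_eq_zero_of_kacAvg (hY0 α))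
  choose hcont d hd using key
  obtain ⟨c1, d1⟩ := hU.entropy hN2 ha hp
  set m := ∫ w, evalS w (U 0) ∂(kacSigma N) with hm
  have hge : ∀ s, 0 ≤ s → ∀ v, a ≤ evalS v (U s) := fun s hs v => hU.ge_of_ge hN2 hp hs v
  have hYpos : ∀ α s, 0 ≤ s → ∀ v, 0 < evalS v (Y α s) := fun α s hs v =>
    ha.trans_le ((hY α).ge_of_ge hN2 (fun v => by
      rw [hY0]; exact kacAvg_ge (continuous_evalS _) hp _ _ _) hs v)
  set S : ℝ → ℝ := fun s => ∑ α : Fin N × Fin N, ∫ v, evalS v (pairWeight α.1 α.2) *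
        relDensity (evalS v (U s)) (evalS v (Y α s)) ∂(kacSigma N) with hS
  have hS0 : ∀ s, 0 ≤ s → 0 ≤ S s := fun s hs => Finset.sum_nonneg fun α _ =>
    integral_nonneg fun v => mul_nonneg (by rw [evalS_pairWeight]; positivity)
      (relDensity_nonneg (ha.trans_le (hge s hs v)) (hYpos α s hs v))
  have hSc : ContinuousOn S (Set.Ici 0) := continuousOn_finsetSum _ fun α _ => hcont α
  have hSd : ∀ s, 0 < s → HasDerivAt S (∑ α, d α s) s := fun s hs =>
    HasDerivAt.fun_sum fun α _ => (hd α s hs).1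
  -- Summed over ordered pairs, `1/8` of the pair terms is `1/8 · 2N` times the Fisher information.
  have hSle : ∀ s, 0 < s → ∑ α, d α s ≤ S s - (N : ℝ) / 4 * fisherInfo (U s) := by
    intro s hs
    refine (Finset.sum_le_sum fun α _ => (hd α s hs).2).trans (le_of_eq ?_)
    rw [Finset.sum_sub_distrib, ← Finset.mul_sum, fisherInfo]
    field_simp
    ring
  set H : ℝ → ℝ := fun s => ∫ v, evalS v (U s) * Real.log (evalS v (U s)) ∂(kacSigma N)
    - m * Real.log m with hH
  have hHrel : ∀ s, 0 ≤ s → H s = relEnt (fun v => evalS v (U s)) := by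
    intro s hs
    rw [relEnt, hU.integral_eq hN2 hs]
  -- The logarithmic Sobolev inequality with `heatRate N ≥ 1/12`; here `N ≥ 3` is needed.
  have hHI : ∀ s, 0 ≤ s → H s ≤ 12 * fisherInfo (U s) := by
    intro s hs
    have h1 := heatRate_mul_relEnt_le hN ha (hge s hs)
    rw [← hHrel s hs] at h1
    have h2 := heatRate_ge hN
    have h3 := fisherInfo_nonneg fun v => ha.trans_le (hge s hs v)
    rcases le_total (H s) 0 with h | h
    · linarith
    · nlinarith
  have hHd : ∀ s, 0 < s → HasDerivAt H (-fisherInfo (U s)) s := fun s hs => (d1 s hs).sub_const _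
  have hHc : ContinuousOn H (Set.Ici 0) := c1.sub continuousOn_const
  have hHanti := antitoneOn_Ici_of_hasDerivAt hHc hHd fun s hs =>
    neg_nonpos.2 (fisherInfo_nonneg fun v => ha.trans_le (hge s hs.le v))
  -- The constant is `52 = 4 · 13`: the gain `N I / 4` covers `N I / 52` from the derivative of `H`
  -- and `12 N I / 52` from the bound on `H`.
  have hΦ := antitoneOn_Ici_of_hasDerivAt
    (f := fun s => Real.exp (-s) * (S s - (N : ℝ) / 52 * H s))
    ((Real.continuous_exp.comp continuous_neg).continuousOn.mul
      (hSc.sub (continuousOn_const.mul hHc)))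
    (fun s hs => ((hasDerivAt_id s).neg.exp).mul ((hSd s hs).sub ((hHd s hs).const_mul _)))
    (fun s hs => by
      have h1 := hSle s hs
      have h2 := mul_le_mul_of_nonneg_left (hHI s hs.le) hNpos.le
      have h3 : (∑ α, d α s - (N : ℝ) / 52 * -fisherInfo (U s)) - (S s - (N : ℝ) / 52 * H s) ≤ 0 := by
        linarith
      have h4 := mul_nonpos_of_nonneg_of_nonpos (Real.exp_pos (-s)).le h3
      simp only [Pi.neg_apply, id] at *
      linarith)
  -- Since `S ≥ 0` and `H` is nonincreasing, the functional stays above `-(N / 52) H(0) exp (-s)`.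
  -- No convergence of `S` is required, although `S' ≤ S` allows growth.
  have hlim : Filter.Tendsto (fun s : ℝ => -(N / 52 * H 0) * Real.exp (-s)) Filter.atTop (nhds 0) := by
    simpa using Real.tendsto_exp_neg_atTop_nhds_zero.const_mul (-((N : ℝ) / 52 * H 0))
  have hfin : 0 ≤ S 0 - (N : ℝ) / 52 * H 0 := by
    refine le_of_tendsto hlim ?_
    filter_upwards [Filter.eventually_ge_atTop 0] with s hs
    have h1 := hΦ (Set.mem_Ici.2 le_rfl) (Set.mem_Ici.2 hs) hs
    have h2 := hHanti (Set.mem_Ici.2 le_rfl) (Set.mem_Ici.2 hs) hs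
    simp only [neg_zero, Real.exp_zero, one_mul] at h1
    refine le_trans ?_ h1
    rw [mul_comm]
    refine mul_le_mul_of_nonneg_left ?_ (Real.exp_pos _).le
    have := hS0 s hs
    have := mul_le_mul_of_nonneg_left h2 hNpos.le
    linarith
  rw [hHrel 0 le_rfl] at hfin
  have hS0e : S 0 = ∑ α : Fin N × Fin N, ∫ v, evalS v (pairWeight α.1 α.2) *
        relDensity (evalS v (U 0)) (kacAvg α.1 α.2 (fun v => evalS v (U 0)) v) ∂(kacSigma N) := by
    simp only [hS, hY0]
  rw [← hS0e]
  linarith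

end pair

/-! ### Averages of bounded measurable functions -/

section avgL1
variable {N : ℕ}

theorem measurable_kacAvg (i j : Fin N) {F : KacSphere N → ℝ} (hF : Measurable F) :
    Measurable (kacAvg i j F) := by
  have h1 : StronglyMeasurable fun q : KacSphere N × ℝ => F (kacRot i j q.2 q.1) :=
    (hF.comp ((continuous_kacRot i j).comp continuous_swap).measurable).stronglyMeasurable
  have h2 : kacAvg i j F = fun v => 1 / (2 * Real.pi) *
      ∫ θ in Set.Ioc (-Real.pi) Real.pi, F (kacRot i j θ v) := by
    ext v
    rw [kacAvg, intervalIntegral.integral_of_le (by linarith [Real.pi_pos])]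
  rw [h2]
  exact (h1.integral_prod_right (ν := volume.restrict (Set.Ioc (-Real.pi) Real.pi))).measurable.const_mul _

theorem intervalIntegrable_kacRot (i j : Fin N) {F : KacSphere N → ℝ} (hF : Measurable F) {B : ℝ}
    (hB : ∀ v, |F v| ≤ B) (v : KacSphere N) (c d : ℝ) :
    IntervalIntegrable (fun θ => F (kacRot i j θ v)) volume c d := by
  refine (intervalIntegrable_const (c := B)).mono_fun ?_ ?_
  · exact (hF.comp (continuous_kacRot_angle i j v).measurable).aestronglyMeasurable
  · refine Filter.Eventually.of_forall fun θ => ?_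
    simp only [Real.norm_eq_abs]
    exact (hB _).trans (le_abs_self B)

theorem kacAvg_mono (i j : Fin N) {F G : KacSphere N → ℝ} (hF : Measurable F) (hG : Measurable G)
    {B C : ℝ} (hB : ∀ v, |F v| ≤ B) (hC : ∀ v, |G v| ≤ C) (h : ∀ v, F v ≤ G v) (v : KacSphere N) :
    kacAvg i j F v ≤ kacAvg i j G v := by
  refine mul_le_mul_of_nonneg_left ?_ (by positivity)
  exact intervalIntegral.integral_mono_on (by linarith [Real.pi_pos])
    (intervalIntegrable_kacRot i j hF hB v _ _) (intervalIntegrable_kacRot i j hG hC v _ _)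
    fun θ _ => h _

theorem kacAvg_mem_Icc (i j : Fin N) {F : KacSphere N → ℝ} (hF : Measurable F) {a b : ℝ}
    (h : ∀ v, F v ∈ Set.Icc a b) (v : KacSphere N) : kacAvg i j F v ∈ Set.Icc a b := by
  have hB : ∀ v, |F v| ≤ max |a| |b| := fun v => abs_le_max_abs_abs (h v).1 (h v).2
  constructor
  · have := kacAvg_mono i j measurable_const hF (fun _ => le_refl |a|) hB (fun v => (h v).1) v
    rwa [kacAvg_const] at this
  · have := kacAvg_mono i j hF measurable_const hB (fun _ => le_refl |b|) (fun v => (h v).2) v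
    rwa [kacAvg_const] at this

theorem abs_kacAvg_le (i j : Fin N) {F : KacSphere N → ℝ} (hF : Measurable F) {B : ℝ}
    (hB : ∀ v, |F v| ≤ B) (v : KacSphere N) : |kacAvg i j F v| ≤ B :=
  abs_le.2 (kacAvg_mem_Icc i j hF (fun v => abs_le.1 (hB v)) v)

theorem kacAvg_sub (i j : Fin N) {F G : KacSphere N → ℝ} (hF : Measurable F) (hG : Measurable G)
    {B C : ℝ} (hB : ∀ v, |F v| ≤ B) (hC : ∀ v, |G v| ≤ C) (v : KacSphere N) :
    kacAvg i j (fun v => F v - G v) v = kacAvg i j F v - kacAvg i j G v := by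
  simp only [kacAvg]
  rw [intervalIntegral.integral_sub (intervalIntegrable_kacRot i j hF hB v _ _)
    (intervalIntegrable_kacRot i j hG hC v _ _), mul_sub]

theorem integrable_of_bounded (hN : 2 ≤ N) {F : KacSphere N → ℝ} (hF : Measurable F) {B : ℝ}
    (hB : ∀ v, |F v| ≤ B) : Integrable F (kacSigma N) := by
  have := isProbabilityMeasure_kacSigma hN
  exact Integrable.of_bound hF.aestronglyMeasurable B (Filter.Eventually.of_forall hB)

theorem integral_mul_kacAvg_eq (hN : 2 ≤ N) (i j : Fin N) {φ G : KacSphere N → ℝ} (hφ : Measurable φ)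
    (hG : Measurable G) {A B : ℝ} (hA : ∀ v, |φ v| ≤ A) (hB : ∀ v, |G v| ≤ B) :
    ∫ v, φ v * kacAvg i j G v ∂(kacSigma N) =
      1 / (2 * Real.pi) * ∫ θ in (-Real.pi)..Real.pi, ∫ v, φ v * G (kacRot i j θ v) ∂(kacSigma N) := by
  have := isProbabilityMeasure_kacSigma hN
  have hle : -Real.pi ≤ Real.pi := by linarith [Real.pi_pos]
  simp only [kacAvg, intervalIntegral.integral_of_le hle]
  have e : ∀ v, φ v * (1 / (2 * Real.pi) * ∫ θ in Set.Ioc (-Real.pi) Real.pi, G (kacRot i j θ v)) =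
      1 / (2 * Real.pi) * ∫ θ in Set.Ioc (-Real.pi) Real.pi, φ v * G (kacRot i j θ v) := by
    intro v; rw [integral_const_mul]; ring
  simp only [e]
  rw [integral_const_mul, integral_integral_swap]
  refine Integrable.of_bound (C := A * B) ?_ (Filter.Eventually.of_forall fun q => ?_)
  · have hm : Measurable fun q : KacSphere N × ℝ => kacRot i j q.2 q.1 :=
      ((continuous_kacRot i j).comp continuous_swap).measurable
    exact ((hφ.comp measurable_fst).mul (hG.comp hm)).aestronglyMeasurable
  · simp only [Function.uncurry, norm_mul, Real.norm_eq_abs]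
    exact mul_le_mul (hA _) (hB _) (abs_nonneg _) ((abs_nonneg _).trans (hA q.1))

/-- The averages over rotations are self-adjoint. -/
theorem integral_mul_kacAvg (hN : 2 ≤ N) (i j : Fin N) {φ G : KacSphere N → ℝ} (hφ : Measurable φ)
    (hG : Measurable G) {A B : ℝ} (hA : ∀ v, |φ v| ≤ A) (hB : ∀ v, |G v| ≤ B) :
    ∫ v, φ v * kacAvg i j G v ∂(kacSigma N) = ∫ v, kacAvg i j φ v * G v ∂(kacSigma N) := by
  rw [integral_mul_kacAvg_eq hN i j hφ hG hA hB]
  simp only [mul_comm (kacAvg i j φ _)]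
  rw [integral_mul_kacAvg_eq hN i j hG hφ hB hA]
  have e : ∀ θ, ∫ v, φ v * G (kacRot i j θ v) ∂(kacSigma N) =
      ∫ v, G v * φ (kacRot i j (-θ) v) ∂(kacSigma N) := by
    intro θ
    rw [← integral_comp_kacRot i j θ fun v => G v * φ (kacRot i j (-θ) v)]
    simp only [kacRot_add, neg_add_cancel, kacRot_zero, mul_comm]
  simp only [e]
  rw [intervalIntegral.integral_comp_neg fun θ => ∫ v, G v * φ (kacRot i j θ v) ∂(kacSigma N), neg_neg]

/-- The average is the conditional expectation onto rotation-invariant functions: by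
self-adjointness it falls on `w`, which it fixes. -/
theorem integral_invariant_mul_kacAvg (hN : 2 ≤ N) (i j : Fin N) {w G : KacSphere N → ℝ}
    (hw : Measurable w) (hG : Measurable G) {A B : ℝ} (hA : ∀ v, |w v| ≤ A) (hB : ∀ v, |G v| ≤ B)
    (hinv : ∀ θ v, w (kacRot i j θ v) = w v) :
    ∫ v, w v * kacAvg i j G v ∂(kacSigma N) = ∫ v, w v * G v ∂(kacSigma N) := by
  rw [integral_mul_kacAvg hN i j hw hG hA hB]
  refine integral_congr_ae (Filter.Eventually.of_forall fun v => ?_)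
  have := kacAvg_mul_of_invariant i j hinv (fun _ => 1) v
  simp only [mul_one, kacAvg_const] at this
  simp only [this]

/-! ### Density of the polynomials -/

/-- Stone–Weierstrass: the coordinates separate points of the compact sphere. -/
theorem exists_evalS_near (f : C(KacSphere N, ℝ)) {ε : ℝ} (hε : 0 < ε) :
    ∃ p : MvPolynomial (Fin N) ℝ, ∀ v, |evalS v p - f v| < ε := by
  let φ : MvPolynomial (Fin N) ℝ →ₐ[ℝ] C(KacSphere N, ℝ) :=
    MvPolynomial.aeval fun i => ⟨fun v => v.1 i, KacSphere.continuous_coord i⟩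
  have hφ : ∀ p v, φ p v = evalS v p := by
    intro p v
    induction p using MvPolynomial.induction_on with
    | C a => simp [φ, evalS]
    | add p q hp hq => simp [hp, hq]
    | mul_X p l hp => simp [hp, φ]
  have hsep : φ.range.SeparatesPoints := by
    intro v w hvw
    have : ∃ i, v.1 i ≠ w.1 i := by
      by_contra! h; exact hvw (KacSphere.ext_coord h)
    obtain ⟨i, hi⟩ := this
    exact ⟨_, ⟨φ (MvPolynomial.X i), ⟨_, rfl⟩, rfl⟩, by simpa [hφ] using hi⟩
  obtain ⟨⟨_, p, rfl⟩, hp⟩ :=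
    ContinuousMap.exists_mem_subalgebra_near_continuousMap_of_separatesPoints φ.range hsep f ε hε
  refine ⟨p, fun v => ?_⟩
  have := (ContinuousMap.norm_lt_iff _ hε).1 hp v
  rw [← hφ]
  exact this

/-- Approximate in `L¹` by a continuous function, clamp it to `[a, b]`, and approximate uniformly by
a polynomial. The enlarged interval leaves room for the last error and keeps the polynomial away
from zero, so that logarithms are controlled independently of `ε`. -/
theorem exists_evalS_near_L1 (hN : 2 ≤ N) {F : KacSphere N → ℝ} (hF : Measurable F) {a b : ℝ}
    (ha : 0 < a) (h : ∀ v, F v ∈ Set.Icc a b) {ε : ℝ} (hε : 0 < ε) :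
    ∃ p : MvPolynomial (Fin N) ℝ, (∀ v, evalS v p ∈ Set.Icc (a / 2) (b + 1)) ∧
      ∫ v, |F v - evalS v p| ∂(kacSigma N) ≤ ε := by
  have := isProbabilityMeasure_kacSigma hN
  have hFi : Integrable F (kacSigma N) :=
    integrable_of_bounded hN hF fun v => abs_le_max_abs_abs (h v).1 (h v).2
  obtain ⟨g, hg, -⟩ := hFi.exists_boundedContinuous_integral_sub_le (half_pos hε)
  let g' : C(KacSphere N, ℝ) := ⟨fun v => max a (min b (g v)), by fun_prop⟩
  have hab : a ≤ b := by
    obtain ⟨v⟩ := KacSphere.nonempty hN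
    exact (h v).1.trans (h v).2
  have hg' : ∀ v, g' v ∈ Set.Icc a b := fun v => ⟨le_max_left _ _, max_le hab (min_le_left _ _)⟩
  -- Clamping is 1-Lipschitz and fixes the values of `F`, so it does not increase the distance.
  have hclamp : ∀ v, |F v - g' v| ≤ |F v - g v| := by
    intro v
    have h1 := (h v).1
    have h2 := (h v).2
    change |F v - max a (min b (g v))| ≤ _
    rcases le_total b (g v) with hb | hb
    · rw [min_eq_left hb, max_eq_right hab, abs_of_nonpos (by linarith), abs_of_nonpos (by linarith)]
      linarith
    · rw [min_eq_right hb]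
      rcases le_total a (g v) with hg | hg
      · rw [max_eq_right hg]
      · rw [max_eq_left hg, abs_of_nonneg (by linarith), abs_of_nonneg (by linarith)]
        linarith
  obtain ⟨p, hp⟩ := exists_evalS_near g' (ε := min (ε / 2) (min (a / 2) 1)) (by positivity)
  have hp1 : ∀ v, |evalS v p - g' v| < ε / 2 := fun v => (hp v).trans_le (min_le_left _ _)
  have hp2 : ∀ v, |evalS v p - g' v| < a / 2 := fun v =>
    (hp v).trans_le ((min_le_right _ _).trans (min_le_left _ _))
  have hp3 : ∀ v, |evalS v p - g' v| < 1 := fun v =>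
    (hp v).trans_le ((min_le_right _ _).trans (min_le_right _ _))
  refine ⟨p, fun v => ⟨?_, ?_⟩, ?_⟩
  · have := (abs_lt.1 (hp2 v)).1; have := (hg' v).1; linarith
  · have := (abs_lt.1 (hp3 v)).2; have := (hg' v).2; linarith
  · have hgi : Integrable (fun v => |F v - g v|) (kacSigma N) :=
      (hFi.sub (integrable_kacSigma hN g.continuous)).abs
    calc ∫ v, |F v - evalS v p| ∂(kacSigma N) ≤ ∫ v, (|F v - g v| + ε / 2) ∂(kacSigma N) := by
          refine integral_mono (hFi.sub (integrable_kacSigma hN (continuous_evalS p))).abs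
            (hgi.add (integrable_const _)) fun v => ?_
          simp only
          have h1 := abs_sub_le (F v) (g' v) (evalS v p)
          have h2 := hp1 v
          rw [abs_sub_comm] at h2
          linarith [hclamp v]
      _ ≤ ε := by
          rw [integral_add hgi (integrable_const _)]
          simp only [Real.norm_eq_abs] at hg
          simp
          linarith

end avgL1

/-! ### The pair entropy inequality for bounded measurable densities -/

section pairIneq
variable {N : ℕ}

theorem abs_log_sub_log_le {a x y : ℝ} (ha : 0 < a) (hx : a ≤ x) (hy : a ≤ y) :
    |Real.log x - Real.log y| ≤ |x - y| / a := by
  have key : ∀ {x y : ℝ}, a ≤ x → a ≤ y → Real.log x - Real.log y ≤ |x - y| / a := by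
    intro x y hx hy
    have hx0 := ha.trans_le hx
    have hy0 := ha.trans_le hy
    rw [← Real.log_div hx0.ne' hy0.ne']
    refine (Real.log_le_sub_one_of_pos (div_pos hx0 hy0)).trans ?_
    rw [div_sub_one hy0.ne']
    exact (div_le_div_of_nonneg_right (le_abs_self _) hy0.le).trans
      (div_le_div_of_nonneg_left (abs_nonneg _) ha hy)
  refine abs_le.2 ⟨?_, key hx hy⟩
  have := key hy hx
  rw [abs_sub_comm] at this
  linarith

theorem abs_log_le_of_mem {a b x : ℝ} (ha : 0 < a) (hx : x ∈ Set.Icc a b) :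
    |Real.log x| ≤ max |Real.log a| |Real.log b| :=
  abs_le_max_abs_abs (Real.log_le_log ha hx.1) (Real.log_le_log (ha.trans_le hx.1) hx.2)

theorem abs_mul_log_sub_le {a b x x' y y' : ℝ} (ha : 0 < a)
    (hx' : x' ∈ Set.Icc a b) (hy : y ∈ Set.Icc a b) (hy' : y' ∈ Set.Icc a b) :
    |x * Real.log y - x' * Real.log y'| ≤
      max |Real.log a| |Real.log b| * |x - x'| + b / a * |y - y'| := by
  have e : x * Real.log y - x' * Real.log y' =
      (x - x') * Real.log y + x' * (Real.log y - Real.log y') := by ring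
  have hx0 : 0 ≤ x' := ha.le.trans hx'.1
  rw [e]
  refine (abs_add_le _ _).trans (add_le_add ?_ ?_)
  · rw [abs_mul, mul_comm]
    exact mul_le_mul_of_nonneg_right (abs_log_le_of_mem ha hy) (abs_nonneg _)
  · rw [abs_mul, abs_of_nonneg hx0, div_mul_eq_mul_div, ← mul_div_assoc']
    exact mul_le_mul hx'.2 (abs_log_sub_log_le ha hy.1 hy'.1) (abs_nonneg _) (hx0.trans hx'.2)

theorem abs_relDensity_sub_le {a b x x' y y' : ℝ} (ha : 0 < a) (hx : x ∈ Set.Icc a b)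
    (hx' : x' ∈ Set.Icc a b) (hy : y ∈ Set.Icc a b) (hy' : y' ∈ Set.Icc a b) :
    |relDensity x y - relDensity x' y'| ≤
      (2 * max |Real.log a| |Real.log b| + b / a + 1) * (|x - x'| + |y - y'|) := by
  have h1 := abs_mul_log_sub_le (x := x) ha hx' hx hx'
  have h2 := abs_mul_log_sub_le (x := x) ha hx' hy hy'
  have e : relDensity x y - relDensity x' y' = (x * Real.log x - x' * Real.log x')
      - (x * Real.log y - x' * Real.log y') - (x - x') + (y - y') := by
    simp only [relDensity]; ring
  have hM : 0 ≤ max |Real.log a| |Real.log b| := (abs_nonneg _).trans (le_max_left _ _)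
  have h3 : |relDensity x y - relDensity x' y'| ≤ |x * Real.log x - x' * Real.log x'|
      + |x * Real.log y - x' * Real.log y'| + |x - x'| + |y - y'| := by
    rw [e]
    refine (abs_add_le _ _).trans (add_le_add_left ((abs_sub _ _).trans
      (add_le_add_left (abs_sub _ _) _)) _)
  have := mul_nonneg hM (abs_nonneg (y - y'))
  linarith

theorem measurable_relDensity {F G : KacSphere N → ℝ} (hF : Measurable F) (hG : Measurable G) :
    Measurable fun v => relDensity (F v) (G v) := by
  unfold relDensity
  exact ((hF.mul (hF.log.sub hG.log)).sub hF).add hG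

theorem abs_relDensity_le {a b x y : ℝ} (ha : 0 < a) (hx : x ∈ Set.Icc a b) (hy : y ∈ Set.Icc a b) :
    |relDensity x y| ≤ (2 * max |Real.log a| |Real.log b| + b / a + 1) * (2 * |b - a|) := by
  have h := abs_relDensity_sub_le ha hx ⟨le_rfl, hx.1.trans hx.2⟩ hy ⟨le_rfl, hx.1.trans hx.2⟩
  have h0 : relDensity a a = 0 := by simp [relDensity]
  rw [h0, sub_zero] at h
  have hM : 0 ≤ max |Real.log a| |Real.log b| := (abs_nonneg _).trans (le_max_left _ _)
  have hb : 0 ≤ b := ha.le.trans (hx.1.trans hx.2)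
  refine h.trans (mul_le_mul_of_nonneg_left ?_ (by positivity))
  rw [abs_of_nonneg (sub_nonneg.2 hx.1), abs_of_nonneg (sub_nonneg.2 hy.1),
    abs_of_nonneg (sub_nonneg.2 (hx.1.trans hx.2))]
  linarith [hx.2, hy.2]

theorem abs_evalS_pairWeight_le (i j : Fin N) (v : KacSphere N) :
    |evalS v (pairWeight i j)| ≤ 1 + N := by
  rw [evalS_pairWeight, abs_of_nonneg (by positivity)]
  linarith [v.sq_le i, v.sq_le j, (Nat.cast_nonneg N : (0 : ℝ) ≤ N)]

/-- On `[a, b]²` the relative entropy density is Lipschitz, the weight is bounded on the sphere, and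
averaging is an `L¹` contraction. The constant depends on `N`, which is harmless because
approximation is carried out at fixed `N`. -/
theorem abs_integral_relDensity_sub_le (hN : 2 ≤ N) {F G : KacSphere N → ℝ} (hF : Measurable F)
    (hG : Measurable G) {a b : ℝ} (ha : 0 < a) (hFb : ∀ v, F v ∈ Set.Icc a b)
    (hGb : ∀ v, G v ∈ Set.Icc a b) (i j : Fin N) :
    |∫ v, evalS v (pairWeight i j) * relDensity (F v) (kacAvg i j F v) ∂(kacSigma N)
      - ∫ v, evalS v (pairWeight i j) * relDensity (G v) (kacAvg i j G v) ∂(kacSigma N)| ≤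
    2 * (1 + N) * (2 * max |Real.log a| |Real.log b| + b / a + 1) *
      ∫ v, |F v - G v| ∂(kacSigma N) := by
  have := isProbabilityMeasure_kacSigma hN
  set Λ := 2 * max |Real.log a| |Real.log b| + b / a + 1 with hΛ
  have hb : 0 ≤ b := by
    obtain ⟨v⟩ := KacSphere.nonempty hN
    exact ha.le.trans ((hFb v).1.trans (hFb v).2)
  have hΛ0 : 0 ≤ Λ := by
    have : 0 ≤ max |Real.log a| |Real.log b| := (abs_nonneg _).trans (le_max_left _ _)
    positivity
  have hw := (continuous_evalS (pairWeight i j)).measurable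
  have hi : ∀ {F : KacSphere N → ℝ}, Measurable F → (∀ v, F v ∈ Set.Icc a b) → Integrable (fun v =>
      evalS v (pairWeight i j) * relDensity (F v) (kacAvg i j F v)) (kacSigma N) := by
    intro F hF hFb
    refine integrable_of_bounded hN (B := (1 + N) * (Λ * (2 * |b - a|)))
      (hw.mul (measurable_relDensity hF (measurable_kacAvg i j hF))) fun v => ?_
    rw [abs_mul]
    exact mul_le_mul (abs_evalS_pairWeight_le i j v)
      (abs_relDensity_le ha (hFb v) (kacAvg_mem_Icc i j hF hFb v)) (abs_nonneg _) (by positivity)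
  have hFB : ∀ v, |F v| ≤ max |a| |b| := fun v => abs_le_max_abs_abs (hFb v).1 (hFb v).2
  have hGB : ∀ v, |G v| ≤ max |a| |b| := fun v => abs_le_max_abs_abs (hGb v).1 (hGb v).2
  have hdm : Measurable fun v => |F v - G v| := (hF.sub hG).abs
  have hdb : ∀ v, |(|F v - G v|)| ≤ max |a| |b| + max |a| |b| := fun v => by
    rw [abs_abs]; exact (abs_sub _ _).trans (add_le_add (hFB v) (hGB v))
  have hd : Integrable (fun v => |F v - G v|) (kacSigma N) := integrable_of_bounded hN hdm hdb
  have hdE : Integrable (fun v => kacAvg i j (fun v => |F v - G v|) v) (kacSigma N) :=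
    integrable_of_bounded hN (measurable_kacAvg i j hdm) (abs_kacAvg_le i j hdm hdb)
  have hEd : ∀ v, |kacAvg i j F v - kacAvg i j G v| ≤ kacAvg i j (fun v => |F v - G v|) v := by
    intro v
    have hsubb : ∀ v, |F v - G v| ≤ max |a| |b| + max |a| |b| :=
      fun v => (abs_sub _ _).trans (add_le_add (hFB v) (hGB v))
    rw [abs_le, ← kacAvg_sub i j hF hG hFB hGB]
    constructor
    · have h1 := kacAvg_mono i j (hG.sub hF) hdm (B := max |a| |b| + max |a| |b|)
        (fun v => by simpa [abs_sub_comm] using hsubb v) hdb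
        (fun v => by simpa [abs_sub_comm] using le_abs_self (G v - F v)) v
      have h2 := kacAvg_sub i j hG hF hGB hFB v
      have h3 := kacAvg_sub i j hF hG hFB hGB v
      change kacAvg i j (fun v => G v - F v) v ≤ _ at h1
      linarith
    · exact kacAvg_mono i j (hF.sub hG) hdm hsubb hdb (fun v => le_abs_self _) v
  rw [← integral_sub (hi hF hFb) (hi hG hGb), ← Real.norm_eq_abs]
  calc ‖∫ v, (evalS v (pairWeight i j) * relDensity (F v) (kacAvg i j F v)
      - evalS v (pairWeight i j) * relDensity (G v) (kacAvg i j G v)) ∂(kacSigma N)‖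
      ≤ ∫ v, (1 + N) * Λ * (|F v - G v| + kacAvg i j (fun v => |F v - G v|) v) ∂(kacSigma N) := by
        refine norm_integral_le_of_norm_le ((hd.add hdE).const_mul _)
          (Filter.Eventually.of_forall fun v => ?_)
        rw [← mul_sub, norm_mul, Real.norm_eq_abs, Real.norm_eq_abs, mul_assoc]
        refine mul_le_mul (abs_evalS_pairWeight_le i j v) ?_ (abs_nonneg _) (by positivity)
        refine (abs_relDensity_sub_le ha (hFb v) (hGb v) (kacAvg_mem_Icc i j hF hFb v)
          (kacAvg_mem_Icc i j hG hGb v)).trans ?_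
        exact mul_le_mul_of_nonneg_left (add_le_add_right (hEd v) _) hΛ0
    _ = _ := by
        rw [integral_const_mul, integral_add hd hdE]
        have := integral_invariant_mul_kacAvg hN i j (w := fun _ => 1) measurable_const hdm
          (fun _ => le_refl |(1 : ℝ)|) hdb (fun _ _ => rfl)
        simp only [one_mul] at this
        rw [this]; ring

theorem abs_relEnt_sub_le (hN : 2 ≤ N) {F G : KacSphere N → ℝ} (hF : Measurable F)
    (hG : Measurable G) {a b : ℝ} (ha : 0 < a) (hFb : ∀ v, F v ∈ Set.Icc a b)
    (hGb : ∀ v, G v ∈ Set.Icc a b) :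
    |relEnt F - relEnt G| ≤ 2 * (max |Real.log a| |Real.log b| + b / a) *
      ∫ v, |F v - G v| ∂(kacSigma N) := by
  have := isProbabilityMeasure_kacSigma hN
  set Λ := max |Real.log a| |Real.log b| + b / a with hΛ
  have hlip : ∀ {x x' : ℝ}, x ∈ Set.Icc a b → x' ∈ Set.Icc a b →
      |x * Real.log x - x' * Real.log x'| ≤ Λ * |x - x'| := by
    intro x x' hx hx'
    refine (abs_mul_log_sub_le (x := x) ha hx' hx hx').trans_eq ?_
    rw [hΛ]; ring
  have hb : ∀ {F : KacSphere N → ℝ}, (∀ v, F v ∈ Set.Icc a b) → ∀ v, |F v| ≤ max |a| |b| :=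
    fun hFb v => abs_le_max_abs_abs (hFb v).1 (hFb v).2
  have hint : ∀ {F : KacSphere N → ℝ}, Measurable F → (∀ v, F v ∈ Set.Icc a b) →
      Integrable F (kacSigma N) := fun hF hFb => integrable_of_bounded hN hF (hb hFb)
  have hintl : ∀ {F : KacSphere N → ℝ}, Measurable F → (∀ v, F v ∈ Set.Icc a b) →
      Integrable (fun v => F v * Real.log (F v)) (kacSigma N) := by
    intro F hF hFb
    refine integrable_of_bounded hN (B := max |a| |b| * max |Real.log a| |Real.log b|)
      (hF.mul hF.log) fun v => ?_
    rw [abs_mul]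
    exact mul_le_mul (hb hFb v) (abs_log_le_of_mem ha (hFb v)) (abs_nonneg _)
      ((abs_nonneg _).trans (le_max_left _ _))
  have hmean : ∀ {F : KacSphere N → ℝ}, Measurable F → (∀ v, F v ∈ Set.Icc a b) →
      ∫ v, F v ∂(kacSigma N) ∈ Set.Icc a b := by
    intro F hF hFb
    constructor
    · simpa using integral_mono (integrable_const a) (hint hF hFb) fun v => (hFb v).1
    · simpa using integral_mono (hint hF hFb) (integrable_const b) fun v => (hFb v).2
  have hd : Integrable (fun v => |F v - G v|) (kacSigma N) :=
    ((hint hF hFb).sub (hint hG hGb)).abs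
  have h1 : |∫ v, F v * Real.log (F v) ∂(kacSigma N) - ∫ v, G v * Real.log (G v) ∂(kacSigma N)| ≤
      Λ * ∫ v, |F v - G v| ∂(kacSigma N) := by
    rw [← integral_sub (hintl hF hFb) (hintl hG hGb), ← Real.norm_eq_abs, ← integral_const_mul]
    exact norm_integral_le_of_norm_le (hd.const_mul _)
      (Filter.Eventually.of_forall fun v => hlip (hFb v) (hGb v))
  have h2 := hlip (hmean hF hFb) (hmean hG hGb)
  have h3 : |∫ v, F v ∂(kacSigma N) - ∫ v, G v ∂(kacSigma N)| ≤ ∫ v, |F v - G v| ∂(kacSigma N) := by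
    rw [← integral_sub (hint hF hFb) (hint hG hGb)]
    exact abs_integral_le_integral_abs
  have hΛ0 : 0 ≤ Λ := by
    have h4 := (hmean hF hFb)
    have : 0 ≤ b := ha.le.trans (h4.1.trans h4.2)
    have : 0 ≤ max |Real.log a| |Real.log b| := (abs_nonneg _).trans (le_max_left _ _)
    positivity
  have h4 := mul_le_mul_of_nonneg_left h3 hΛ0
  rw [relEnt, relEnt, sub_sub_sub_comm]
  refine (abs_sub _ _).trans ?_
  linarith

theorem relEnt_eq_integral_relDensity (hN : 2 ≤ N) {F : KacSphere N → ℝ} (hF : Measurable F)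
    {a b : ℝ} (ha : 0 < a) (hFb : ∀ v, F v ∈ Set.Icc a b) :
    relEnt F = ∫ v, relDensity (F v) (∫ w, F w ∂(kacSigma N)) ∂(kacSigma N) := by
  have := isProbabilityMeasure_kacSigma hN
  set m := ∫ w, F w ∂(kacSigma N) with hm
  have hb : ∀ v, |F v| ≤ max |a| |b| := fun v => abs_le_max_abs_abs (hFb v).1 (hFb v).2
  have hint := integrable_of_bounded hN hF hb
  have hintl : Integrable (fun v => F v * Real.log (F v)) (kacSigma N) := by
    refine integrable_of_bounded hN (B := max |a| |b| * max |Real.log a| |Real.log b|)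
      (hF.mul hF.log) fun v => ?_
    rw [abs_mul]
    exact mul_le_mul (hb v) (abs_log_le_of_mem ha (hFb v)) (abs_nonneg _)
      ((abs_nonneg _).trans (le_max_left _ _))
  have i1 : Integrable (fun v => F v * Real.log (F v) - F v * Real.log m) (kacSigma N) :=
    hintl.sub (hint.mul_const _)
  have i2 : Integrable (fun v => F v * Real.log (F v) - F v * Real.log m - F v) (kacSigma N) :=
    i1.sub hint
  simp only [relDensity, mul_sub]
  rw [integral_add i2 (integrable_const _), integral_sub i1 hint, integral_sub hintl (hint.mul_const _),
    integral_mul_const, relEnt, ← hm]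
  simp

theorem relEnt_nonneg (hN : 2 ≤ N) {F : KacSphere N → ℝ} (hF : Measurable F)
    {a b : ℝ} (ha : 0 < a) (hFb : ∀ v, F v ∈ Set.Icc a b) : 0 ≤ relEnt F := by
  have := isProbabilityMeasure_kacSigma hN
  have hb : ∀ v, |F v| ≤ max |a| |b| := fun v => abs_le_max_abs_abs (hFb v).1 (hFb v).2
  have hm : a ≤ ∫ w, F w ∂(kacSigma N) := by
    simpa using integral_mono (integrable_const a) (integrable_of_bounded hN hF hb)
      fun v => (hFb v).1
  rw [relEnt_eq_integral_relDensity hN hF ha hFb]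
  exact integral_nonneg fun v => relDensity_nonneg (ha.trans_le (hFb v).1) (ha.trans_le hm)

/-- Both sides are `L¹` continuous on functions between positive bounds, so the polynomial case
passes to the limit. -/
theorem relEnt_le_sum_relDensity (hN : 3 ≤ N) {F : KacSphere N → ℝ} (hF : Measurable F) {a b : ℝ}
    (ha : 0 < a) (hFb : ∀ v, F v ∈ Set.Icc a b) :
    (N : ℝ) / 52 * relEnt F ≤ ∑ α : Fin N × Fin N, ∫ v, evalS v (pairWeight α.1 α.2) *
        relDensity (F v) (kacAvg α.1 α.2 F v) ∂(kacSigma N) := by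
  have hN2 : 2 ≤ N := by omega
  have ha2 : 0 < a / 2 := half_pos ha
  have hFb' : ∀ v, F v ∈ Set.Icc (a / 2) (b + 1) := fun v =>
    ⟨by linarith [(hFb v).1], by linarith [(hFb v).2]⟩
  set C₁ := 2 * (max |Real.log (a / 2)| |Real.log (b + 1)| + (b + 1) / (a / 2)) with hC₁
  set C₂ := 2 * (1 + (N : ℝ)) * (2 * max |Real.log (a / 2)| |Real.log (b + 1)|
    + (b + 1) / (a / 2) + 1) with hC₂
  have key : ∀ ε > 0, (N : ℝ) / 52 * relEnt F ≤
      (∑ α : Fin N × Fin N, ∫ v, evalS v (pairWeight α.1 α.2) *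
        relDensity (F v) (kacAvg α.1 α.2 F v) ∂(kacSigma N))
      + ((N : ℝ) / 52 * |C₁| + Fintype.card (Fin N × Fin N) * |C₂|) * ε := by
    intro ε hε
    obtain ⟨p, hp, hpε⟩ := exists_evalS_near_L1 hN2 hF ha hFb hε
    have hpm := (continuous_evalS p).measurable
    have h0 : 0 ≤ ∫ v, |F v - evalS v p| ∂(kacSigma N) := integral_nonneg fun v => abs_nonneg _
    have h1 := relEnt_le_sum_pair_poly hN ha2 fun v => (hp v).1
    have h2 := abs_relEnt_sub_le hN2 hF hpm ha2 hFb' hp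
    rw [← hC₁] at h2
    have h3 := fun α : Fin N × Fin N =>
      abs_integral_relDensity_sub_le hN2 hF hpm ha2 hFb' hp α.1 α.2
    simp only [← hC₂] at h3
    have h4 : relEnt F ≤ relEnt (fun v => evalS v p) + |C₁| * ε := by
      have h5 := (le_abs_self _).trans h2
      have h6 : C₁ * ∫ v, |F v - evalS v p| ∂(kacSigma N) ≤ |C₁| * ε :=
        mul_le_mul (le_abs_self _) hpε h0 (abs_nonneg _)
      linarith
    have h5 : ∑ α : Fin N × Fin N, ∫ v, evalS v (pairWeight α.1 α.2) *
          relDensity (evalS v p) (kacAvg α.1 α.2 (fun v => evalS v p) v) ∂(kacSigma N) ≤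
        ∑ α : Fin N × Fin N, (∫ v, evalS v (pairWeight α.1 α.2) *
          relDensity (F v) (kacAvg α.1 α.2 F v) ∂(kacSigma N) + |C₂| * ε) := by
      refine Finset.sum_le_sum fun α _ => ?_
      have h6 := (abs_le.1 (h3 α)).1
      have h7 : C₂ * ∫ v, |F v - evalS v p| ∂(kacSigma N) ≤ |C₂| * ε :=
        mul_le_mul (le_abs_self _) hpε h0 (abs_nonneg _)
      linarith
    rw [Finset.sum_add_distrib, Finset.sum_const, Finset.card_univ, nsmul_eq_mul] at h5
    have h6 := mul_le_mul_of_nonneg_left h4 (by positivity : (0 : ℝ) ≤ (N : ℝ) / 52)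
    linarith
  set K := (N : ℝ) / 52 * |C₁| + Fintype.card (Fin N × Fin N) * |C₂| with hK
  have hK0 : 0 ≤ K := by positivity
  refine le_of_forall_pos_le_add fun ε hε => ?_
  refine (key (ε / (K + 1)) (by positivity)).trans ?_
  refine add_le_add_right ?_ _
  rw [mul_div_assoc', div_le_iff₀ (by positivity)]
  nlinarith

theorem exists_cos_sin_eq {c s : ℝ} (h : c ^ 2 + s ^ 2 = 1) :
    ∃ t, |t| ≤ Real.pi ∧ Real.cos t = c ∧ Real.sin t = s := by
  have hn : ‖(⟨c, s⟩ : ℂ)‖ = 1 := by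
    rw [Complex.norm_eq_sqrt_sq_add_sq, h, Real.sqrt_one]
  have hne : (⟨c, s⟩ : ℂ) ≠ 0 := by
    intro e; rw [e, norm_zero] at hn; exact zero_ne_one hn
  refine ⟨Complex.arg ⟨c, s⟩, Complex.abs_arg_le_pi _, ?_, ?_⟩
  · rw [Complex.cos_arg hne, hn, div_one]
  · rw [Complex.sin_arg, hn, div_one]

theorem exists_kacRot_eq_two (v w : KacSphere 2) : ∃ t, kacRot 0 1 t v = w := by
  have hv := v.sum_sq
  have hw := w.sum_sq
  rw [Fin.sum_univ_two] at hv hw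
  push_cast at hv hw
  obtain ⟨t, -, hc, hs⟩ := exists_cos_sin_eq
    (c := (v.1 0 * w.1 0 + v.1 1 * w.1 1) / 2) (s := (v.1 1 * w.1 0 - v.1 0 * w.1 1) / 2)
    (by
      have : (v.1 0 ^ 2 + v.1 1 ^ 2) * (w.1 0 ^ 2 + w.1 1 ^ 2) = 4 := by rw [hv, hw]; norm_num
      linear_combination this / 4)
  refine ⟨t, KacSphere.ext_coord fun l => ?_⟩
  fin_cases l
  · change (kacRot 0 1 t v).1 0 = w.1 0
    rw [kacRot_coord_left (by decide), hc, hs]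
    linear_combination (w.1 0 / 2) * hv
  · change (kacRot 0 1 t v).1 1 = w.1 1
    rw [kacRot_coord_right (by decide), hc, hs]
    linear_combination (w.1 1 / 2) * hv

/-- Rotations act transitively on the circle, so the average is a constant, and it preserves the
integral. -/
theorem kacAvg_two {F : KacSphere 2 → ℝ} (hF : Measurable F) {B : ℝ} (hB : ∀ v, |F v| ≤ B)
    (v : KacSphere 2) : kacAvg 0 1 F v = ∫ w, F w ∂(kacSigma 2) := by
  have := isProbabilityMeasure_kacSigma (le_refl 2)
  have h := integral_invariant_mul_kacAvg (le_refl 2) 0 1 (w := fun _ => 1) measurable_const hF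
    (fun _ => le_refl |(1 : ℝ)|) hB (fun _ _ => rfl)
  simp only [one_mul] at h
  rw [← h]
  have hconst : ∀ w, kacAvg 0 1 F w = kacAvg 0 1 F v := by
    intro w
    obtain ⟨t, rfl⟩ := exists_kacRot_eq_two v w
    exact kacAvg_kacRot _ _ _ _ _
  simp [hconst]

/-- The entropy production density `(F - E F) (log F - log E F)` of the pair `(i, j)`. -/
noncomputable def pairProduction (i j : Fin N) (F : KacSphere N → ℝ) (v : KacSphere N) : ℝ :=
  (F v - kacAvg i j F v) * (Real.log (F v) - Real.log (kacAvg i j F v))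

/-- The right side is the symmetrised quantity `relDensity x y + relDensity y x`. -/
theorem relDensity_le_mul {x y : ℝ} (hx : 0 < x) (hy : 0 < y) :
    relDensity x y ≤ (x - y) * (Real.log x - Real.log y) := by
  have := relDensity_nonneg hy hx
  simp only [relDensity] at *
  linarith

theorem pairProduction_nonneg (i j : Fin N) {F : KacSphere N → ℝ} (hF : Measurable F) {a b : ℝ}
    (ha : 0 < a) (hFb : ∀ v, F v ∈ Set.Icc a b) (v : KacSphere N) : 0 ≤ pairProduction i j F v := by
  have h1 := ha.trans_le (hFb v).1
  have h2 := ha.trans_le (kacAvg_mem_Icc i j hF hFb v).1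
  exact (relDensity_nonneg h1 h2).trans (relDensity_le_mul h1 h2)

theorem measurable_pairProduction (i j : Fin N) {F : KacSphere N → ℝ} (hF : Measurable F) :
    Measurable (pairProduction i j F) :=
  (hF.sub (measurable_kacAvg i j hF)).mul (hF.log.sub (measurable_kacAvg i j hF).log)

theorem abs_pairProduction_le (i j : Fin N) {F : KacSphere N → ℝ} (hF : Measurable F) {a b : ℝ}
    (ha : 0 < a) (hFb : ∀ v, F v ∈ Set.Icc a b) (v : KacSphere N) :
    |pairProduction i j F v| ≤
      (F v + kacAvg i j F v) * (2 * max |Real.log a| |Real.log b|) := by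
  have hE := kacAvg_mem_Icc i j hF hFb v
  rw [pairProduction, abs_mul]
  refine mul_le_mul ?_ ?_ (abs_nonneg _) (by linarith [(hFb v).1, hE.1])
  · rw [abs_le]; constructor <;> linarith [(hFb v).1, hE.1]
  · refine (abs_sub _ _).trans ?_
    linarith [abs_log_le_of_mem ha (hFb v), abs_log_le_of_mem ha hE]

/-- The entropy production of the walk with quadratic rates controls the entropy, uniformly in the
number of particles. -/
theorem relEnt_le_sum_pairProduction (hN : 2 ≤ N) {F : KacSphere N → ℝ} (hF : Measurable F)
    {a b : ℝ} (ha : 0 < a) (hFb : ∀ v, F v ∈ Set.Icc a b) :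
    (N : ℝ) / 52 * relEnt F ≤ ∑ α : Fin N × Fin N, ∫ v, (1 + v.1 α.1 ^ 2 + v.1 α.2 ^ 2) *
        pairProduction α.1 α.2 F v ∂(kacSigma N) := by
  have := isProbabilityMeasure_kacSigma hN
  have hb : 0 ≤ b := by
    obtain ⟨v⟩ := KacSphere.nonempty hN
    exact ha.le.trans ((hFb v).1.trans (hFb v).2)
  have hM : 0 ≤ max |Real.log a| |Real.log b| := (abs_nonneg _).trans (le_max_left _ _)
  have hwc : ∀ i j : Fin N, Continuous fun v : KacSphere N => 1 + v.1 i ^ 2 + v.1 j ^ 2 := by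
    intro i j; fun_prop
  have hi : ∀ i j : Fin N, Integrable (fun v : KacSphere N =>
      (1 + v.1 i ^ 2 + v.1 j ^ 2) * pairProduction i j F v) (kacSigma N) := by
    intro i j
    refine integrable_of_bounded hN (B := (1 + N + N) * ((b + b) *
      (2 * max |Real.log a| |Real.log b|)))
      ((hwc i j).measurable.mul (measurable_pairProduction i j hF)) fun v => ?_
    rw [abs_mul]
    refine mul_le_mul ?_ ((abs_pairProduction_le i j hF ha hFb v).trans ?_) (abs_nonneg _)
      (by positivity)
    · rw [abs_of_nonneg (by positivity)]; linarith [v.sq_le i, v.sq_le j]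
    · gcongr
      · exact (hFb v).2
      · exact (kacAvg_mem_Icc i j hF hFb v).2
  have hi2 : ∀ (i j : Fin N), Integrable (fun v : KacSphere N =>
      evalS v (pairWeight i j) * relDensity (F v) (kacAvg i j F v)) (kacSigma N) := by
    intro i j
    refine integrable_of_bounded hN (B := (1 + N) * ((2 * max |Real.log a| |Real.log b| + b / a + 1)
      * (2 * |b - a|))) ((continuous_evalS _).measurable.mul
        (measurable_relDensity hF (measurable_kacAvg i j hF))) fun v => ?_
    rw [abs_mul]
    exact mul_le_mul (abs_evalS_pairWeight_le i j v)
      (abs_relDensity_le ha (hFb v) (kacAvg_mem_Icc i j hF hFb v)) (abs_nonneg _) (by positivity)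
  have hcmp : ∀ (i j : Fin N) v, evalS v (pairWeight i j) * relDensity (F v) (kacAvg i j F v) ≤
      (1 + v.1 i ^ 2 + v.1 j ^ 2) * pairProduction i j F v := by
    intro i j v
    have h1 := ha.trans_le (hFb v).1
    have h2 := ha.trans_le (kacAvg_mem_Icc i j hF hFb v).1
    refine mul_le_mul ?_ (relDensity_le_mul h1 h2) (relDensity_nonneg h1 h2) (by positivity)
    rw [evalS_pairWeight]
    linarith [sq_nonneg (v.1 i), sq_nonneg (v.1 j)]
  have hstep : ∑ α : Fin N × Fin N, ∫ v, evalS v (pairWeight α.1 α.2) *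
        relDensity (F v) (kacAvg α.1 α.2 F v) ∂(kacSigma N) ≤
      ∑ α : Fin N × Fin N, ∫ v, (1 + v.1 α.1 ^ 2 + v.1 α.2 ^ 2) *
        pairProduction α.1 α.2 F v ∂(kacSigma N) :=
    Finset.sum_le_sum fun α _ => integral_mono (hi2 α.1 α.2) (hi α.1 α.2) (hcmp α.1 α.2)
  -- For `N = 2` the curvature constant vanishes and the logarithmic Sobolev route is closed. There
  -- the average over the single pair is the mean, so the `(0, 1)` term alone bounds the entropy.
  rcases hN.eq_or_lt with rfl | h3
  · refine le_trans ?_ hstep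
    have hFB : ∀ v, |F v| ≤ max |a| |b| := fun v => abs_le_max_abs_abs (hFb v).1 (hFb v).2
    have hnn := relEnt_nonneg hN hF ha hFb
    have hpos : ∀ α : Fin 2 × Fin 2, 0 ≤ ∫ v, evalS v (pairWeight α.1 α.2) *
        relDensity (F v) (kacAvg α.1 α.2 F v) ∂(kacSigma 2) := fun α =>
      integral_nonneg fun v => mul_nonneg (by rw [evalS_pairWeight]; positivity)
        (relDensity_nonneg (ha.trans_le (hFb v).1)
          (ha.trans_le (kacAvg_mem_Icc _ _ hF hFb v).1))
    refine le_trans ?_ (Finset.single_le_sum (fun α _ => hpos α) (Finset.mem_univ (0, 1)))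
    have h1 : relEnt F ≤ ∫ v, evalS v (pairWeight 0 1) *
        relDensity (F v) (kacAvg 0 1 F v) ∂(kacSigma 2) := by
      rw [relEnt_eq_integral_relDensity hN hF ha hFb]
      have e : ∀ v, relDensity (F v) (∫ w, F w ∂(kacSigma 2)) =
          relDensity (F v) (kacAvg 0 1 F v) := fun v => by rw [kacAvg_two hF hFB]
      simp only [e]
      refine integral_mono ?_ (hi2 0 1) fun v => ?_
      · exact integrable_of_bounded hN (measurable_relDensity hF (measurable_kacAvg 0 1 hF))
          fun v => abs_relDensity_le ha (hFb v) (kacAvg_mem_Icc 0 1 hF hFb v)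
      · refine le_mul_of_one_le_left (relDensity_nonneg (ha.trans_le (hFb v).1)
          (ha.trans_le (kacAvg_mem_Icc _ _ hF hFb v).1)) ?_
        rw [evalS_pairWeight]
        have : 0 ≤ (v.1 0 ^ 2 + v.1 1 ^ 2) / 4 := by positivity
        linarith
    push_cast
    linarith
  · exact (relEnt_le_sum_relDensity h3 hF ha hFb).trans hstep

end pairIneq

/-! ### The Kac generator -/

/-- The collision rate `(1 + v_i² + v_j²)^γ`. -/
noncomputable def kacRate {N : ℕ} (γ : ℝ) (i j : Fin N) (v : KacSphere N) : ℝ :=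
  (1 + v.1 i ^ 2 + v.1 j ^ 2) ^ γ

section generator
variable {N : ℕ} {γ : ℝ}

theorem kacRate_pos (γ : ℝ) (i j : Fin N) (v : KacSphere N) : 0 < kacRate γ i j v :=
  Real.rpow_pos_of_pos (by positivity) _

theorem kacRate_swap (γ : ℝ) (i j : Fin N) (v : KacSphere N) : kacRate γ j i v = kacRate γ i j v := by
  rw [kacRate, kacRate, add_right_comm]

theorem kacRate_kacRot (γ : ℝ) (i j : Fin N) (θ : ℝ) (v : KacSphere N) :
    kacRate γ i j (kacRot i j θ v) = kacRate γ i j v := by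
  rw [kacRate, kacRate, add_assoc, kacRot_pair_sq, ← add_assoc]

theorem continuous_kacRate (γ : ℝ) (i j : Fin N) :
    Continuous (kacRate γ i j : KacSphere N → ℝ) := by
  refine Continuous.rpow_const (by fun_prop) fun v => Or.inl ?_
  positivity

theorem kacRate_le (hγ : 0 ≤ γ) (i j : Fin N) (v : KacSphere N) :
    kacRate γ i j v ≤ (1 + N + N : ℝ) ^ γ :=
  Real.rpow_le_rpow (by positivity) (by linarith [v.sq_le i, v.sq_le j]) hγ

theorem sum_lt_eq_half_sum {f : Fin N → Fin N → ℝ} (hsymm : ∀ i j, f j i = f i j)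
    (hdiag : ∀ i, f i i = 0) :
    ∑ p : {p : Fin N × Fin N // p.1 < p.2}, f p.1.1 p.1.2 = 1 / 2 * ∑ α : Fin N × Fin N, f α.1 α.2 := by
  have h1 : ∑ p : {p : Fin N × Fin N // p.1 < p.2}, f p.1.1 p.1.2
      = ∑ α : Fin N × Fin N, if α.1 < α.2 then f α.1 α.2 else 0 := by
    rw [← Finset.sum_filter]
    exact (Finset.sum_subtype (Finset.univ.filter fun α : Fin N × Fin N => α.1 < α.2)
      (fun x => by simp) (fun α => f α.1 α.2)).symm
  have h2 : ∑ α : Fin N × Fin N, (if α.1 < α.2 then f α.1 α.2 else 0)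
      = ∑ α : Fin N × Fin N, if α.2 < α.1 then f α.1 α.2 else 0 := by
    rw [← (Equiv.prodComm (Fin N) (Fin N)).sum_comp]
    simp [hsymm]
  have h3 : ∑ α : Fin N × Fin N, f α.1 α.2
      = ∑ α : Fin N × Fin N, (if α.1 < α.2 then f α.1 α.2 else 0)
        + ∑ α : Fin N × Fin N, (if α.2 < α.1 then f α.1 α.2 else 0) := by
    rw [← Finset.sum_add_distrib]
    refine Finset.sum_congr rfl fun α _ => ?_
    rcases lt_trichotomy α.1 α.2 with h | h | h
    · simp [h, h.not_gt]
    · rw [h, hdiag]; simp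
    · simp [h, h.not_gt]
  rw [h1, h3, ← h2]; ring

/-- The sum over `i < j` is half that over ordered pairs, whose diagonal vanishes, and `N / (2 (N
choose 2)) = 1 / (N - 1)`. -/
theorem kacGenerator_eq (hN : 2 ≤ N) {F : KacSphere N → ℝ} (hF : Measurable F) {B : ℝ}
    (hB : ∀ v, |F v| ≤ B) (v : KacSphere N) :
    kacGenerator γ F v = ((N : ℝ) - 1)⁻¹ *
      ∑ α : Fin N × Fin N, kacRate γ α.1 α.2 v * (kacAvg α.1 α.2 F v - F v) := by
  have hN' : (2 : ℝ) ≤ N := by exact_mod_cast hN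
  have hch : ((N.choose 2 : ℕ) : ℝ) = N * (N - 1) / 2 := Nat.cast_choose_two ℝ N
  have e : ∀ p : {p : Fin N × Fin N // p.1 < p.2},
      (1 + v.1 p.1.1 ^ 2 + v.1 p.1.2 ^ 2) ^ γ * (1 / (2 * Real.pi) *
          ∫ θ in (-Real.pi)..Real.pi, (F v - F (kacRotation p.1.1 p.1.2 p.2.ne θ v))) =
      -(kacRate γ p.1.1 p.1.2 v * (kacAvg p.1.1 p.1.2 F v - F v)) := by
    intro p
    have h1 := kacAvg_sub p.1.1 p.1.2 (F := fun _ => F v) (G := F) measurable_const hF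
      (fun _ => le_refl |F v|) hB v
    rw [kacAvg_const] at h1
    have h2 : kacAvg p.1.1 p.1.2 (fun w => F v - F w) v = 1 / (2 * Real.pi) *
          ∫ θ in (-Real.pi)..Real.pi, (F v - F (kacRotation p.1.1 p.1.2 p.2.ne θ v)) := by
      simp only [kacAvg, kacRot_of_ne p.2.ne]
    rw [← h2, h1, kacRate]
    ring
  rw [kacGenerator, Finset.sum_congr rfl fun p _ => e p, Finset.sum_neg_distrib,
    sum_lt_eq_half_sum (f := fun i j => kacRate γ i j v * (kacAvg i j F v - F v))
      (fun i j => by rw [kacRate_swap, kacAvg_swap]) (fun i => by rw [kacAvg_self]; ring), hch]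
  have : (N : ℝ) - 1 ≠ 0 := by linarith
  field_simp

theorem measurable_kacGenerator (hN : 2 ≤ N) {F : KacSphere N → ℝ} (hF : Measurable F) {B : ℝ}
    (hB : ∀ v, |F v| ≤ B) : Measurable (kacGenerator γ F) := by
  have e : kacGenerator γ F = fun v => ((N : ℝ) - 1)⁻¹ *
      ∑ α : Fin N × Fin N, kacRate γ α.1 α.2 v * (kacAvg α.1 α.2 F v - F v) :=
    funext fun v => kacGenerator_eq hN hF hB v
  rw [e]
  exact (Finset.measurable_fun_sum _ fun α _ => (continuous_kacRate γ α.1 α.2).measurable.mul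
    ((measurable_kacAvg α.1 α.2 hF).sub hF)).const_mul _

theorem abs_kacGenerator_le (hN : 2 ≤ N) (hγ : 0 ≤ γ) {F : KacSphere N → ℝ} (hF : Measurable F)
    {B : ℝ} (hB : ∀ v, |F v| ≤ B) (v : KacSphere N) :
    |kacGenerator γ F v| ≤ ((N : ℝ) - 1)⁻¹ *
      (Fintype.card (Fin N × Fin N) * ((1 + N + N : ℝ) ^ γ * (2 * B))) := by
  have hN' : (2 : ℝ) ≤ N := by exact_mod_cast hN
  have hinv : 0 ≤ ((N : ℝ) - 1)⁻¹ := inv_nonneg.2 (by linarith)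
  rw [kacGenerator_eq hN hF hB, abs_mul, abs_of_nonneg hinv]
  refine mul_le_mul_of_nonneg_left ((Finset.abs_sum_le_sum_abs _ _).trans ?_) hinv
  rw [← nsmul_eq_mul, ← Finset.card_univ]
  refine Finset.sum_le_card_nsmul _ _ _ fun α _ => ?_
  rw [abs_mul, abs_of_pos (kacRate_pos _ _ _ _)]
  refine mul_le_mul (kacRate_le hγ _ _ _) ?_ (abs_nonneg _) (by positivity)
  refine (abs_sub _ _).trans ?_
  linarith [abs_kacAvg_le α.1 α.2 hF hB v, hB v]

/-- Each average is self-adjoint and commutes with multiplication by the rate of its pair, which is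
invariant under the rotations of that pair. -/
theorem integral_kacGenerator_mul (hN : 2 ≤ N) {F φ : KacSphere N → ℝ}
    (hF : Measurable F) (hφ : Measurable φ) {A B : ℝ} (hB : ∀ v, |F v| ≤ B) (hA : ∀ v, |φ v| ≤ A) :
    ∫ v, kacGenerator γ F v * φ v ∂(kacSigma N) = ∫ v, F v * kacGenerator γ φ v ∂(kacSigma N) := by
  have hrc : ∀ i j, Continuous (kacRate γ i j : KacSphere N → ℝ) := fun i j => continuous_kacRate γ i j
  have hrb : ∀ i j : Fin N, ∃ R, ∀ v, |kacRate γ i j v| ≤ R := by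
    intro i j
    obtain ⟨R, hR⟩ := isCompact_univ.exists_bound_of_continuousOn (hrc i j).continuousOn
    exact ⟨R, fun v => hR v (Set.mem_univ v)⟩
  have hpair : ∀ {F φ : KacSphere N → ℝ}, Measurable F → Measurable φ → ∀ {A B : ℝ},
      (∀ v, |F v| ≤ B) → (∀ v, |φ v| ≤ A) → ∀ i j : Fin N,
      Integrable (fun v => kacRate γ i j v * (kacAvg i j F v - F v) * φ v) (kacSigma N) := by
    intro F φ hF hφ A B hB hA i j
    obtain ⟨R, hR⟩ := hrb i j
    refine integrable_of_bounded hN (B := R * (B + B) * A)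
      (((hrc i j).measurable.mul ((measurable_kacAvg i j hF).sub hF)).mul hφ) fun v => ?_
    rw [abs_mul, abs_mul]
    have hR0 := (abs_nonneg _).trans (hR v)
    have hB0 := (abs_nonneg _).trans (hB v)
    exact mul_le_mul (mul_le_mul (hR v) ((abs_sub _ _).trans
      (add_le_add (abs_kacAvg_le i j hF hB v) (hB v))) (abs_nonneg _) hR0) (hA v) (abs_nonneg _)
      (by positivity)
  have hsym : ∀ i j : Fin N, ∫ v, kacRate γ i j v * (kacAvg i j F v - F v) * φ v ∂(kacSigma N) =
      ∫ v, kacRate γ i j v * (kacAvg i j φ v - φ v) * F v ∂(kacSigma N) := by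
    intro i j
    obtain ⟨R, hR⟩ := hrb i j
    have hm : ∀ {F : KacSphere N → ℝ}, Measurable F → Measurable fun v => kacRate γ i j v * F v :=
      fun hF => (hrc i j).measurable.mul hF
    have hb : ∀ {F : KacSphere N → ℝ} {B : ℝ}, (∀ v, |F v| ≤ B) →
        ∀ v, |kacRate γ i j v * F v| ≤ R * B := by
      intro F B hB v
      rw [abs_mul]
      exact mul_le_mul (hR v) (hB v) (abs_nonneg _) ((abs_nonneg _).trans (hR v))
    have h1 := integral_mul_kacAvg hN i j (hm hφ) hF (hb hA) hB
    simp only [kacAvg_mul_of_invariant i j (kacRate_kacRot γ i j) φ] at h1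
    have i1 : Integrable (fun v => kacRate γ i j v * φ v * kacAvg i j F v) (kacSigma N) :=
      integrable_of_bounded hN ((hm hφ).mul (measurable_kacAvg i j hF)) (B := R * A * B) fun v => by
        rw [abs_mul]
        exact mul_le_mul (hb hA v) (abs_kacAvg_le i j hF hB v) (abs_nonneg _)
          ((abs_nonneg _).trans (hb hA v))
    have i2 : Integrable (fun v => kacRate γ i j v * kacAvg i j φ v * F v) (kacSigma N) :=
      integrable_of_bounded hN ((hm (measurable_kacAvg i j hφ)).mul hF) (B := R * A * B) fun v => by
        rw [abs_mul]
        exact mul_le_mul (hb (abs_kacAvg_le i j hφ hA) v) (hB v) (abs_nonneg _)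
          ((abs_nonneg _).trans (hb hA v))
    have i3 : Integrable (fun v => kacRate γ i j v * φ v * F v) (kacSigma N) :=
      integrable_of_bounded hN ((hm hφ).mul hF) (B := R * A * B) fun v => by
        rw [abs_mul]
        exact mul_le_mul (hb hA v) (hB v) (abs_nonneg _) ((abs_nonneg _).trans (hb hA v))
    calc _ = ∫ v, (kacRate γ i j v * φ v * kacAvg i j F v - kacRate γ i j v * φ v * F v)
          ∂(kacSigma N) := by congr 1; ext v; ring
      _ = ∫ v, (kacRate γ i j v * kacAvg i j φ v * F v - kacRate γ i j v * φ v * F v)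
          ∂(kacSigma N) := by rw [integral_sub i1 i3, integral_sub i2 i3, h1]
      _ = _ := by congr 1; ext v; ring
  have e : ∀ {F φ : KacSphere N → ℝ}, Measurable F → Measurable φ → ∀ {A B : ℝ},
      (∀ v, |F v| ≤ B) → (∀ v, |φ v| ≤ A) → ∫ v, kacGenerator γ F v * φ v ∂(kacSigma N) =
        ((N : ℝ) - 1)⁻¹ * ∑ α : Fin N × Fin N,
          ∫ v, kacRate γ α.1 α.2 v * (kacAvg α.1 α.2 F v - F v) * φ v ∂(kacSigma N) := by
    intro F φ hF hφ A B hB hA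
    simp only [kacGenerator_eq hN hF hB, mul_assoc, Finset.sum_mul]
    rw [integral_const_mul, integral_finsetSum]
    intro α _
    have := hpair hF hφ hB hA α.1 α.2
    simp only [mul_assoc] at this
    exact this
  rw [e hF hφ hB hA]
  simp only [mul_comm (F _)]
  rw [e hφ hF hA hB]
  simp only [hsym]

end generator

/-! ### Solutions of the Kac master equation -/

section solution
variable {N : ℕ} {γ : ℝ} {F₀ G₀ : KacSphere N → ℝ} {F G : ℝ → KacSphere N → ℝ}

theorem IsKacSolution.exists_bound (h : IsKacSolution γ F₀ F) (T : ℝ) :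
    ∃ B, 0 ≤ B ∧ ∀ t, 0 ≤ t → t ≤ T → ∀ v, |F t v| ≤ B := by
  obtain ⟨B, hB⟩ := h.bounded T
  exact ⟨max B 0, le_max_right _ _, fun t h0 hT v => (hB t h0 hT v).trans (le_max_left _ _)⟩

theorem IsKacSolution.exists_bound_at (h : IsKacSolution γ F₀ F) {t : ℝ} (ht : 0 ≤ t) :
    ∃ B, ∀ v, |F t v| ≤ B := by
  obtain ⟨B, hB⟩ := h.bounded t
  exact ⟨B, hB t ht le_rfl⟩

theorem IsKacSolution.hasDerivAt (h : IsKacSolution γ F₀ F) {t : ℝ} (ht : 0 < t) (v : KacSphere N) :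
    HasDerivAt (fun s => F s v) (kacGenerator γ (F t) v) t :=
  (h.equation t ht.le v).hasDerivAt (Ici_mem_nhds ht)

theorem IsKacSolution.continuousOn (h : IsKacSolution γ F₀ F) (v : KacSphere N) :
    ContinuousOn (fun s => F s v) (Set.Ici 0) :=
  fun t ht => (h.equation t ht v).continuousWithinAt

theorem IsKacSolution.sub (hN : 2 ≤ N) (hF : IsKacSolution γ F₀ F) (hG : IsKacSolution γ G₀ G) :
    IsKacSolution γ (fun v => F₀ v - G₀ v) (fun t v => F t v - G t v) where
  initial := by rw [hF.initial, hG.initial]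
  measurable t ht := (hF.measurable t ht).sub (hG.measurable t ht)
  bounded T := by
    obtain ⟨B, hB⟩ := hF.bounded T
    obtain ⟨C, hC⟩ := hG.bounded T
    exact ⟨B + C, fun t h0 hT v => (abs_sub _ _).trans (add_le_add (hB t h0 hT v) (hC t h0 hT v))⟩
  equation t ht v := by
    obtain ⟨B, hB⟩ := hF.exists_bound_at ht
    obtain ⟨C, hC⟩ := hG.exists_bound_at ht
    refine ((hF.equation t ht v).sub (hG.equation t ht v)).congr_deriv ?_
    have hm := hF.measurable t ht
    have hm' := hG.measurable t ht
    rw [kacGenerator_eq hN hm hB, kacGenerator_eq hN hm' hC,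
      kacGenerator_eq hN (F := fun v => F t v - G t v) (hm.sub hm') (B := B + C)
        fun v => (abs_sub _ _).trans (add_le_add (hB v) (hC v)), ← mul_sub, ← Finset.sum_sub_distrib]
    refine congrArg _ (Finset.sum_congr rfl fun α _ => ?_)
    have e := kacAvg_sub α.1 α.2 hm hm' hB hC v
    change _ = _ * (kacAvg α.1 α.2 (fun v => F t v - G t v) v - (F t v - G t v))
    rw [e]; ring

theorem isKacSolution_const (hN : 2 ≤ N) (c : ℝ) :
    IsKacSolution γ (fun _ : KacSphere N => c) (fun _ _ => c) where
  initial := rfl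
  measurable _ _ := measurable_const
  bounded _ := ⟨|c|, fun _ _ _ _ => le_rfl⟩
  equation t ht v := by
    rw [kacGenerator_eq hN measurable_const (fun _ => le_refl |c|)]
    simpa [kacAvg_const] using hasDerivWithinAt_const t (Set.Ici 0) c

/-- One Duhamel step. The gain term is at most `W A exp s`, where `W` is the total rate at `v`;
integrating `(exp (W s) F)'` turns the bound `A exp t` into `A W / (W + 1) exp t`. -/
theorem IsKacSolution.le_geometric (hN : 2 ≤ N) (h : IsKacSolution γ F₀ F) (h0 : ∀ v, F₀ v ≤ 0)
    {T A R : ℝ} (hA : 0 ≤ A)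
    (hR : ∀ v : KacSphere N, ((N : ℝ) - 1)⁻¹ * ∑ α : Fin N × Fin N, kacRate γ α.1 α.2 v ≤ R)
    (hle : ∀ t, 0 ≤ t → t ≤ T → ∀ v, F t v ≤ A * Real.exp t) {t : ℝ} (ht : 0 ≤ t) (htT : t ≤ T)
    (v : KacSphere N) : F t v ≤ A * (R / (R + 1)) * Real.exp t := by
  have hN' : (2 : ℝ) ≤ N := by exact_mod_cast hN
  have hinv : 0 ≤ ((N : ℝ) - 1)⁻¹ := inv_nonneg.2 (by linarith)
  set W := ((N : ℝ) - 1)⁻¹ * ∑ α : Fin N × Fin N, kacRate γ α.1 α.2 v with hW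
  have hW0 : 0 ≤ W := mul_nonneg hinv (Finset.sum_nonneg fun α _ => (kacRate_pos _ _ _ _).le)
  have hd : ∀ s, 0 < s → HasDerivAt (fun s => Real.exp (W * s) * F s v
      - A * (W / (W + 1)) * Real.exp ((W + 1) * s))
      (Real.exp (W * s) * W * F s v + Real.exp (W * s) * kacGenerator γ (F s) v
        - A * (W / (W + 1)) * (Real.exp ((W + 1) * s) * (W + 1))) s := by
    intro s hs
    have e1 : HasDerivAt (fun s => Real.exp (W * s)) (Real.exp (W * s) * W) s := by
      simpa using ((hasDerivAt_id s).const_mul W).exp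
    have e2 : HasDerivAt (fun s => Real.exp ((W + 1) * s)) (Real.exp ((W + 1) * s) * (W + 1)) s := by
      simpa using ((hasDerivAt_id s).const_mul (W + 1)).exp
    exact (e1.mul (h.hasDerivAt hs v)).sub (e2.const_mul _)
  have hanti : AntitoneOn (fun s => Real.exp (W * s) * F s v
      - A * (W / (W + 1)) * Real.exp ((W + 1) * s)) (Set.Icc 0 T) := by
    refine antitoneOn_of_deriv_nonpos (convex_Icc 0 T) ?_ ?_ ?_
    · have hc := (h.continuousOn v).mono (fun s hs => hs.1 : Set.Icc 0 T ⊆ Set.Ici 0)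
      exact (Continuous.continuousOn (by fun_prop)).mul hc |>.sub
        (Continuous.continuousOn (by fun_prop))
    · intro s hs
      rw [interior_Icc] at hs
      exact (hd s hs.1).differentiableAt.differentiableWithinAt
    · intro s hs
      rw [interior_Icc] at hs
      rw [(hd s hs.1).deriv]
      have hm := h.measurable s hs.1.le
      obtain ⟨B, hB⟩ := h.exists_bound_at hs.1.le
      have hgen : kacGenerator γ (F s) v ≤ W * (A * Real.exp s) - W * F s v := by
        rw [kacGenerator_eq hN hm hB, hW, mul_assoc, mul_assoc, ← mul_sub, Finset.sum_mul,
          Finset.sum_mul, ← Finset.sum_sub_distrib]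
        refine mul_le_mul_of_nonneg_left (Finset.sum_le_sum fun α _ => ?_) hinv
        rw [← mul_sub]
        refine mul_le_mul_of_nonneg_left (sub_le_sub_right ?_ _) (kacRate_pos _ _ _ _).le
        have := kacAvg_mono α.1 α.2 hm measurable_const hB (fun _ => le_refl |A * Real.exp s|)
          (fun w => hle s hs.1.le hs.2.le w) v
        rwa [kacAvg_const] at this
      have hexp : Real.exp ((W + 1) * s) = Real.exp (W * s) * Real.exp s := by
        rw [← Real.exp_add]; ring_nf
      rw [hexp]
      have h2 := mul_le_mul_of_nonneg_left hgen (Real.exp_pos (W * s)).le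
      have h3 : A * (W / (W + 1)) * (Real.exp (W * s) * Real.exp s * (W + 1)) =
          Real.exp (W * s) * (W * (A * Real.exp s)) := by field_simp
      rw [h3]
      linarith
  have h1 := hanti (Set.left_mem_Icc.2 (ht.trans htT)) ⟨ht, htT⟩ ht
  simp only [mul_zero, Real.exp_zero, one_mul, mul_one, h.initial] at h1
  have h2 : 0 ≤ A * (W / (W + 1)) := by positivity
  have h3 : Real.exp (W * t) * F t v ≤ A * (W / (W + 1)) * Real.exp ((W + 1) * t) := by
    linarith [h0 v]
  have hexp : Real.exp ((W + 1) * t) = Real.exp (W * t) * Real.exp t := by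
    rw [← Real.exp_add]; ring_nf
  rw [hexp] at h3
  have h4 : F t v ≤ A * (W / (W + 1)) * Real.exp t := by
    refine le_of_mul_le_mul_left ?_ (Real.exp_pos (W * t))
    linarith
  refine h4.trans ?_
  have hR0 : 0 ≤ R := hW0.trans (hR v)
  have h5 : W / (W + 1) ≤ R / (R + 1) := by
    rw [div_le_div_iff₀ (by linarith) (by linarith)]
    linarith [hR v]
  gcongr

/-- Comparison principle, by iterating the Duhamel step with a fixed contraction factor `R / (R +
1)`. The solution is only measurable in `v`, so a maximum need not be attained and the classical
argument is not available. -/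
theorem IsKacSolution.nonpos (hN : 2 ≤ N) (hγ : 0 ≤ γ) (h : IsKacSolution γ F₀ F)
    (h0 : ∀ v, F₀ v ≤ 0) {t : ℝ} (ht : 0 ≤ t) (v : KacSphere N) : F t v ≤ 0 := by
  have hN' : (2 : ℝ) ≤ N := by exact_mod_cast hN
  have hinv : 0 ≤ ((N : ℝ) - 1)⁻¹ := inv_nonneg.2 (by linarith)
  obtain ⟨B, hB0, hB⟩ := h.exists_bound t
  set R : ℝ := ((N : ℝ) - 1)⁻¹ * ∑ _α : Fin N × Fin N, (1 + N + N : ℝ) ^ γ with hRdef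
  have hR : ∀ v : KacSphere N, ((N : ℝ) - 1)⁻¹ * ∑ α : Fin N × Fin N, kacRate γ α.1 α.2 v ≤ R :=
    fun v => mul_le_mul_of_nonneg_left (Finset.sum_le_sum fun α _ => kacRate_le hγ _ _ _) hinv
  have hR0 : 0 ≤ R := mul_nonneg hinv (Finset.sum_nonneg fun _ _ => by positivity)
  have key : ∀ n : ℕ, ∀ s, 0 ≤ s → s ≤ t → ∀ v, F s v ≤ B * (R / (R + 1)) ^ n * Real.exp s := by
    intro n
    induction n with
    | zero =>
      intro s hs hst v
      rw [pow_zero, mul_one]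
      exact (le_abs_self _).trans ((hB s hs hst v).trans
        (le_mul_of_one_le_right hB0 (Real.one_le_exp hs)))
    | succ n ih =>
      intro s hs hst v
      have := h.le_geometric hN h0 (by positivity) hR ih hs hst v
      rwa [mul_assoc B, ← pow_succ] at this
  have hlim : Filter.Tendsto (fun n : ℕ => B * (R / (R + 1)) ^ n * Real.exp t) Filter.atTop
      (nhds 0) := by
    have h1 : R / (R + 1) < 1 := by rw [div_lt_one (by linarith)]; linarith
    simpa using ((tendsto_pow_atTop_nhds_zero_of_lt_one (by positivity) h1).const_mul B).mul_const
      (Real.exp t)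
  exact ge_of_tendsto' hlim fun n => key n t ht le_rfl v

theorem IsKacSolution.le_of_le (hN : 2 ≤ N) (hγ : 0 ≤ γ) (h : IsKacSolution γ F₀ F) {M : ℝ}
    (h0 : ∀ v, F₀ v ≤ M) {t : ℝ} (ht : 0 ≤ t) (v : KacSphere N) : F t v ≤ M :=
  sub_nonpos.1 ((h.sub hN (isKacSolution_const hN M)).nonpos hN hγ
    (fun v => sub_nonpos.2 (h0 v)) ht v)

theorem IsKacSolution.ge_of_ge (hN : 2 ≤ N) (hγ : 0 ≤ γ) (h : IsKacSolution γ F₀ F) {m : ℝ}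
    (h0 : ∀ v, m ≤ F₀ v) {t : ℝ} (ht : 0 ≤ t) (v : KacSphere N) : m ≤ F t v :=
  sub_nonpos.1 (((isKacSolution_const hN m).sub hN h).nonpos hN hγ
    (fun v => sub_nonpos.2 (h0 v)) ht v)

theorem kacAvg_kacPerm (π : Equiv.Perm (Fin N)) (i j : Fin N) (F : KacSphere N → ℝ)
    (v : KacSphere N) : kacAvg i j F (kacPerm π v) = kacAvg (π i) (π j) (fun v => F (kacPerm π v)) v := by
  simp only [kacAvg, kacRot_kacPerm]

theorem IsKacSolution.comp_kacPerm (hN : 2 ≤ N) (h : IsKacSolution γ F₀ F)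
    (π : Equiv.Perm (Fin N)) :
    IsKacSolution γ (fun v => F₀ (kacPerm π v)) (fun t v => F t (kacPerm π v)) where
  initial := by rw [h.initial]
  measurable t ht := (h.measurable t ht).comp (measurePreserving_kacPerm π).measurable
  bounded T := by
    obtain ⟨B, hB⟩ := h.bounded T
    exact ⟨B, fun t h0 hT v => hB t h0 hT _⟩
  equation t ht v := by
    obtain ⟨B, hB⟩ := h.exists_bound_at ht
    have hm := h.measurable t ht
    refine (h.equation t ht (kacPerm π v)).congr_deriv ?_
    rw [kacGenerator_eq hN hm hB, kacGenerator_eq hN (F := fun v => F t (kacPerm π v))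
      (hm.comp (measurePreserving_kacPerm π).measurable) (fun v => hB _)]
    refine congrArg _ ?_
    refine Fintype.sum_equiv (Equiv.prodCongr π π) _ _ fun α => ?_
    rw [kacAvg_kacPerm, kacRate, kacPerm_coord, kacPerm_coord]
    rfl

/-- The permuted solution solves the same equation with the same datum, and comparison in both
directions gives equality. -/
theorem IsKacSolution.isPermSymmetric (hN : 2 ≤ N) (hγ : 0 ≤ γ) (h : IsKacSolution γ F₀ F)
    (h0 : IsPermSymmetric F₀) {t : ℝ} (ht : 0 ≤ t) : IsPermSymmetric (F t) := by
  rw [isPermSymmetric_iff] at h0 ⊢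
  intro π v
  have hπ := h.comp_kacPerm hN π
  have h1 := (hπ.sub hN h).nonpos hN hγ (fun v => by rw [h0]; simp) ht v
  have h2 := (h.sub hN hπ).nonpos hN hγ (fun v => by rw [h0]; simp) ht v
  linarith

theorem IsKacSolution.hasDerivAt_integral_mul (hN : 2 ≤ N) (hγ : 0 ≤ γ) (h : IsKacSolution γ F₀ F)
    {φ : KacSphere N → ℝ} (hφ : Measurable φ) {A : ℝ} (hA : ∀ v, |φ v| ≤ A) :
    ContinuousOn (fun t => ∫ v, F t v * φ v ∂(kacSigma N)) (Set.Ici 0) ∧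
    ∀ t, 0 < t → HasDerivAt (fun t => ∫ v, F t v * φ v ∂(kacSigma N))
      (∫ v, F t v * kacGenerator γ φ v ∂(kacSigma N)) t := by
  have := isProbabilityMeasure_kacSigma hN
  obtain ⟨h1, h2⟩ := hasDerivAt_integral_of_bounded (μ := kacSigma N)
    (f := fun t v => F t v * φ v) (f' := fun t v => kacGenerator γ (F t) v * φ v)
    (fun t ht => (h.measurable t ht).mul hφ)
    (fun t ht => by
      obtain ⟨B, hB⟩ := h.exists_bound_at ht.le
      exact (measurable_kacGenerator hN (h.measurable t ht.le) hB).mul hφ)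
    (fun T => by
      obtain ⟨B, hB0, hB⟩ := h.exists_bound T
      refine ⟨B * A, fun t h0 hT v => ?_⟩
      rw [abs_mul]
      exact mul_le_mul (hB t h0 hT v) (hA v) (abs_nonneg _) hB0)
    (fun T => by
      obtain ⟨B, hB0, hB⟩ := h.exists_bound T
      refine ⟨((N : ℝ) - 1)⁻¹ * (Fintype.card (Fin N × Fin N) * ((1 + N + N : ℝ) ^ γ * (2 * B))) * A,
        fun t h0 hT v => ?_⟩
      rw [abs_mul]
      have hg := abs_kacGenerator_le hN hγ (h.measurable t h0.le) (fun v => hB t h0.le hT v) v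
      exact mul_le_mul hg (hA v) (abs_nonneg _) ((abs_nonneg _).trans hg))
    (fun v => (h.continuousOn v).mul continuousOn_const)
    (fun t ht v => (h.hasDerivAt ht v).mul_const _)
  refine ⟨h1, fun t ht => ?_⟩
  obtain ⟨B, hB⟩ := h.exists_bound_at ht.le
  rw [← integral_kacGenerator_mul hN (h.measurable t ht.le) hφ hB hA]
  exact h2 t ht

theorem IsKacSolution.integral_eq (hN : 2 ≤ N) (hγ : 0 ≤ γ) (h : IsKacSolution γ F₀ F) {t : ℝ}
    (ht : 0 ≤ t) : ∫ v, F t v ∂(kacSigma N) = ∫ v, F₀ v ∂(kacSigma N) := by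
  obtain ⟨hc, hd⟩ := h.hasDerivAt_integral_mul hN hγ (φ := fun _ => 1) measurable_const
    (fun _ => le_refl |(1 : ℝ)|)
  have hz : ∀ v : KacSphere N, kacGenerator γ (fun _ => (1 : ℝ)) v = 0 := fun v => by
    rw [kacGenerator_eq hN measurable_const (fun _ => le_refl |(1 : ℝ)|)]
    simp [kacAvg_const]
  simp only [mul_one, hz, mul_zero, integral_zero] at hc hd
  have h1 := antitoneOn_Ici_of_hasDerivAt hc hd (fun _ _ => le_rfl) (Set.mem_Ici.2 le_rfl)
    (Set.mem_Ici.2 ht) ht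
  have h2 := antitoneOn_Ici_of_hasDerivAt hc.neg (fun t ht => (hd t ht).neg) (fun _ _ => by simp)
    (Set.mem_Ici.2 le_rfl) (Set.mem_Ici.2 ht) ht
  simp only [Pi.neg_apply, h.initial] at h1 h2
  linarith

end solution

/-! ### Povzner inequalities -/

/-- For `x` in `[0, 1]` and `m = min (k - 1) 1`, one has `x^k ≤ x · x^m`, and Bernoulli's inequality
gives `x^m ≤ 1 - m (1 - x)`. Add the cases `x = z` and `x = 1 - z`. -/
theorem rpow_add_rpow_one_sub_le {k z : ℝ} (hk : 1 < k) (h0 : 0 ≤ z) (h1 : z ≤ 1) :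
    z ^ k + (1 - z) ^ k ≤ 1 - 2 * min (k - 1) 1 * (z * (1 - z)) := by
  have key : ∀ x : ℝ, 0 ≤ x → x ≤ 1 → x ^ k ≤ x - min (k - 1) 1 * (x * (1 - x)) := by
    intro x hx0 hx1
    have hm0 : 0 ≤ min (k - 1) 1 := le_min (by linarith) zero_le_one
    have e : x ^ k ≤ x * x ^ min (k - 1) 1 := by
      rcases hx0.eq_or_lt with rfl | hx
      · rw [Real.zero_rpow (by linarith)]; simp
      · calc x ^ k = x * x ^ (k - 1) := by
              rw [← Real.rpow_one_add' hx0 (by linarith)]; congr 1; ring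
          _ ≤ _ := mul_le_mul_of_nonneg_left
            (Real.rpow_le_rpow_of_exponent_ge hx hx1 (min_le_left _ _)) hx0
    have h2 : x ^ min (k - 1) 1 ≤ 1 + min (k - 1) 1 * (x - 1) := by
      simpa using rpow_one_add_le_one_add_mul_self (s := x - 1) (by linarith) hm0 (min_le_right _ _)
    nlinarith [mul_le_mul_of_nonneg_left h2 hx0]
  have e1 := key z h0 h1
  have e2 := key (1 - z) (by linarith) (by linarith)
  nlinarith

theorem rpow_add_rpow_le {k a b : ℝ} (hk : 1 < k) (ha : 0 ≤ a) (hb : 0 ≤ b) :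
    a ^ k + b ^ k ≤ (a + b) ^ k - 2 * min (k - 1) 1 * ((a + b) ^ k / (a + b) ^ 2) * (a * b) := by
  rcases (add_nonneg ha hb).eq_or_lt with h | h
  · have h1 : a = 0 := by linarith
    have h2 : b = 0 := by linarith
    subst h1 h2
    simp [Real.zero_rpow (by linarith : k ≠ 0)]
  · have e := rpow_add_rpow_one_sub_le hk (div_nonneg ha h.le) (by rw [div_le_one h]; linarith)
    have e2 : 1 - a / (a + b) = b / (a + b) := by field_simp; ring
    rw [e2, Real.div_rpow ha h.le, Real.div_rpow hb h.le, ← add_div,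
      div_le_iff₀ (Real.rpow_pos_of_pos h k)] at e
    refine e.trans (le_of_eq ?_)
    field_simp

theorem integral_rotated_mul_sq (x y : ℝ) :
    1 / (2 * Real.pi) * ∫ θ in (-Real.pi)..Real.pi, (x * Real.cos θ + y * Real.sin θ) ^ 2 *
      (-x * Real.sin θ + y * Real.cos θ) ^ 2 = (x ^ 2 + y ^ 2) ^ 2 / 8 := by
  -- The integrand is the derivative of the periodic function `(sin θ cos θ)²`.
  have hodd : ∫ θ in (-Real.pi)..Real.pi, 2 * (Real.sin θ * Real.cos θ) *
      (Real.cos θ * Real.cos θ + Real.sin θ * -Real.sin θ) = 0 := by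
    rw [intervalIntegral.integral_eq_sub_of_hasDerivAt
      (f := fun θ => (Real.sin θ * Real.cos θ) ^ 2)]
    · simp
    · intro θ _
      have h := ((Real.hasDerivAt_sin θ).mul (Real.hasDerivAt_cos θ)).pow 2
      simp only [Nat.cast_ofNat, Nat.reduceSub, pow_one] at h
      exact h
    · exact Continuous.intervalIntegrable (by fun_prop) _ _
  have e : ∀ θ : ℝ, (x * Real.cos θ + y * Real.sin θ) ^ 2 *
      (-x * Real.sin θ + y * Real.cos θ) ^ 2 =
      ((y ^ 2 - x ^ 2) ^ 2 - 4 * (x * y) ^ 2) * (Real.sin θ ^ 2 * Real.cos θ ^ 2) +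
      ((x * y) ^ 2 + (x * y) * (y ^ 2 - x ^ 2) * (2 * (Real.sin θ * Real.cos θ) *
      (Real.cos θ * Real.cos θ + Real.sin θ * -Real.sin θ))) := by
    intro θ
    have h : (x * y) ^ 2 = (x * y) ^ 2 * (Real.sin θ ^ 2 + Real.cos θ ^ 2) ^ 2 := by
      rw [Real.sin_sq_add_cos_sq]; ring
    rw [show ∀ q r : ℝ, q + ((x * y) ^ 2 + r) = q + (x * y) ^ 2 + r from fun q r => by ring, h]
    have h2 : 4 * ((x * y) ^ 2 * (Real.sin θ ^ 2 + Real.cos θ ^ 2) ^ 2) = 4 * (x * y) ^ 2 := by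
      rw [← h]
    rw [h2]
    ring
  simp only [e]
  rw [intervalIntegral.integral_add (Continuous.intervalIntegrable (by fun_prop) _ _)
      (Continuous.intervalIntegrable (by fun_prop) _ _),
    intervalIntegral.integral_add (Continuous.intervalIntegrable (by fun_prop) _ _)
      (Continuous.intervalIntegrable (by fun_prop) _ _),
    intervalIntegral.integral_const_mul, intervalIntegral.integral_const_mul, hodd,
    integral_sin_sq_mul_cos_sq, intervalIntegral.integral_const]
  have h4 : Real.sin (4 * Real.pi) = 0 := by exact_mod_cast Real.sin_nat_mul_pi 4
  have h5 : Real.sin (4 * -Real.pi) = 0 := by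
    rw [mul_neg, Real.sin_neg, h4, neg_zero]
  rw [h4, h5, smul_eq_mul]
  have := Real.pi_ne_zero
  field_simp
  ring

/-- The contraction factor `1 - min (k - 1) 1 / 4` of the collision operator on moments of
order `2k`. -/
noncomputable def povznerFactor (k : ℝ) : ℝ := 1 - min (k - 1) 1 / 4

theorem povznerFactor_lt_one {k : ℝ} (hk : 1 < k) : povznerFactor k < 1 := by
  have : 0 < min (k - 1) 1 := lt_min (by linarith) zero_lt_one
  rw [povznerFactor]; linarith

theorem povznerFactor_pos (k : ℝ) : 0 < povznerFactor k := by
  have : min (k - 1) 1 ≤ 1 := min_le_right _ _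
  rw [povznerFactor]; linarith

/-- The empirical moment `N⁻¹ ∑ |v_l|^{2k}`. -/
noncomputable def empMoment {N : ℕ} (k : ℝ) (v : KacSphere N) : ℝ :=
  (N : ℝ)⁻¹ * ∑ l, (v.1 l ^ 2) ^ k

section moments
variable {N : ℕ} {k γ : ℝ}

theorem continuous_coord_rpow (hk : 1 < k) (l : Fin N) :
    Continuous fun v : KacSphere N => (v.1 l ^ 2) ^ k :=
  Continuous.rpow_const (by fun_prop) fun _ => Or.inr (by linarith)

theorem continuous_empMoment (hk : 1 < k) : Continuous (empMoment k : KacSphere N → ℝ) :=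
  continuous_const.mul (continuous_finsetSum _ fun l _ => continuous_coord_rpow hk l)

theorem empMoment_kacRot {i j : Fin N} (hij : i ≠ j) (θ : ℝ) (v : KacSphere N) :
    empMoment k (kacRot i j θ v) = empMoment k v + (N : ℝ)⁻¹ *
      (((kacRot i j θ v).1 i ^ 2) ^ k + ((kacRot i j θ v).1 j ^ 2) ^ k
        - ((v.1 i ^ 2) ^ k + (v.1 j ^ 2) ^ k)) := by
  have h : ∑ l, (((kacRot i j θ v).1 l ^ 2) ^ k - (v.1 l ^ 2) ^ k) =
      ∑ l ∈ {i, j}, (((kacRot i j θ v).1 l ^ 2) ^ k - (v.1 l ^ 2) ^ k) := by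
    refine (Finset.sum_subset (Finset.subset_univ _) fun l _ hl => ?_).symm
    simp only [Finset.mem_insert, Finset.mem_singleton, not_or] at hl
    rw [kacRot_coord_other hij θ v hl.1 hl.2, sub_self]
  rw [Finset.sum_pair hij, Finset.sum_sub_distrib] at h
  simp only [empMoment]
  rw [← sub_eq_iff_eq_add', ← mul_sub, h]
  ring

/-- The strict convexity gain is applied at each angle to the rotated energies, whose sum `S` is
conserved and whose product averages to `S² / 8`. The gain `2 min (k - 1) 1 / 8` is the deficit of
`povznerFactor k` from one. -/
theorem kacAvg_empMoment_le (hk : 1 < k) {i j : Fin N} (hij : i ≠ j) (v : KacSphere N) :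
    kacAvg i j (empMoment k) v - empMoment k v ≤ (N : ℝ)⁻¹ *
      (povznerFactor k * (v.1 i ^ 2 + v.1 j ^ 2) ^ k - (v.1 i ^ 2) ^ k - (v.1 j ^ 2) ^ k) := by
  set S := v.1 i ^ 2 + v.1 j ^ 2 with hS
  have hpt : ∀ θ : ℝ, empMoment k (kacRot i j θ v) ≤
      (empMoment k v + (N : ℝ)⁻¹ * (S ^ k - ((v.1 i ^ 2) ^ k + (v.1 j ^ 2) ^ k)))
      - (N : ℝ)⁻¹ * (2 * min (k - 1) 1 * (S ^ k / S ^ 2)) *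
        ((v.1 i * Real.cos θ + v.1 j * Real.sin θ) ^ 2 *
          (-v.1 i * Real.sin θ + v.1 j * Real.cos θ) ^ 2) := by
    intro θ
    have h := rpow_add_rpow_le hk (sq_nonneg ((kacRot i j θ v).1 i))
      (sq_nonneg ((kacRot i j θ v).1 j))
    rw [kacRot_pair_sq, ← hS] at h
    rw [← kacRot_coord_left hij, ← kacRot_coord_right hij, empMoment_kacRot hij]
    have := mul_le_mul_of_nonneg_left h (inv_nonneg.2 (Nat.cast_nonneg (α := ℝ) N))
    linarith
  have hint : kacAvg i j (empMoment k) v ≤ 1 / (2 * Real.pi) * ∫ θ in (-Real.pi)..Real.pi,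
      ((empMoment k v + (N : ℝ)⁻¹ * (S ^ k - ((v.1 i ^ 2) ^ k + (v.1 j ^ 2) ^ k)))
      - (N : ℝ)⁻¹ * (2 * min (k - 1) 1 * (S ^ k / S ^ 2)) *
        ((v.1 i * Real.cos θ + v.1 j * Real.sin θ) ^ 2 *
          (-v.1 i * Real.sin θ + v.1 j * Real.cos θ) ^ 2)) := by
    refine mul_le_mul_of_nonneg_left ?_ (by positivity)
    exact intervalIntegral.integral_mono_on (by linarith [Real.pi_pos])
      (((continuous_empMoment hk).comp (continuous_kacRot_angle i j v)).intervalIntegrable _ _)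
      (Continuous.intervalIntegrable (by fun_prop) _ _) fun θ _ => hpt θ
  rw [intervalIntegral.integral_sub (Continuous.intervalIntegrable (by fun_prop) _ _)
      (Continuous.intervalIntegrable (by fun_prop) _ _), intervalIntegral.integral_const_mul,
    intervalIntegral.integral_const, mul_sub, mul_left_comm _ ((N : ℝ)⁻¹ * _),
    integral_rotated_mul_sq, ← hS, smul_eq_mul] at hint
  have hS2 : S ^ k / S ^ 2 * S ^ 2 = S ^ k := by
    rcases eq_or_ne S 0 with h | h
    · rw [h, Real.zero_rpow (by linarith)]; simp
    · field_simp
  have hpi : 1 / (2 * Real.pi) * ((Real.pi - -Real.pi) *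
      (empMoment k v + (N : ℝ)⁻¹ * (S ^ k - ((v.1 i ^ 2) ^ k + (v.1 j ^ 2) ^ k)))) =
      empMoment k v + (N : ℝ)⁻¹ * (S ^ k - ((v.1 i ^ 2) ^ k + (v.1 j ^ 2) ^ k)) := by
    have := Real.pi_ne_zero
    field_simp
    ring
  rw [hpi] at hint
  have e : (N : ℝ)⁻¹ * (2 * min (k - 1) 1 * (S ^ k / S ^ 2)) * (S ^ 2 / 8) =
      (N : ℝ)⁻¹ * (min (k - 1) 1 / 4 * S ^ k) := by
    linear_combination ((N : ℝ)⁻¹ * (min (k - 1) 1 / 4)) * hS2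
  rw [e] at hint
  rw [povznerFactor]
  linarith

theorem empMoment_nonneg (k : ℝ) (v : KacSphere N) : 0 ≤ empMoment k v :=
  mul_nonneg (by positivity) (Finset.sum_nonneg fun l _ => by positivity)

end moments

/-- If `b ≤ η a`, then `(a + b)^k` is close to `a^k` and the factor `lam < 1` leaves a negative
multiple of `a^k`. If `b ≥ η a`, the energies are comparable, and every term is dominated by the
product `(1 + b) (1 + a)^(k+γ-1)`, which is of lower order in each variable separately. -/
theorem povzner_aux {lam k γ η a b : ℝ} (h0 : 0 < lam) (h1 : lam < 1) (hk : 1 < k) (hγ0 : 0 ≤ γ)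
    (hγ1 : γ ≤ 1) (hη0 : 0 < η) (hη1 : η ≤ 1) (hη : lam * (1 + η) ^ k ≤ (1 + lam) / 2)
    (hb : 0 ≤ b) (hab : b ≤ a) :
    (1 + a + b) ^ γ * (lam * (a + b) ^ k - a ^ k - b ^ k) ≤
      -((1 - lam) / 4) * (a ^ k * (1 + a) ^ γ + b ^ k * (1 + b) ^ γ) +
      ((2 * 2 ^ k + 1) / η) * ((1 + b) * (1 + a) ^ (k + γ - 1)) := by
  have ha : 0 ≤ a := hb.trans hab
  have hbk : 0 ≤ b ^ k := by positivity
  have hak : 0 ≤ a ^ k := by positivity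
  have hag : 0 < (1 + a) ^ γ := by positivity
  have hmono : b ^ k * (1 + b) ^ γ ≤ a ^ k * (1 + a) ^ γ := by gcongr
  have h2 : (1 - lam) / 4 * (a ^ k * (1 + a) ^ γ + b ^ k * (1 + b) ^ γ) ≤
      (1 - lam) / 2 * (a ^ k * (1 + a) ^ γ) := by nlinarith
  rcases le_total b (η * a) with h | h
  · have h3 : (a + b) ^ k ≤ (1 + η) ^ k * a ^ k := by
      rw [← Real.mul_rpow (by linarith) ha]
      exact Real.rpow_le_rpow (by linarith) (by linarith) (by linarith)
    have h4 : lam * (a + b) ^ k - a ^ k - b ^ k ≤ -((1 - lam) / 2 * a ^ k) := by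
      nlinarith [mul_le_mul_of_nonneg_left h3 h0.le, mul_le_mul_of_nonneg_right hη hak]
    have h5 : (1 + a) ^ γ ≤ (1 + a + b) ^ γ :=
      Real.rpow_le_rpow (by linarith) (by linarith) hγ0
    have h6 : (1 + a + b) ^ γ * (lam * (a + b) ^ k - a ^ k - b ^ k) ≤
        (1 + a + b) ^ γ * -((1 - lam) / 2 * a ^ k) := mul_le_mul_of_nonneg_left h4 (by positivity)
    have h7 : 0 ≤ (1 - lam) / 2 * a ^ k := mul_nonneg (by linarith) hak
    have h8 : 0 ≤ ((2 * 2 ^ k + 1) / η) * ((1 + b) * (1 + a) ^ (k + γ - 1)) := by positivity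
    nlinarith [mul_le_mul_of_nonneg_right h5 h7]
  · have h3 : (1 + a + b) ^ γ ≤ 2 * (1 + a) ^ γ := by
      calc (1 + a + b) ^ γ ≤ (2 * (1 + a)) ^ γ :=
            Real.rpow_le_rpow (by linarith) (by linarith) hγ0
        _ = 2 ^ γ * (1 + a) ^ γ := Real.mul_rpow (by norm_num) (by linarith)
        _ ≤ 2 ^ (1 : ℝ) * (1 + a) ^ γ := by gcongr; norm_num
        _ = _ := by rw [Real.rpow_one]
    have h4 : (a + b) ^ k ≤ 2 ^ k * a ^ k := by
      rw [← Real.mul_rpow (by norm_num) ha]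
      exact Real.rpow_le_rpow (by linarith) (by linarith) (by linarith)
    have h5 : (1 + a + b) ^ γ * (lam * (a + b) ^ k - a ^ k - b ^ k) ≤
        2 * (1 + a) ^ γ * (2 ^ k * a ^ k) := by
      refine (mul_le_mul_of_nonneg_left (?_ : _ ≤ 2 ^ k * a ^ k) (by positivity)).trans
        (mul_le_mul_of_nonneg_right h3 (by positivity))
      nlinarith [(by positivity : 0 ≤ (a + b) ^ k)]
    have h6 : η * (a ^ k * (1 + a) ^ γ) ≤ (1 + b) * (1 + a) ^ (k + γ - 1) := by
      calc η * (a ^ k * (1 + a) ^ γ) ≤ η * ((1 + a) ^ k * (1 + a) ^ γ) := by gcongr; linarith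
        _ = (η * (1 + a)) * (1 + a) ^ (k + γ - 1) := by
            rw [← Real.rpow_add (by linarith), mul_assoc]
            congr 1
            rw [← Real.rpow_one_add' (by linarith) (by linarith)]
            congr 1; ring
        _ ≤ _ := by gcongr; nlinarith
    have h7 : (2 * 2 ^ k + 1) * (a ^ k * (1 + a) ^ γ) ≤
        ((2 * 2 ^ k + 1) / η) * ((1 + b) * (1 + a) ^ (k + γ - 1)) := by
      rw [div_mul_eq_mul_div, le_div_iff₀ hη0, mul_assoc, mul_comm _ η]
      gcongr
    nlinarith [mul_nonneg hak hag.le]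

theorem exists_povzner {lam k γ : ℝ} (h0 : 0 < lam) (h1 : lam < 1) (hk : 1 < k) (hγ0 : 0 ≤ γ)
    (hγ1 : γ ≤ 1) : ∃ δ C : ℝ, 0 < δ ∧ 0 < C ∧ ∀ a b : ℝ, 0 ≤ a → 0 ≤ b →
    (1 + a + b) ^ γ * (lam * (a + b) ^ k - a ^ k - b ^ k) ≤
      -δ * (a ^ k * (1 + a) ^ γ + b ^ k * (1 + b) ^ γ) +
      C * ((1 + b) * (1 + a) ^ (k + γ - 1) + (1 + a) * (1 + b) ^ (k + γ - 1)) := by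
  -- By continuity at `η = 0`, where the left side is `lam < (1 + lam) / 2`.
  obtain ⟨η, hη0, hη1, hη⟩ : ∃ η : ℝ, 0 < η ∧ η ≤ 1 ∧ lam * (1 + η) ^ k ≤ (1 + lam) / 2 := by
    have hc : ContinuousAt (fun η : ℝ => lam * (1 + η) ^ k) 0 :=
      ContinuousAt.mul continuousAt_const
        (ContinuousAt.rpow_const (by fun_prop) (Or.inl (by norm_num)))
    have h2 : ∀ᶠ η in nhds (0 : ℝ), lam * (1 + η) ^ k < (1 + lam) / 2 :=
      hc.eventually_lt_const (by simp; linarith)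
    obtain ⟨ε, hε, hball⟩ := Metric.eventually_nhds_iff.1 h2
    refine ⟨min (ε / 2) 1, by positivity, min_le_right _ _, (hball ?_).le⟩
    rw [Real.dist_eq, sub_zero, abs_of_pos (by positivity)]
    exact (min_le_left _ _).trans_lt (by linarith)
  refine ⟨(1 - lam) / 4, (2 * 2 ^ k + 1) / η, by linarith, by positivity, fun a b ha hb => ?_⟩
  have hC : 0 < (2 * (2 : ℝ) ^ k + 1) / η := by positivity
  rcases le_total b a with hab | hab
  · have h := povzner_aux h0 h1 hk hγ0 hγ1 hη0 hη1 hη hb hab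
    have : 0 ≤ (2 * 2 ^ k + 1) / η * ((1 + a) * (1 + b) ^ (k + γ - 1)) := by positivity
    linarith
  · have h := povzner_aux h0 h1 hk hγ0 hγ1 hη0 hη1 hη ha hab
    have : 0 ≤ (2 * 2 ^ k + 1) / η * ((1 + b) * (1 + a) ^ (k + γ - 1)) := by positivity
    rw [add_right_comm, add_comm b a] at h
    linarith

/-- The left side grows like `a^(k+γ-1)`, one power below `a^(k+γ)`; this absorbs the cross terms
into the dissipation. -/
theorem exists_rpow_le {k γ ε : ℝ} (hk : 1 < k) (hγ : 0 ≤ γ) (hε : 0 < ε) :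
    ∃ C : ℝ, 0 < C ∧ ∀ a : ℝ, 0 ≤ a →
      (1 + a) ^ (k + γ - 1) ≤ ε * (a ^ k * (1 + a) ^ γ) + C := by
  set A : ℝ := max 1 (2 ^ (k - 1) / ε) with hA
  have hA1 : 1 ≤ A := le_max_left _ _
  refine ⟨(1 + A) ^ (k + γ - 1), by positivity, fun a ha => ?_⟩
  rcases le_total a A with h | h
  · have h1 : (1 + a) ^ (k + γ - 1) ≤ (1 + A) ^ (k + γ - 1) :=
      Real.rpow_le_rpow (by linarith) (by linarith) (by linarith)
    have h2 : 0 ≤ ε * (a ^ k * (1 + a) ^ γ) := by positivity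
    linarith
  · have ha1 : 1 ≤ a := hA1.trans h
    have ha2 : 2 ^ (k - 1) ≤ ε * a := by
      rw [mul_comm, ← div_le_iff₀ hε]; exact (le_max_right _ _).trans h
    have h1 : (1 + a) ^ (k - 1) ≤ ε * a ^ k := by
      calc (1 + a) ^ (k - 1) ≤ (2 * a) ^ (k - 1) :=
            Real.rpow_le_rpow (by linarith) (by linarith) (by linarith)
        _ = 2 ^ (k - 1) * a ^ (k - 1) := Real.mul_rpow (by norm_num) ha
        _ ≤ (ε * a) * a ^ (k - 1) := by gcongr
        _ = _ := by
          rw [mul_assoc, ← Real.rpow_one_add' ha (by linarith)]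
          congr 2; ring
    have h2 : (1 + a) ^ (k + γ - 1) = (1 + a) ^ (k - 1) * (1 + a) ^ γ := by
      rw [← Real.rpow_add (by linarith)]; congr 1; ring
    rw [h2, ← mul_assoc]
    have h3 : 0 ≤ (1 + A) ^ (k + γ - 1) := by positivity
    have : (1 + a) ^ (k - 1) * (1 + a) ^ γ ≤ ε * a ^ k * (1 + a) ^ γ := by gcongr
    linarith

/-- Summing the Povzner inequality over pairs produces products of one-particle quantities. One
factor sums to the constant `∑ (1 + v_j²) = 2N`, so the cross terms are linear in a lower empirical
moment, which is absorbed. The drift holds at every point of the sphere, so neither independence nor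
symmetry of the law enters. -/
theorem exists_kacGenerator_empMoment_le {k γ : ℝ} (hk : 1 < k) (hγ0 : 0 ≤ γ) (hγ1 : γ ≤ 1) :
    ∃ c C : ℝ, 0 < c ∧ 0 < C ∧ ∀ N : ℕ, 2 ≤ N → ∀ v : KacSphere N,
      kacGenerator γ (empMoment k) v ≤ -c * empMoment k v + C := by
  obtain ⟨δ, C, hδ, hC, hP⟩ := exists_povzner (povznerFactor_pos k) (povznerFactor_lt_one hk) hk
    hγ0 hγ1
  -- With `ε = δ / (8C)` the cross terms consume half of the dissipation `2δ`.
  obtain ⟨D, hD, hPD⟩ := exists_rpow_le (ε := δ / (8 * C)) hk hγ0 (by positivity)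
  refine ⟨δ, 8 * C * D, hδ, by positivity, fun N hN v => ?_⟩
  have hN' : (2 : ℝ) ≤ N := by exact_mod_cast hN
  have hN1 : (0 : ℝ) < (N : ℝ) - 1 := by linarith
  have hN0 : (0 : ℝ) < N := by linarith
  obtain ⟨B, hB⟩ := isCompact_univ.exists_bound_of_continuousOn
    (continuous_empMoment (N := N) hk).continuousOn
  rw [kacGenerator_eq hN (continuous_empMoment hk).measurable (fun v => hB v (Set.mem_univ v))]
  set a : Fin N → ℝ := fun l => v.1 l ^ 2 with ha
  have ha0 : ∀ l, 0 ≤ a l := fun l => sq_nonneg _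
  have hsum : ∑ l, (1 + a l) = 2 * N := by
    rw [Finset.sum_add_distrib, v.sum_sq]; simp; ring
  set ψ : Fin N → ℝ := fun l => a l ^ k * (1 + a l) ^ γ with hψ
  set q : Fin N → ℝ := fun l => (1 + a l) ^ (k + γ - 1) with hq
  have hψ0 : ∀ l, 0 ≤ ψ l := fun l => by have := ha0 l; positivity
  have hq0 : ∀ l, 0 ≤ q l := fun l => by have := ha0 l; positivity
  -- The diagonal correction offsets the negative Povzner term at `i = j`, where no collision takes
  -- place; it turns the factor `2N` of the dissipation into `2(N - 1)`.
  have hterm : ∀ α : Fin N × Fin N,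
      kacRate γ α.1 α.2 v * (kacAvg α.1 α.2 (empMoment k) v - empMoment k v) ≤
      (N : ℝ)⁻¹ * (-δ * (ψ α.1 + ψ α.2) + (if α.1 = α.2 then 2 * δ * ψ α.1 else 0) +
        C * ((1 + a α.2) * q α.1 + (1 + a α.1) * q α.2)) := by
    rintro ⟨i, j⟩
    simp only
    have hC0 : 0 ≤ C * ((1 + a j) * q i + (1 + a i) * q j) := by
      have := ha0 i
      have := ha0 j
      have := hq0 i
      have := hq0 j
      positivity
    rcases eq_or_ne i j with rfl | hij
    · rw [kacAvg_self, sub_self, mul_zero, if_pos rfl]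
      refine mul_nonneg (by positivity) ?_
      linarith
    · rw [if_neg hij, add_zero]
      calc _ ≤ kacRate γ i j v * ((N : ℝ)⁻¹ *
            (povznerFactor k * (a i + a j) ^ k - a i ^ k - a j ^ k)) :=
            mul_le_mul_of_nonneg_left (kacAvg_empMoment_le hk hij v) (kacRate_pos _ _ _ _).le
        _ = (N : ℝ)⁻¹ * ((1 + a i + a j) ^ γ *
            (povznerFactor k * (a i + a j) ^ k - a i ^ k - a j ^ k)) := by rw [kacRate]; ring
        _ ≤ _ := mul_le_mul_of_nonneg_left (hP _ _ (ha0 i) (ha0 j)) (by positivity)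
  have hs : ∑ α : Fin N × Fin N, (-δ * (ψ α.1 + ψ α.2) +
      (if α.1 = α.2 then 2 * δ * ψ α.1 else 0) +
        C * ((1 + a α.2) * q α.1 + (1 + a α.1) * q α.2)) =
      -(2 * ((N : ℝ) - 1) * δ) * ∑ l, ψ l + 4 * N * C * ∑ l, q l := by
    have e1 : ∑ i, ∑ j, (ψ i + ψ j) = 2 * N * ∑ l, ψ l := by
      simp only [Finset.sum_add_distrib, Finset.sum_const, Finset.card_univ, Fintype.card_fin,
        nsmul_eq_mul, ← Finset.mul_sum]
      ring
    have e2 : ∑ i, ∑ j, ((1 + a j) * q i + (1 + a i) * q j) = 4 * N * ∑ l, q l := by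
      have h : ∀ i, ∑ j, ((1 + a j) * q i + (1 + a i) * q j) =
          2 * N * q i + (1 + a i) * ∑ l, q l := fun i => by
        rw [Finset.sum_add_distrib, ← Finset.sum_mul, hsum, ← Finset.mul_sum]
      rw [Finset.sum_congr rfl fun i _ => h i, Finset.sum_add_distrib, ← Finset.mul_sum,
        ← Finset.sum_mul, hsum]
      ring
    have h : ∀ i, ∑ j, (-δ * (ψ i + ψ j) + (if i = j then 2 * δ * ψ i else 0) +
        C * ((1 + a j) * q i + (1 + a i) * q j)) = -δ * ∑ j, (ψ i + ψ j) + 2 * δ * ψ i +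
        C * ∑ j, ((1 + a j) * q i + (1 + a i) * q j) := fun i => by
      rw [Finset.sum_add_distrib, Finset.sum_add_distrib, ← Finset.mul_sum, ← Finset.mul_sum,
        Finset.sum_ite_eq, if_pos (Finset.mem_univ i)]
    rw [Fintype.sum_prod_type, Finset.sum_congr rfl fun i _ => h i, Finset.sum_add_distrib,
      Finset.sum_add_distrib, ← Finset.mul_sum, ← Finset.mul_sum, ← Finset.mul_sum, e1, e2]
    ring
  have hqs : ∑ l, q l ≤ δ / (8 * C) * ∑ l, ψ l + N * D := by
    calc ∑ l, q l ≤ ∑ l, (δ / (8 * C) * ψ l + D) := Finset.sum_le_sum fun l _ => hPD _ (ha0 l)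
      _ = _ := by rw [Finset.sum_add_distrib, ← Finset.mul_sum]; simp
  have hψs : ∑ l, a l ^ k ≤ ∑ l, ψ l := Finset.sum_le_sum fun l _ =>
    le_mul_of_one_le_right (by have := ha0 l; positivity)
      (Real.one_le_rpow (by linarith [ha0 l]) hγ0)
  have hq00 : 0 ≤ ∑ l, q l := Finset.sum_nonneg fun l _ => hq0 l
  calc _ ≤ ((N : ℝ) - 1)⁻¹ * ((N : ℝ)⁻¹ *
        (-(2 * ((N : ℝ) - 1) * δ) * ∑ l, ψ l + 4 * N * C * ∑ l, q l)) := by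
        rw [← hs, Finset.mul_sum (a := (N : ℝ)⁻¹)]
        exact mul_le_mul_of_nonneg_left (Finset.sum_le_sum fun α _ => hterm α)
          (inv_nonneg.2 hN1.le)
    -- Since `N ≥ 2`, `4N ≤ 8(N - 1)`, so the prefactor cancels uniformly in `N`.
    _ ≤ ((N : ℝ) - 1)⁻¹ * ((N : ℝ)⁻¹ *
        (-(2 * ((N : ℝ) - 1) * δ) * ∑ l, ψ l + 8 * (N - 1) * C * ∑ l, q l)) := by
        refine mul_le_mul_of_nonneg_left (mul_le_mul_of_nonneg_left ?_ (by positivity))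
          (inv_nonneg.2 hN1.le)
        have := mul_nonneg hC.le hq00
        nlinarith
    _ = (N : ℝ)⁻¹ * (-(2 * δ) * ∑ l, ψ l + 8 * C * ∑ l, q l) := by field_simp
    _ ≤ (N : ℝ)⁻¹ * (-(2 * δ) * ∑ l, ψ l + 8 * C * (δ / (8 * C) * ∑ l, ψ l + N * D)) := by
        gcongr
    _ = -δ * ((N : ℝ)⁻¹ * ∑ l, ψ l) + 8 * C * D := by field_simp; ring
    _ ≤ _ := by
        rw [empMoment, neg_mul, neg_mul]
        gcongr

/-! ### Propagation of moments -/

section solution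
variable {N : ℕ} {k γ : ℝ}

/-- Moments stay bounded along a nonnegative solution of mass one, uniformly in `N` and `t`. -/
theorem exists_integral_mul_empMoment_le (hk : 1 < k) (hγ0 : 0 ≤ γ) (hγ1 : γ ≤ 1) :
    ∃ C : ℝ, 0 < C ∧ ∀ N : ℕ, 2 ≤ N → ∀ (F₀ : KacSphere N → ℝ) (F : ℝ → KacSphere N → ℝ),
      IsKacSolution γ F₀ F → (∀ v, 0 ≤ F₀ v) → ∫ v, F₀ v ∂(kacSigma N) = 1 → ∀ t, 0 ≤ t →
      ∫ v, F t v * empMoment k v ∂(kacSigma N) ≤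
        ∫ v, F₀ v * empMoment k v ∂(kacSigma N) + C := by
  obtain ⟨c, C, hc, hC, hgen⟩ := exists_kacGenerator_empMoment_le hk hγ0 hγ1
  refine ⟨C / c, by positivity, fun N hN F₀ F h h0 h1 t ht => ?_⟩
  have hφm := (continuous_empMoment (N := N) hk).measurable
  obtain ⟨A, hA⟩ := isCompact_univ.exists_bound_of_continuousOn
    (continuous_empMoment (N := N) hk).continuousOn
  have hA' : ∀ v : KacSphere N, |empMoment k v| ≤ A := fun v => hA v (Set.mem_univ v)
  obtain ⟨hcont, hd⟩ := h.hasDerivAt_integral_mul hN hγ0 hφm hA'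
  set m : ℝ → ℝ := fun t => ∫ v, F t v * empMoment k v ∂(kacSigma N) with hm
  have hle : ∀ s, 0 < s → ∫ v, F s v * kacGenerator γ (empMoment k) v ∂(kacSigma N) ≤
      -c * m s + C := by
    intro s hs
    obtain ⟨B, hB⟩ := h.exists_bound_at hs.le
    have hB0 : 0 ≤ B := (abs_nonneg _).trans (hB (Classical.choice (KacSphere.nonempty hN)))
    have hFm := h.measurable s hs.le
    have hnn : ∀ v, 0 ≤ F s v := fun v => h.ge_of_ge hN hγ0 h0 hs.le v
    have hmass : ∫ v, F s v ∂(kacSigma N) = 1 := by rw [h.integral_eq hN hγ0 hs.le, h1]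
    have i1 : Integrable (F s) (kacSigma N) := integrable_of_bounded hN hFm hB
    have i2 : Integrable (fun v => F s v * empMoment k v) (kacSigma N) :=
      integrable_of_bounded hN (hFm.mul hφm) (B := B * A) fun v => by
        rw [abs_mul]; exact mul_le_mul (hB v) (hA' v) (abs_nonneg _) hB0
    have i3 : Integrable (fun v => F s v * kacGenerator γ (empMoment k) v) (kacSigma N) :=
      integrable_of_bounded hN (hFm.mul (measurable_kacGenerator hN hφm hA'))
        (B := B * (((N : ℝ) - 1)⁻¹ *
          (Fintype.card (Fin N × Fin N) * ((1 + N + N : ℝ) ^ γ * (2 * A))))) fun v => by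
        rw [abs_mul]
        exact mul_le_mul (hB v) (abs_kacGenerator_le hN hγ0 hφm hA' v) (abs_nonneg _) hB0
    calc _ ≤ ∫ v, (-c * (F s v * empMoment k v) + C * F s v) ∂(kacSigma N) := by
          refine integral_mono i3 ((i2.const_mul _).add (i1.const_mul _)) fun v => ?_
          have := mul_le_mul_of_nonneg_left (hgen N hN v) (hnn v)
          simp only
          linarith
      _ = _ := by
          rw [integral_add (i2.const_mul _) (i1.const_mul _), integral_const_mul,
            integral_const_mul, hmass, mul_one]
  have hexp : ∀ s, HasDerivAt (fun s => Real.exp (c * s)) (Real.exp (c * s) * c) s := fun s => by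
    simpa using ((hasDerivAt_id s).const_mul c).exp
  -- Grönwall for `m' ≤ -c m + C`, whose equilibrium level is `C / c`.
  have hanti := antitoneOn_Ici_of_hasDerivAt (f := fun s => Real.exp (c * s) * (m s - C / c))
    ((Continuous.continuousOn (by fun_prop)).mul (hcont.sub continuousOn_const))
    (fun s hs => (hexp s).mul ((hd s hs).sub_const _)) (fun s hs => by
      have e : Real.exp (c * s) * c * (m s - C / c) +
          Real.exp (c * s) * ∫ v, F s v * kacGenerator γ (empMoment k) v ∂(kacSigma N) =
          Real.exp (c * s) * (c * m s - C +
            ∫ v, F s v * kacGenerator γ (empMoment k) v ∂(kacSigma N)) := by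
        field_simp
      refine e.trans_le (mul_nonpos_of_nonneg_of_nonpos (Real.exp_pos _).le ?_)
      linarith [hle s hs])
  have h2 := hanti (Set.mem_Ici.2 le_rfl) (Set.mem_Ici.2 ht) ht
  simp only [mul_zero, Real.exp_zero, one_mul] at h2
  have hm0 : m 0 = ∫ v, F₀ v * empMoment k v ∂(kacSigma N) := by rw [hm]; simp only [h.initial]
  have hm00 : 0 ≤ m 0 := by
    rw [hm0]; exact integral_nonneg fun v => mul_nonneg (h0 v) (empMoment_nonneg k v)
  change m t ≤ _
  rw [← hm0]
  by_contra hcon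
  push Not at hcon
  have h3 : 1 ≤ Real.exp (c * t) := Real.one_le_exp (by positivity)
  have h4 : 0 < C / c := by positivity
  nlinarith [mul_le_mul_of_nonneg_right h3 (by linarith : 0 ≤ m t - C / c)]

/-- By symmetry all coordinates have the same moment. The symmetric observable is the one to which
the drift inequality applies, while the marginal moment involves a single coordinate. -/
theorem integral_mul_coord_eq_empMoment (hN : 2 ≤ N) (hk : 1 < k) {G : KacSphere N → ℝ}
    (hG : Measurable G) {B : ℝ} (hB : ∀ v, |G v| ≤ B) (hs : IsPermSymmetric G) (i : Fin N) :
    ∫ v, G v * (v.1 i ^ 2) ^ k ∂(kacSigma N) = ∫ v, G v * empMoment k v ∂(kacSigma N) := by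
  have hN0 : (N : ℝ) ≠ 0 := by positivity
  have hI : ∀ l, Integrable (fun v : KacSphere N => G v * (v.1 l ^ 2) ^ k) (kacSigma N) := fun l =>
    integrable_of_bounded hN (hG.mul (continuous_coord_rpow hk l).measurable)
      (B := B * (N : ℝ) ^ k) fun v => by
        rw [abs_mul, abs_of_nonneg (by positivity : 0 ≤ (v.1 l ^ 2) ^ k)]
        exact mul_le_mul (hB v) (Real.rpow_le_rpow (sq_nonneg _) (v.sq_le l) (by linarith))
          (by positivity) ((abs_nonneg _).trans (hB v))
  have heq : ∀ l, ∫ v, G v * (v.1 l ^ 2) ^ k ∂(kacSigma N) =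
      ∫ v, G v * (v.1 i ^ 2) ^ k ∂(kacSigma N) := fun l => by
    rw [← integral_comp_kacPerm (Equiv.swap i l) fun v => G v * (v.1 l ^ 2) ^ k]
    simp only [kacPerm_coord, Equiv.swap_apply_right, (isPermSymmetric_iff G).1 hs]
  simp only [empMoment, Finset.mul_sum]
  rw [integral_finsetSum _ fun l _ => by
    simpa only [mul_left_comm] using (hI l).const_mul (N : ℝ)⁻¹]
  simp only [mul_left_comm (G _), integral_const_mul, heq]
  rw [Finset.sum_const, Finset.card_univ, Fintype.card_fin, nsmul_eq_mul]
  field_simp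

theorem absMoment_firstMarginal_eq (hN : 2 ≤ N) (hk : 1 < k) {G : KacSphere N → ℝ}
    (hG : Measurable G) {B : ℝ} (hB : ∀ v, |G v| ≤ B) (hnn : ∀ v, 0 ≤ G v)
    (hs : IsPermSymmetric G) :
    absMoment (2 * k) (firstMarginal G) =
      ENNReal.ofReal (∫ v, G v * empMoment k v ∂(kacSigma N)) := by
  have hN0 : 0 < N := by omega
  have hfv : (firstVelocity : KacSphere N → ℝ) = fun v => v.1 ⟨0, hN0⟩ := by
    ext v; simp [firstVelocity, hN0]
  have hfm : Measurable (firstVelocity : KacSphere N → ℝ) := by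
    rw [hfv]; exact (KacSphere.continuous_coord _).measurable
  have hpm : Measurable fun x : ℝ => ENNReal.ofReal (|x| ^ (2 * k)) := by fun_prop
  rw [absMoment, firstMarginal, lintegral_map hpm hfm,
    lintegral_withDensity_eq_lintegral_mul _ hG.ennreal_ofReal
      (g := fun v => ENNReal.ofReal (|firstVelocity v| ^ (2 * k))) (hpm.comp hfm),
    ← integral_mul_coord_eq_empMoment hN hk hG hB hs ⟨0, hN0⟩,
    ofReal_integral_eq_lintegral_ofReal]
  · refine lintegral_congr fun v => ?_
    simp only [Pi.mul_apply]
    rw [← ENNReal.ofReal_mul (hnn v), hfv, Real.rpow_mul (abs_nonneg _), Real.rpow_two, sq_abs]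
  · refine integrable_of_bounded hN (hG.mul (continuous_coord_rpow hk _).measurable)
      (B := B * (N : ℝ) ^ k) fun v => ?_
    rw [abs_mul, abs_of_nonneg (by positivity : 0 ≤ (v.1 ⟨0, hN0⟩ ^ 2) ^ k)]
    exact mul_le_mul (hB v) (Real.rpow_le_rpow (sq_nonneg _) (v.sq_le _) (by linarith))
      (by positivity) ((abs_nonneg _).trans (hB v))
  · exact Filter.Eventually.of_forall fun v => mul_nonneg (hnn v) (by positivity)

end solution

/-! ### Entropy production -/

/-- The entropy production of the Kac walk with collision rates `(1 + v_i² + v_j²)^p`. -/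
noncomputable def entropyProduction {N : ℕ} (p : ℝ) (F : KacSphere N → ℝ) : ℝ :=
  ((N : ℝ) - 1)⁻¹ * ∑ α : Fin N × Fin N,
    ∫ v, kacRate p α.1 α.2 v * pairProduction α.1 α.2 F v ∂(kacSigma N)

/-- Split at the threshold `R`: below it the first term suffices, above it the second. -/
theorem le_rpow_interpolation {x R γ k : ℝ} (hx : 0 < x) (hR : 0 < R) (hγ : γ ≤ 1) (hk : 1 < k) :
    x ≤ R ^ (1 - γ) * x ^ γ + R ^ (1 - k) * x ^ k := by
  rcases le_total x R with h | h
  · have e : x = x ^ (1 - γ) * x ^ γ := by rw [← Real.rpow_add hx]; simp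
    calc x = x ^ (1 - γ) * x ^ γ := e
      _ ≤ R ^ (1 - γ) * x ^ γ := by
        gcongr
      _ ≤ _ := le_add_of_nonneg_right (by positivity)
  · have e : x = x ^ (1 - k) * x ^ k := by rw [← Real.rpow_add hx]; simp
    calc x = x ^ (1 - k) * x ^ k := e
      _ ≤ R ^ (1 - k) * x ^ k := mul_le_mul_of_nonneg_right
        (Real.rpow_le_rpow_of_nonpos hR h (by linarith)) (by positivity)
      _ ≤ _ := le_add_of_nonneg_left (by positivity)

theorem rpow_one_add_add_le {k a b : ℝ} (hk : 1 < k) (ha : 0 ≤ a) (hb : 0 ≤ b) :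
    (1 + a + b) ^ k ≤ 3 ^ k * (1 + a ^ k + b ^ k) := by
  have key : ∀ x : ℝ, 0 ≤ x → 1 + a + b ≤ 3 * x → x ^ k ≤ 1 + a ^ k + b ^ k →
      (1 + a + b) ^ k ≤ 3 ^ k * (1 + a ^ k + b ^ k) := by
    intro x hx h1 h2
    calc (1 + a + b) ^ k ≤ (3 * x) ^ k := Real.rpow_le_rpow (by positivity) h1 (by linarith)
      _ = 3 ^ k * x ^ k := Real.mul_rpow (by norm_num) hx
      _ ≤ _ := by gcongr
  have h1 : 0 ≤ a ^ k := by positivity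
  have h2 : 0 ≤ b ^ k := by positivity
  rcases le_total a b with hab | hab
  · rcases le_total 1 b with h | h
    · exact key b hb (by linarith) (by linarith)
    · exact key 1 zero_le_one (by linarith) (by rw [Real.one_rpow]; linarith)
  · rcases le_total 1 a with h | h
    · exact key a ha (by linarith) (by linarith)
    · exact key 1 zero_le_one (by linarith) (by rw [Real.one_rpow]; linarith)

section production
variable {N : ℕ} {F : KacSphere N → ℝ} {a b : ℝ}

theorem integrable_kacRate_mul (hN : 2 ≤ N) {p : ℝ} (hp : 0 ≤ p) (i j : Fin N)
    {G : KacSphere N → ℝ} (hG : Measurable G) {B : ℝ} (hB : ∀ v, |G v| ≤ B) :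
    Integrable (fun v => kacRate p i j v * G v) (kacSigma N) :=
  integrable_of_bounded hN ((continuous_kacRate p i j).measurable.mul hG)
    (B := (1 + N + N : ℝ) ^ p * B) fun v => by
      rw [abs_mul, abs_of_pos (kacRate_pos _ _ _ _)]
      exact mul_le_mul (kacRate_le hp i j v) (hB v) (abs_nonneg _) (by positivity)

theorem abs_pairProduction_le' (i j : Fin N) (hF : Measurable F) (ha : 0 < a)
    (hFb : ∀ v, F v ∈ Set.Icc a b) (v : KacSphere N) :
    |pairProduction i j F v| ≤ (b + b) * (2 * max |Real.log a| |Real.log b|) :=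
  (abs_pairProduction_le i j hF ha hFb v).trans (mul_le_mul_of_nonneg_right
    (add_le_add (hFb v).2 (kacAvg_mem_Icc i j hF hFb v).2) (by positivity))

theorem integrable_kacRate_mul_pairProduction (hN : 2 ≤ N) {p : ℝ} (hp : 0 ≤ p) (i j : Fin N)
    (hF : Measurable F) (ha : 0 < a) (hFb : ∀ v, F v ∈ Set.Icc a b) :
    Integrable (fun v => kacRate p i j v * pairProduction i j F v) (kacSigma N) :=
  integrable_kacRate_mul hN hp i j (measurable_pairProduction i j hF)
    (abs_pairProduction_le' i j hF ha hFb)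

theorem entropyProduction_nonneg (hN : 2 ≤ N) (p : ℝ) (hF : Measurable F) (ha : 0 < a)
    (hFb : ∀ v, F v ∈ Set.Icc a b) : 0 ≤ entropyProduction p F := by
  have hN' : (2 : ℝ) ≤ N := by exact_mod_cast hN
  exact mul_nonneg (inv_nonneg.2 (by linarith)) (Finset.sum_nonneg fun α _ =>
    integral_nonneg fun v => mul_nonneg (kacRate_pos _ _ _ _).le
      (pairProduction_nonneg _ _ hF ha hFb v))

/-- Replace `log F` by `log (E F) + (log F - log (E F))`. The first part multiplies `E F - F` by a
rotation-invariant function and integrates to zero; the second is minus the production. -/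
theorem integral_kacRate_mul_sub_mul_log (hN : 2 ≤ N) {p : ℝ} (hp : 0 ≤ p) (i j : Fin N)
    (hF : Measurable F) (ha : 0 < a) (hFb : ∀ v, F v ∈ Set.Icc a b) :
    Integrable (fun v => kacRate p i j v * (kacAvg i j F v - F v) * (Real.log (F v) + 1))
      (kacSigma N) ∧
    ∫ v, kacRate p i j v * (kacAvg i j F v - F v) * (Real.log (F v) + 1) ∂(kacSigma N) =
      -∫ v, kacRate p i j v * pairProduction i j F v ∂(kacSigma N) := by
  set L := max |Real.log a| |Real.log b| with hL
  have hb : ∀ v, |F v| ≤ max |a| |b| := fun v => abs_le_max_abs_abs (hFb v).1 (hFb v).2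
  have hE := kacAvg_mem_Icc i j hF hFb
  have hEm := measurable_kacAvg i j hF
  have hwb : ∀ v, |kacRate p i j v * (Real.log (kacAvg i j F v) + 1)| ≤
      (1 + N + N : ℝ) ^ p * (L + 1) := fun v => by
    rw [abs_mul, abs_of_pos (kacRate_pos _ _ _ _)]
    refine mul_le_mul (kacRate_le hp i j v) ((abs_add_le _ _).trans ?_) (abs_nonneg _)
      (by positivity)
    rw [abs_one]
    linarith [abs_log_le_of_mem ha (hE v)]
  have hwm : Measurable fun v => kacRate p i j v * (Real.log (kacAvg i j F v) + 1) :=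
    (continuous_kacRate p i j).measurable.mul (hEm.log.add_const 1)
  have hinv := integral_invariant_mul_kacAvg hN i j hwm hF hwb hb fun θ v => by
    rw [kacRate_kacRot, kacAvg_kacRot]
  have hwI : ∀ {G : KacSphere N → ℝ}, Measurable G → (∀ v, |G v| ≤ max |a| |b|) →
      Integrable (fun v => kacRate p i j v * (Real.log (kacAvg i j F v) + 1) * G v) (kacSigma N) :=
    fun hG hGb => integrable_of_bounded hN (hwm.mul hG)
      (B := (1 + N + N : ℝ) ^ p * (L + 1) * max |a| |b|) fun v => by
        rw [abs_mul]
        exact mul_le_mul (hwb v) (hGb v) (abs_nonneg _) ((abs_nonneg _).trans (hwb v))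
  have i1 := hwI hEm (abs_kacAvg_le i j hF hb)
  have i2 := hwI hF hb
  have i3 := integrable_kacRate_mul_pairProduction hN hp i j hF ha hFb
  have e : (fun v => kacRate p i j v * (kacAvg i j F v - F v) * (Real.log (F v) + 1)) =
      fun v => kacRate p i j v * (Real.log (kacAvg i j F v) + 1) * kacAvg i j F v -
        kacRate p i j v * (Real.log (kacAvg i j F v) + 1) * F v -
        kacRate p i j v * pairProduction i j F v := by
    ext v
    rw [pairProduction]
    ring
  rw [e]
  have i12 : Integrable (fun v => kacRate p i j v * (Real.log (kacAvg i j F v) + 1) * kacAvg i j F v -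
      kacRate p i j v * (Real.log (kacAvg i j F v) + 1) * F v) (kacSigma N) := i1.sub i2
  refine ⟨i12.sub i3, ?_⟩
  rw [integral_sub i12 i3, integral_sub i1 i2, hinv, sub_self, zero_sub]

theorem integral_kacGenerator_mul_log (hN : 2 ≤ N) {p : ℝ} (hp : 0 ≤ p) (hF : Measurable F)
    (ha : 0 < a) (hFb : ∀ v, F v ∈ Set.Icc a b) :
    ∫ v, kacGenerator p F v * (Real.log (F v) + 1) ∂(kacSigma N) = -entropyProduction p F := by
  have hb : ∀ v, |F v| ≤ max |a| |b| := fun v => abs_le_max_abs_abs (hFb v).1 (hFb v).2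
  have h := fun i j => integral_kacRate_mul_sub_mul_log hN hp i j hF ha hFb
  have e : ∀ v, kacGenerator p F v * (Real.log (F v) + 1) = ((N : ℝ) - 1)⁻¹ *
      ∑ α : Fin N × Fin N, kacRate p α.1 α.2 v * (kacAvg α.1 α.2 F v - F v) *
        (Real.log (F v) + 1) := fun v => by
    rw [kacGenerator_eq hN hF hb, mul_assoc, Finset.sum_mul]
  simp only [e]
  rw [integral_const_mul, integral_finsetSum _ fun α _ => (h α.1 α.2).1,
    Finset.sum_congr rfl fun α _ => (h α.1 α.2).2, Finset.sum_neg_distrib, mul_neg,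
    entropyProduction]

theorem relEnt_le_entropyProduction_one (hN : 2 ≤ N) (hF : Measurable F)
    (ha : 0 < a) (hFb : ∀ v, F v ∈ Set.Icc a b) : relEnt F ≤ 52 * entropyProduction 1 F := by
  have hN' : (2 : ℝ) ≤ N := by exact_mod_cast hN
  have h := relEnt_le_sum_pairProduction hN hF ha hFb
  have h0 := relEnt_nonneg hN hF ha hFb
  have e : entropyProduction 1 F = ((N : ℝ) - 1)⁻¹ * ∑ α : Fin N × Fin N,
      ∫ v, (1 + v.1 α.1 ^ 2 + v.1 α.2 ^ 2) * pairProduction α.1 α.2 F v ∂(kacSigma N) := by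
    simp only [entropyProduction, kacRate, Real.rpow_one]
  rw [e]
  have h1 : 0 ≤ ((N : ℝ) - 1)⁻¹ := inv_nonneg.2 (by linarith)
  have h2 := mul_le_mul_of_nonneg_left h h1
  have h3 : relEnt F / 52 ≤ ((N : ℝ) - 1)⁻¹ * (N / 52 * relEnt F) := by
    rw [inv_mul_eq_div, le_div_iff₀ (by linarith)]
    nlinarith
  linarith

theorem entropyProduction_one_le (hN : 2 ≤ N) {γ k R : ℝ} (hγ0 : 0 ≤ γ) (hγ1 : γ ≤ 1) (hk : 1 < k)
    (hR : 0 < R) (hF : Measurable F) (ha : 0 < a) (hFb : ∀ v, F v ∈ Set.Icc a b) :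
    entropyProduction 1 F ≤
      R ^ (1 - γ) * entropyProduction γ F + R ^ (1 - k) * entropyProduction k F := by
  have hN' : (2 : ℝ) ≤ N := by exact_mod_cast hN
  have hI := fun {p : ℝ} (hp : 0 ≤ p) (i j : Fin N) =>
    integrable_kacRate_mul_pairProduction hN hp i j hF ha hFb
  have hk0 : 0 ≤ k := by linarith
  have hα : ∀ α : Fin N × Fin N,
      ∫ v, kacRate 1 α.1 α.2 v * pairProduction α.1 α.2 F v ∂(kacSigma N) ≤
      R ^ (1 - γ) * ∫ v, kacRate γ α.1 α.2 v * pairProduction α.1 α.2 F v ∂(kacSigma N) +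
      R ^ (1 - k) * ∫ v, kacRate k α.1 α.2 v * pairProduction α.1 α.2 F v ∂(kacSigma N) := by
    intro α
    have i1 := (hI hγ0 α.1 α.2).const_mul (R ^ (1 - γ))
    have i2 := (hI hk0 α.1 α.2).const_mul (R ^ (1 - k))
    rw [← integral_const_mul, ← integral_const_mul, ← integral_add i1 i2]
    refine integral_mono (hI zero_le_one α.1 α.2) (i1.add i2) fun v => ?_
    have h := le_rpow_interpolation (x := 1 + v.1 α.1 ^ 2 + v.1 α.2 ^ 2) (by positivity) hR hγ1 hk
    have h2 := mul_le_mul_of_nonneg_right h (pairProduction_nonneg α.1 α.2 hF ha hFb v)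
    simp only [kacRate, Real.rpow_one]
    linarith
  have h1 : 0 ≤ ((N : ℝ) - 1)⁻¹ := inv_nonneg.2 (by linarith)
  have h2 := mul_le_mul_of_nonneg_left (Finset.sum_le_sum fun α (_ : α ∈ Finset.univ) => hα α) h1
  rw [Finset.sum_add_distrib, ← Finset.mul_sum, ← Finset.mul_sum, mul_add, mul_left_comm,
    mul_left_comm _ (R ^ (1 - k))] at h2
  exact h2

/-- The logarithms are bounded by `L`, so each production is at most `2L (F + E F)`; against the
invariant rate `E F` integrates like `F`, and the moment bounds the result. The factor `8N` comes
from `4 N² / (N - 1) ≤ 8N`. For a log-scalable family `L` is of order `N`, which makes the bound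
quadratic in `N`. -/
theorem entropyProduction_le_of_moment (hN : 2 ≤ N) {k M : ℝ} (hk : 1 < k)
    (hF : Measurable F) (ha : 0 < a) (hFb : ∀ v, F v ∈ Set.Icc a b)
    (hmass : ∫ v, F v ∂(kacSigma N) = 1)
    (hM : ∀ i : Fin N, ∫ v, F v * (v.1 i ^ 2) ^ k ∂(kacSigma N) ≤ M) :
    entropyProduction k F ≤
      8 * N * max |Real.log a| |Real.log b| * (3 ^ k * (1 + 2 * M)) := by
  have hN' : (2 : ℝ) ≤ N := by exact_mod_cast hN
  have hk0 : 0 ≤ k := by linarith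
  set L := max |Real.log a| |Real.log b| with hL
  have hL0 : 0 ≤ L := (abs_nonneg _).trans (le_max_left _ _)
  have hb : ∀ v, |F v| ≤ max |a| |b| := fun v => abs_le_max_abs_abs (hFb v).1 (hFb v).2
  have hB0 : 0 ≤ max |a| |b| := (abs_nonneg _).trans (le_max_left _ _)
  have hnn : ∀ v, 0 ≤ F v := fun v => ha.le.trans (hFb v).1
  have hI1 := integrable_of_bounded hN hF hb
  have hI2 : ∀ i, Integrable (fun v => F v * (v.1 i ^ 2) ^ k) (kacSigma N) := fun i =>
    integrable_of_bounded hN (hF.mul (continuous_coord_rpow hk i).measurable)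
      (B := max |a| |b| * (N : ℝ) ^ k) fun v => by
        rw [abs_mul, abs_of_nonneg (by positivity : 0 ≤ (v.1 i ^ 2) ^ k)]
        exact mul_le_mul (hb v) (Real.rpow_le_rpow (sq_nonneg _) (v.sq_le i) hk0)
          (by positivity) hB0
  have hM0 : 0 ≤ M := (integral_nonneg fun v => mul_nonneg (hnn v) (by positivity)).trans
    (hM ⟨0, by omega⟩)
  have hwF : ∀ i j : Fin N, ∫ v, kacRate k i j v * F v ∂(kacSigma N) ≤ 3 ^ k * (1 + 2 * M) := by
    intro i j
    have hI12 : Integrable (fun v => F v + F v * (v.1 i ^ 2) ^ k) (kacSigma N) := hI1.add (hI2 i)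
    calc _ ≤ ∫ v, 3 ^ k * (F v + F v * (v.1 i ^ 2) ^ k + F v * (v.1 j ^ 2) ^ k) ∂(kacSigma N) := by
          refine integral_mono (integrable_kacRate_mul hN hk0 i j hF hb)
            ((hI12.add (hI2 j)).const_mul _) fun v => ?_
          have h := mul_le_mul_of_nonneg_left
            (rpow_one_add_add_le hk (sq_nonneg (v.1 i)) (sq_nonneg (v.1 j))) (hnn v)
          simp only [kacRate]
          linarith
      _ = 3 ^ k * (1 + ∫ v, F v * (v.1 i ^ 2) ^ k ∂(kacSigma N) +
            ∫ v, F v * (v.1 j ^ 2) ^ k ∂(kacSigma N)) := by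
          rw [integral_const_mul, integral_add hI12 (hI2 j), integral_add hI1 (hI2 i),
            hmass]
      _ ≤ _ := by
          refine mul_le_mul_of_nonneg_left ?_ (by positivity)
          linarith [hM i, hM j]
  have hα : ∀ α : Fin N × Fin N,
      ∫ v, kacRate k α.1 α.2 v * pairProduction α.1 α.2 F v ∂(kacSigma N) ≤
        4 * L * (3 ^ k * (1 + 2 * M)) := by
    rintro ⟨i, j⟩
    simp only
    have i1 := integrable_kacRate_mul hN hk0 i j hF hb
    have i2 := integrable_kacRate_mul hN hk0 i j (measurable_kacAvg i j hF)
      (abs_kacAvg_le i j hF hb)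
    have hrb : ∀ v : KacSphere N, |kacRate k i j v| ≤ (1 + N + N : ℝ) ^ k := fun v => by
      rw [abs_of_pos (kacRate_pos _ _ _ _)]; exact kacRate_le hk0 i j v
    calc _ ≤ ∫ v, 2 * L * (kacRate k i j v * F v + kacRate k i j v * kacAvg i j F v)
          ∂(kacSigma N) := by
          refine integral_mono (integrable_kacRate_mul_pairProduction hN hk0 i j hF ha hFb)
            ((i1.add i2).const_mul _) fun v => ?_
          have h := mul_le_mul_of_nonneg_left ((le_abs_self _).trans
            (abs_pairProduction_le i j hF ha hFb v)) (kacRate_pos k i j v).le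
          simp only
          linarith
      _ = 4 * L * ∫ v, kacRate k i j v * F v ∂(kacSigma N) := by
          rw [integral_const_mul, integral_add i1 i2,
            integral_invariant_mul_kacAvg hN i j (continuous_kacRate k i j).measurable hF hrb hb
              (kacRate_kacRot k i j)]
          ring
      _ ≤ _ := mul_le_mul_of_nonneg_left (hwF i j) (by positivity)
  have hsum := Finset.sum_le_card_nsmul Finset.univ _ _ fun α (_ : α ∈ Finset.univ) => hα α
  rw [Finset.card_univ, Fintype.card_prod, Fintype.card_fin, nsmul_eq_mul] at hsum
  have h1 : 0 < (N : ℝ) - 1 := by linarith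
  rw [entropyProduction, inv_mul_le_iff₀ h1]
  refine hsum.trans ?_
  push_cast
  have hK : 0 ≤ L * (3 ^ k * (1 + 2 * M)) := by positivity
  nlinarith [mul_nonneg (mul_nonneg (by linarith : (0 : ℝ) ≤ N) (by linarith : (0 : ℝ) ≤ N - 2)) hK]

end production

/-! ### Entropy dissipation along solutions -/

section decay
variable {N : ℕ} {γ k : ℝ} {F₀ : KacSphere N → ℝ} {F : ℝ → KacSphere N → ℝ} {a b : ℝ}

theorem relEnt_eq_kacEntropy {F : KacSphere N → ℝ} (hmass : ∫ v, F v ∂(kacSigma N) = 1) :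
    relEnt F = kacEntropy F := by
  rw [relEnt, hmass, Real.log_one, mul_zero, sub_zero, kacEntropy]

theorem IsKacSolution.mem_Icc (hN : 2 ≤ N) (hγ : 0 ≤ γ) (h : IsKacSolution γ F₀ F)
    (hFb : ∀ v, F₀ v ∈ Set.Icc a b) {t : ℝ} (ht : 0 ≤ t) (v : KacSphere N) :
    F t v ∈ Set.Icc a b :=
  ⟨h.ge_of_ge hN hγ (fun v => (hFb v).1) ht v, h.le_of_le hN hγ (fun v => (hFb v).2) ht v⟩

/-- The `H`-theorem for the Kac master equation. -/
theorem IsKacSolution.hasDerivAt_kacEntropy (hN : 2 ≤ N) (hγ : 0 ≤ γ) (h : IsKacSolution γ F₀ F)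
    (ha : 0 < a) (hFb : ∀ v, F₀ v ∈ Set.Icc a b) :
    ContinuousOn (fun t => kacEntropy (F t)) (Set.Ici 0) ∧
    ∀ t, 0 < t → HasDerivAt (fun t => kacEntropy (F t)) (-entropyProduction γ (F t)) t := by
  have := isProbabilityMeasure_kacSigma hN
  have hmem : ∀ {t}, 0 ≤ t → ∀ v, F t v ∈ Set.Icc a b := fun ht => h.mem_Icc hN hγ hFb ht
  have hb : ∀ {t}, 0 ≤ t → ∀ v, |F t v| ≤ max |a| |b| :=
    fun ht v => abs_le_max_abs_abs (hmem ht v).1 (hmem ht v).2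
  have hB0 : 0 ≤ max |a| |b| := (abs_nonneg _).trans (le_max_left _ _)
  obtain ⟨h1, h2⟩ := hasDerivAt_integral_of_bounded (μ := kacSigma N)
    (f := fun t v => F t v * Real.log (F t v))
    (f' := fun t v => kacGenerator γ (F t) v * (Real.log (F t v) + 1))
    (fun t ht => (h.measurable t ht).mul (h.measurable t ht).log)
    (fun t ht => (measurable_kacGenerator hN (h.measurable t ht.le) (hb ht.le)).mul
      ((h.measurable t ht.le).log.add_const 1))
    (fun T => ⟨max |a| |b| * max |Real.log a| |Real.log b|, fun t h0 _ v => by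
      rw [abs_mul]
      exact mul_le_mul (hb h0 v) (abs_log_le_of_mem ha (hmem h0 v)) (abs_nonneg _) hB0⟩)
    (fun T => ⟨((N : ℝ) - 1)⁻¹ *
      (Fintype.card (Fin N × Fin N) * ((1 + N + N : ℝ) ^ γ * (2 * max |a| |b|))) *
        (max |Real.log a| |Real.log b| + 1), fun t h0 _ v => by
      have hg := abs_kacGenerator_le hN hγ (h.measurable t h0.le) (hb h0.le) v
      rw [abs_mul]
      refine mul_le_mul hg ((abs_add_le _ _).trans ?_) (abs_nonneg _) ((abs_nonneg _).trans hg)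
      rw [abs_one]
      linarith [abs_log_le_of_mem ha (hmem h0.le v)]⟩)
    (fun v => (h.continuousOn v).mul ((h.continuousOn v).log fun t ht =>
      (ha.trans_le (hmem ht v).1).ne'))
    (fun t ht v => by
      have hd := h.hasDerivAt ht v
      have hpos := ha.trans_le (hmem ht.le v).1
      refine (hd.mul (hd.log hpos.ne')).congr_deriv ?_
      field_simp)
  refine ⟨h1, fun t ht => ?_⟩
  rw [← integral_kacGenerator_mul_log hN hγ (h.measurable t ht.le) ha (hmem ht.le)]
  exact h2 t ht

/-- While `h` is positive, the inequality says that `h ^ (-β)` has derivative at least `β c`. -/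
theorem rpow_neg_ge_of_deriv_le {h h' : ℝ → ℝ} {β c t : ℝ} (hβ : 0 < β) (ht : 0 ≤ t)
    (hc : ContinuousOn h (Set.Ici 0)) (hd : ∀ s, 0 < s → HasDerivAt h (h' s) s)
    (hpos : ∀ s, 0 ≤ s → s ≤ t → 0 < h s)
    (hle : ∀ s, 0 < s → s ≤ t → h' s ≤ -c * h s ^ (1 + β)) :
    h 0 ^ (-β) + β * c * t ≤ h t ^ (-β) := by
  have hder : ∀ s, 0 < s → s ≤ t → HasDerivAt (fun s => h s ^ (-β) - β * c * s)
      (h' s * -β * h s ^ (-β - 1) - β * c * 1) s := fun s h0 h1 =>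
    ((hd s h0).rpow_const (Or.inl (hpos s h0.le h1).ne')).sub ((hasDerivAt_id s).const_mul _)
  have hmono : MonotoneOn (fun s => h s ^ (-β) - β * c * s) (Set.Icc 0 t) := by
    refine monotoneOn_of_deriv_nonneg (convex_Icc 0 t) ?_ ?_ ?_
    · refine ContinuousOn.sub ?_ (Continuous.continuousOn (by fun_prop))
      exact (hc.mono fun s hs => hs.1).rpow_const fun s hs => Or.inl (hpos s hs.1 hs.2).ne'
    · intro s hs
      rw [interior_Icc] at hs
      exact (hder s hs.1 hs.2.le).differentiableAt.differentiableWithinAt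
    · intro s hs
      rw [interior_Icc] at hs
      rw [(hder s hs.1 hs.2.le).deriv]
      have hp := hpos s hs.1.le hs.2.le
      have h1 := hle s hs.1 hs.2.le
      have h2 : h s ^ (1 + β) * h s ^ (-β - 1) = 1 := by
        rw [← Real.rpow_add hp]; ring_nf; simp
      have h3 : 0 ≤ β * h s ^ (-β - 1) := by positivity
      have h4 := mul_le_mul_of_nonneg_right h1 h3
      have h5 : -c * h s ^ (1 + β) * (β * h s ^ (-β - 1)) = -(β * c) := by
        linear_combination (-c * β) * h2
      rw [h5] at h4
      linarith
  have := hmono (Set.left_mem_Icc.2 ht) (Set.right_mem_Icc.2 ht) ht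
  simp only [mul_zero, sub_zero] at this
  linarith

end decay

/-! ### Polynomial decay of the entropy -/

/-- Interpolates between the production of order `γ`, to be bounded below, and that of order `k`, at
most `K N²`, in the inequality `H ≤ 52 D_1`. -/
theorem relEnt_rpow_le_entropyProduction {N : ℕ} (hN : 2 ≤ N) {γ k K a b : ℝ} (hγ0 : 0 ≤ γ)
    (hγ1 : γ ≤ 1) (hk : 1 < k) (hK : 0 < K) {F : KacSphere N → ℝ} (hF : Measurable F) (ha : 0 < a)
    (hFb : ∀ v, F v ∈ Set.Icc a b) (hD : entropyProduction k F ≤ K * (N : ℝ) ^ 2)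
    (hH : 0 < relEnt F) :
    104⁻¹ * (104 * K) ^ (-((1 - γ) / (k - 1))) * (N : ℝ) ^ (-((1 - γ) / (k - 1))) *
      (relEnt F / N) ^ (1 + (1 - γ) / (k - 1)) ≤ entropyProduction γ F / N := by
  have hN' : (2 : ℝ) ≤ N := by exact_mod_cast hN
  have hN0 : (0 : ℝ) < N := by linarith
  have hk1 : 0 < k - 1 := by linarith
  set H := relEnt F with hHdef
  set β := (1 - γ) / (k - 1) with hβ
  -- Chosen so that the `k` term, after multiplication by `52`, takes at most half of `H`; the
  -- remaining half gives the factor `104⁻¹`.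
  set Q : ℝ := 104 * K * N ^ 2 / H with hQ
  have hQ0 : 0 < Q := by positivity
  set R : ℝ := Q ^ (1 / (k - 1)) with hR
  have hR0 : 0 < R := by positivity
  have hRk : R ^ (1 - k) = Q⁻¹ := by
    rw [hR, ← Real.rpow_mul hQ0.le, ← Real.rpow_neg_one]
    congr 1
    field_simp
    ring
  have hRγ : R ^ (1 - γ) = Q ^ β := by
    rw [hR, ← Real.rpow_mul hQ0.le, hβ]
    congr 1
    field_simp
  have h1 := relEnt_le_entropyProduction_one hN hF ha hFb
  have h2 := entropyProduction_one_le hN hγ0 hγ1 hk hR0 hF ha hFb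
  rw [hRk, hRγ] at h2
  have h3 : Q⁻¹ * entropyProduction k F ≤ H / 104 := by
    calc Q⁻¹ * entropyProduction k F ≤ Q⁻¹ * (K * (N : ℝ) ^ 2) := by gcongr
      _ = H / 104 := by rw [hQ]; field_simp
  have h4 : H / 104 ≤ Q ^ β * entropyProduction γ F := by linarith
  have h5 : Q = 104 * K * N * (H / N)⁻¹ := by rw [hQ]; field_simp
  have hh : 0 < H / N := by positivity
  have h6 : Q ^ (-β) = (104 * K) ^ (-β) * (N : ℝ) ^ (-β) * (H / N) ^ β := by
    rw [h5, Real.mul_rpow (by positivity) (by positivity), Real.mul_rpow (by positivity)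
      (by positivity), Real.inv_rpow hh.le, Real.rpow_neg hh.le, inv_inv]
  have h7 : Q ^ (-β) * (H / 104) ≤ entropyProduction γ F := by
    rw [Real.rpow_neg hQ0.le, inv_mul_le_iff₀ (by positivity)]
    exact h4
  rw [Real.rpow_one_add' hh.le (by
    have : 0 ≤ β := div_nonneg (by linarith) hk1.le
    linarith)]
  calc _ = Q ^ (-β) * (H / 104) / N := by rw [h6]; ring
    _ ≤ _ := by gcongr

theorem LogScalableWith.mem_Icc {C : ℝ} {F : (N : ℕ) → KacSphere N → ℝ} (h : LogScalableWith C F)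
    {N : ℕ} (hN : 2 ≤ N) (v : KacSphere N) :
    F N v ∈ Set.Icc (Real.exp (-(C * N))) (Real.exp (C * N)) := by
  obtain ⟨hpos, hlog⟩ := (h.2 N hN).2 v
  rw [abs_le] at hlog
  exact ⟨(Real.le_log_iff_exp_le hpos).1 hlog.1, (Real.log_le_iff_le_exp hpos).1 hlog.2⟩

/-! ### Families of solutions: log-scalability, moments and entropy -/

section family
variable {γ k C_F : ℝ} {F₀ : (N : ℕ) → KacSphere N → ℝ} {F : (N : ℕ) → ℝ → KacSphere N → ℝ}

/-- Log-scalability is a two-sided bound by the constants `exp (± C_F N)`; constants solve the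
equation, so comparison preserves both bounds. -/
theorem LogScalableWith.of_isKacSolution (hγ : 0 ≤ γ) (hlog : LogScalableWith C_F F₀)
    (hsol : ∀ N : ℕ, 2 ≤ N → IsKacSolution γ (F₀ N) (F N)) {t : ℝ} (ht : 0 ≤ t) :
    LogScalableWith C_F (fun N => F N t) := by
  refine ⟨hlog.1, fun N hN => ?_⟩
  have hmem := (hsol N hN).mem_Icc hN hγ (hlog.mem_Icc hN) ht
  have hpos : ∀ v, 0 < F N t v := fun v => (Real.exp_pos _).trans_le (hmem v).1
  refine ⟨⟨(hsol N hN).measurable t ht, fun v => (hpos v).le, ?_⟩, fun v => ⟨hpos v, ?_⟩⟩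
  · rw [(hsol N hN).integral_eq hN hγ ht, (hlog.2 N hN).1.integral_eq_one]
  · rw [abs_le]
    exact ⟨(Real.le_log_iff_exp_le (hpos v)).2 (hmem v).1,
      (Real.log_le_iff_le_exp (hpos v)).2 (hmem v).2⟩

/-- Uniform propagation of the moments. -/
theorem exists_uniform_moment_bound (hγ0 : 0 ≤ γ) (hγ1 : γ ≤ 1) (hk : 1 < k)
    (hsymm : ∀ N : ℕ, 2 ≤ N → IsPermSymmetric (F₀ N)) (hlog : LogScalableWith C_F F₀)
    (hmom : supMarginalMoment (2 * k) F₀ < ∞)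
    (hsol : ∀ N : ℕ, 2 ≤ N → IsKacSolution γ (F₀ N) (F N)) :
    ∃ M : ℝ, 0 ≤ M ∧ ∀ N : ℕ, 2 ≤ N → ∀ t, 0 ≤ t →
      ∫ v, F N t v * empMoment k v ∂(kacSigma N) ≤ M := by
  obtain ⟨C, hC, hbound⟩ := exists_integral_mul_empMoment_le hk hγ0 hγ1
  refine ⟨(supMarginalMoment (2 * k) F₀).toReal + C, by positivity, fun N hN t ht => ?_⟩
  have hd := hlog.2 N hN
  refine (hbound N hN _ _ (hsol N hN) hd.1.nonneg hd.1.integral_eq_one t ht).trans ?_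
  have hb : ∀ v, |F₀ N v| ≤ Real.exp (C_F * N) := fun v => by
    rw [abs_of_nonneg (hd.1.nonneg v)]; exact (hlog.mem_Icc hN v).2
  have h1 : absMoment (2 * k) (firstMarginal (F₀ N)) ≤ supMarginalMoment (2 * k) F₀ :=
    le_iSup₂_of_le N hN le_rfl
  rw [absMoment_firstMarginal_eq hN hk hd.1.measurable hb hd.1.nonneg (hsymm N hN),
    ENNReal.ofReal_le_iff_le_toReal hmom.ne] at h1
  linarith

theorem supMarginalMomentInTime_lt_top (hγ0 : 0 ≤ γ) (hk : 1 < k)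
    (hsymm : ∀ N : ℕ, 2 ≤ N → IsPermSymmetric (F₀ N)) (hlog : LogScalableWith C_F F₀)
    (hsol : ∀ N : ℕ, 2 ≤ N → IsKacSolution γ (F₀ N) (F N)) {M : ℝ}
    (hM : ∀ N : ℕ, 2 ≤ N → ∀ t, 0 ≤ t → ∫ v, F N t v * empMoment k v ∂(kacSigma N) ≤ M) :
    supMarginalMomentInTime (2 * k) F < ∞ := by
  refine lt_of_le_of_lt (?_ : _ ≤ ENNReal.ofReal M) ENNReal.ofReal_lt_top
  refine iSup₂_le fun N hN => iSup₂_le fun t ht => ?_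
  have hmem := (hsol N hN).mem_Icc hN hγ0 (hlog.mem_Icc hN) ht
  have hnn : ∀ v, 0 ≤ F N t v := fun v => (Real.exp_pos _).le.trans (hmem v).1
  rw [absMoment_firstMarginal_eq hN hk ((hsol N hN).measurable t ht)
    (fun v => by rw [abs_of_nonneg (hnn v)]; exact (hmem v).2) hnn
    ((hsol N hN).isPermSymmetric hN hγ0 (hsymm N hN) ht)]
  exact ENNReal.ofReal_le_ofReal (hM N hN t ht)

theorem kacEntropy_decay (hγ0 : 0 ≤ γ) (hγ1 : γ < 1) (hk : 1 < k)
    (hsymm : ∀ N : ℕ, 2 ≤ N → IsPermSymmetric (F₀ N)) (hlog : LogScalableWith C_F F₀)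
    (hsol : ∀ N : ℕ, 2 ≤ N → IsKacSolution γ (F₀ N) (F N)) {M : ℝ} (hM0 : 0 ≤ M)
    (hM : ∀ N : ℕ, 2 ≤ N → ∀ t, 0 ≤ t → ∫ v, F N t v * empMoment k v ∂(kacSigma N) ≤ M) :
    ∃ C : ℝ, 0 < C ∧ ∀ N : ℕ, 2 ≤ N → ∀ t : ℝ, 0 ≤ t →
      kacEntropy (F N t) / N ≤
        ((kacEntropy (F₀ N) / N) ^ ((γ - 1) / (k - 1)) +
          C * (N : ℝ) ^ ((γ - 1) / (k - 1)) * t) ^ (-(k - 1) / (1 - γ)) ∧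
      (kacEntropy (F₀ N) = 0 → kacEntropy (F N t) = 0) := by
  have hC := hlog.1
  have hk1 : 0 < k - 1 := by linarith
  have hg1 : 0 < 1 - γ := by linarith
  set β := (1 - γ) / (k - 1) with hβ
  have hβ0 : 0 < β := by positivity
  have hβ1 : (γ - 1) / (k - 1) = -β := by rw [hβ, ← neg_div]; ring
  have hβ2 : -(k - 1) / (1 - γ) = (-β)⁻¹ := by rw [hβ, inv_neg, inv_div, neg_div]
  -- The moment bound on the production of order `k`, with logarithms bounded by `C_F N`, divided by
  -- `N²`.
  set K : ℝ := 8 * C_F * (3 ^ k * (1 + 2 * M)) with hK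
  have hK0 : 0 < K := by positivity
  set c : ℝ := 104⁻¹ * (104 * K) ^ (-β) with hc
  have hc0 : 0 < c := by positivity
  refine ⟨β * c, by positivity, fun N hN => ?_⟩
  have hN' : (2 : ℝ) ≤ N := by exact_mod_cast hN
  have hN0 : (0 : ℝ) < N := by linarith
  have h := hsol N hN
  have ha : 0 < Real.exp (-(C_F * N)) := Real.exp_pos _
  have hmem : ∀ {t}, 0 ≤ t → ∀ v, F N t v ∈ Set.Icc (Real.exp (-(C_F * N))) (Real.exp (C_F * N)) :=
    fun ht => h.mem_Icc hN hγ0 (hlog.mem_Icc hN) ht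
  have hmass : ∀ {t}, 0 ≤ t → ∫ v, F N t v ∂(kacSigma N) = 1 := fun ht => by
    rw [h.integral_eq hN hγ0 ht, (hlog.2 N hN).1.integral_eq_one]
  have hrel : ∀ {t}, 0 ≤ t → relEnt (F N t) = kacEntropy (F N t) :=
    fun ht => relEnt_eq_kacEntropy (hmass ht)
  have hnn : ∀ {t}, 0 ≤ t → 0 ≤ kacEntropy (F N t) := fun ht => by
    rw [← hrel ht]; exact relEnt_nonneg hN (h.measurable _ ht) ha (hmem ht)
  obtain ⟨hcont, hder⟩ := h.hasDerivAt_kacEntropy hN hγ0 ha (hlog.mem_Icc hN)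
  have hanti : AntitoneOn (fun t => kacEntropy (F N t)) (Set.Ici 0) :=
    antitoneOn_Ici_of_hasDerivAt hcont hder fun t ht => neg_nonpos.2
      (entropyProduction_nonneg hN γ (h.measurable t ht.le) ha (hmem ht.le))
  intro t ht
  have h0t : kacEntropy (F N t) ≤ kacEntropy (F₀ N) := by
    rw [← h.initial]; exact hanti (Set.mem_Ici.2 le_rfl) (Set.mem_Ici.2 ht) ht
  have h00 : 0 ≤ kacEntropy (F₀ N) := (hnn ht).trans h0t
  refine ⟨?_, fun hz => le_antisymm (h0t.trans_eq hz) (hnn ht)⟩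
  rw [hβ1, hβ2]
  -- If the entropy has vanished by time `t`, the claim is only that the right side is nonnegative.
  -- Otherwise monotonicity keeps the entropy positive on `[0, t]`, as the differential inequality
  -- requires.
  rcases (hnn ht).eq_or_lt with hz | hpos
  · rw [← hz, zero_div]
    positivity
  have hDk : ∀ s, 0 < s → entropyProduction k (F N s) ≤ K * (N : ℝ) ^ 2 := by
    intro s hs
    have hFm := h.measurable s hs.le
    refine (entropyProduction_le_of_moment (M := M) hN hk hFm ha (hmem hs.le) (hmass hs.le)
      fun i => ?_).trans (le_of_eq ?_)
    · rw [integral_mul_coord_eq_empMoment hN hk hFm (fun v => ?_)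
        (h.isPermSymmetric hN hγ0 (hsymm N hN) hs.le)]
      · exact hM N hN s hs.le
      · exact Real.exp (C_F * N)
      · rw [abs_of_nonneg (ha.le.trans (hmem hs.le v).1)]; exact (hmem hs.le v).2
    · rw [Real.log_exp, Real.log_exp, abs_neg, max_self, abs_of_pos (by positivity), hK]
      ring
  have key := rpow_neg_ge_of_deriv_le (h := fun t => kacEntropy (F N t) / N)
    (h' := fun t => -entropyProduction γ (F N t) / N) (c := c * (N : ℝ) ^ (-β)) hβ0 ht
    (hcont.div_const _) (fun s hs => (hder s hs).div_const _)
    (fun s h0 h1 => div_pos (hpos.trans_le (hanti (Set.mem_Ici.2 h0) (Set.mem_Ici.2 ht) h1)) hN0)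
    (fun s h0 h1 => by
      have hs : 0 < kacEntropy (F N s) :=
        hpos.trans_le (hanti (Set.mem_Ici.2 h0.le) (Set.mem_Ici.2 ht) h1)
      have := relEnt_rpow_le_entropyProduction hN hγ0 hγ1.le hk hK0 (h.measurable s h0.le) ha
        (hmem h0.le) (hDk s h0) (by rwa [hrel h0.le])
      rw [hrel h0.le] at this
      rw [neg_div, neg_mul]
      exact neg_le_neg this)
  simp only [h.initial] at key
  have hh : 0 < kacEntropy (F N t) / N := by positivity
  have hh0 : 0 < kacEntropy (F₀ N) / N := div_pos (hpos.trans_le h0t) hN0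
  calc kacEntropy (F N t) / N = ((kacEntropy (F N t) / N) ^ (-β)) ^ (-β)⁻¹ := by
        rw [Real.rpow_rpow_inv hh.le (by linarith)]
    _ ≤ _ := Real.rpow_le_rpow_of_nonpos (by positivity) (by linarith)
        (inv_nonpos.2 (by linarith))

end family

/-- The last conjunct carries the convention for `H_N(F_N) = 0`: there `0` to a negative power is
`0` by default, and the displayed bound alone would not force the entropy to remain zero. -/
theorem mainTheorem4 (γ k C_F : ℝ) (hγ0 : 0 ≤ γ) (hγ1 : γ ≤ 1) (hk : 1 < k)
    (F₀ : (N : ℕ) → KacSphere N → ℝ)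
    (hsymm : ∀ N : ℕ, 2 ≤ N → IsPermSymmetric (F₀ N))
    (hlog : LogScalableWith C_F F₀)
    (hmom : supMarginalMoment (2 * k) F₀ < ∞)
    (F : (N : ℕ) → ℝ → KacSphere N → ℝ)
    (hsol : ∀ N : ℕ, 2 ≤ N → IsKacSolution γ (F₀ N) (F N)) :
    (∀ t : ℝ, 0 ≤ t → LogScalableWith C_F (fun N => F N t)) ∧
    supMarginalMomentInTime (2 * k) F < ∞ ∧
    (γ < 1 → ∃ C : ℝ, 0 < C ∧ ∀ N : ℕ, 2 ≤ N → ∀ t : ℝ, 0 ≤ t →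
      kacEntropy (F N t) / N ≤
        ((kacEntropy (F₀ N) / N) ^ ((γ - 1) / (k - 1)) +
          C * (N : ℝ) ^ ((γ - 1) / (k - 1)) * t) ^ (-(k - 1) / (1 - γ)) ∧
      (kacEntropy (F₀ N) = 0 → kacEntropy (F N t) = 0)) := by
  obtain ⟨M, hM0, hM⟩ := exists_uniform_moment_bound hγ0 hγ1 hk hsymm hlog hmom hsol
  exact ⟨fun t ht => hlog.of_isKacSolution hγ0 hsol ht,
    supMarginalMomentInTime_lt_top hγ0 hk hsymm hlog hsol hM,
    fun hγ => kacEntropy_decay hγ0 hγ hk hsymm hlog hsol hM0 hM⟩
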